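/- Let $n\ge 1$ and $r\ge 1$ be integers with $\gcd(r,n)=1$, and put $k=r/n$. Let $\mathfrak h=\mathbb C^n/\Delta$, where $\Delta=\mathbb C(1,\dots,1)$, be the reflection representation of $S_n$, let $y_i\in\mathfrak h$ be the class of the $i$-th standard basis vector, $\alpha_{ij}=x_i-x_j\in\mathfrak h^*$ and $\alpha_{ij}^\vee=y_i-y_j\in\mathfrak h$. Let $H_k(n)$ be the rational Cherednik algebra, i.e. the quotient of $\mathbb C S_n\ltimes T(\mathfrak h\oplus\mathfrak h^*)$ by the relations $[x,x']=0$, $[y,y']=0$ and $$[y,x]=(y,x)-k\sum_{i<j}(y,\alpha_{ij})(x,\alpha_{ij}^\vee)\,s_{ij}\qquad (x,x'\in\mathfrak h^*,\ y,y'\in\mathfrak h),$$ where $s_{ij}\in S_n$ is the transposition of $i$ and $j$. For a representation $\tau$ of $S_n$ let $M_k(\tau)=H_k(n)\otimes_{\mathbb C S_n\ltimes\mathbb C[\mathfrak h^*]}\tau$ be the standard module, where $\mathfrak h$ acts on $\tau$ by $0$. Let $M_k=M_k(\mathbb C)$ be the polynomial representation ($\mathbb C$ being the trivial representation), identified with $\mathbb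 C[\mathfrak h]$, the algebra of translation-invariant polynomials in $x_1,\dots,x_n$. Let $I_k\subset M_k$ be the $H_k(n)$-submodule generated by $$f_i=\operatorname{Res}_{z=\infty}\,[(z-x_1)\cdots(z-x_n)]^{r/n}\,\frac{dz}{z-x_i},\qquad i=1,\dots,n,$$ where the power is expanded at $z=\infty$ with leading term $z^r$, and let $V_k=M_k/I_k$. Let $$\mathbf h=\sum_a \xi_a\eta_a+\frac{n-1}{2}-k\sum_{i<j}s_{ij}\in H_k(n),$$ where $(\eta_a)$ is a basis of $\mathfrak h$ and $(\xi_a)$ is the dual basis of $\mathfrak h^*$. Then: (1) $V_k$ is finite dimensional over $\mathbb C$. (2) $V_k$ is an irreducible $H_k(n)$-module. (3) $V_k$ has a BGG type resolution: there is an exact sequence of $H_k(n)$-modules $$0\leftarrow V_k\leftarrow M_k=M_k(\wedge^0\mathfrak h)\leftarrow M_k(\mathfrak h)\leftarrow M_k(\wedge^2\mathfrak h)\leftarrow\cdots\leftarrow M_k(\wedge^{n-1}\mathfrak h)\leftarrow 0,$$ in which $M_k\to V_k$ is the projection and $M_k(\mathfrak h)\to M_k$ sends $1\otimes y_i$ to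 $f_i$ for every $i$. (4) For $g\in S_n$ the character $\chi_{V_k}(g,t)=\operatorname{Tr}|_{V_k}(g\,t^{\mathbf h})=\sum_\mu \operatorname{Tr}(g|_{V_k[\mu]})\,t^\mu$, where $V_k[\mu]$ is the generalized $\mu$-eigenspace of $\mathbf h$, is $$\chi_{V_k}(g,t)=t^{(1-r)(n-1)/2}\,\frac{\det|_{\mathfrak h}(1-g\,t^r)}{\det|_{\mathfrak h}(1-g\,t)}\qquad (t>0,\ t\ne 1).$$ (5) $\dim V_k=r^{n-1}$. -/

import Mathlib

noncomputable section

open scoped TensorProduct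

namespace Cherednik

/-! ### The reflection representation of `S_n` on `𝔥 = ℂⁿ / Δ` -/

/-- The space `𝔥 = ℂⁿ / Δ`, where `Δ = ℂ · (1, …, 1)` is the diagonal. -/
abbrev Hsp (n : ℕ) : Type :=
  (Fin n → ℂ) ⧸ Submodule.span ℂ {(1 : Fin n → ℂ)}

/-- The class in `𝔥` of the `i`-th standard basis vector of `ℂⁿ`. -/
def yvec (n : ℕ) (i : Fin n) : Hsp n :=
  Submodule.Quotient.mk (Pi.single i 1)

/-- The permutation action of `S_n` on `ℂⁿ`: `(σ a)_i = a_{σ⁻¹ i}`, so `σ e_i = e_{σ i}`. -/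
def permRep (n : ℕ) : Representation ℂ (Equiv.Perm (Fin n)) (Fin n → ℂ) where
  toFun σ := LinearMap.funLeft ℂ ℂ (σ⁻¹ : Equiv.Perm (Fin n))
  map_one' := by ext; simp [LinearMap.funLeft]
  map_mul' σ τ := by ext; simp [LinearMap.funLeft]

theorem permRep_mem (n : ℕ) (σ : Equiv.Perm (Fin n)) :
    Submodule.span ℂ {(1 : Fin n → ℂ)} ≤
      (Submodule.span ℂ {(1 : Fin n → ℂ)}).comap (permRep n σ) := by
  rw [Submodule.span_le]
  rintro _ rfl
  exact Submodule.mem_span_singleton_self _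

/-- The reflection representation of `S_n` on `𝔥 = ℂⁿ / Δ`. -/
def reflRep (n : ℕ) : Representation ℂ (Equiv.Perm (Fin n)) (Hsp n) where
  toFun σ := Submodule.mapQ _ _ (permRep n σ) (permRep_mem n σ)
  map_one' := by
    apply Submodule.linearMap_qext
    ext; simp
  map_mul' σ τ := by
    apply Submodule.linearMap_qext
    ext; simp

/-- The root `α_{ij} = x_i - x_j ∈ 𝔥*`. -/
def root (n : ℕ) (i j : Fin n) : Module.Dual ℂ (Hsp n) :=
  Submodule.liftQ _ ((LinearMap.proj i : (Fin n → ℂ) →ₗ[ℂ] ℂ) - LinearMap.proj j) (by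
    rw [Submodule.span_le]
    rintro _ rfl
    simp)

/-- The coroot `α_{ij}^∨ = y_i - y_j ∈ 𝔥`; it satisfies `(α_{ij}, α_{ij}^∨) = 2` for `i ≠ j`. -/
def coroot (n : ℕ) (i j : Fin n) : Hsp n := yvec n i - yvec n j

/-- The linear function `x̃_i = x_i - (x_1 + ⋯ + x_n) / n` on `𝔥 = ℂⁿ / Δ`. -/
def xfun (n : ℕ) (i : Fin n) : Module.Dual ℂ (Hsp n) :=
  Submodule.liftQ _ ((LinearMap.proj i : (Fin n → ℂ) →ₗ[ℂ] ℂ) -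
    (n : ℂ)⁻¹ • ∑ j, LinearMap.proj j) (by
    rw [Submodule.span_le]
    rintro _ rfl
    have hn : (n : ℂ) ≠ 0 := by
      have := i.pos
      exact_mod_cast this.ne'
    simp [hn])

/-- The index set of the reflections of `S_n`: the pairs `i < j`, giving `s_{ij} = (i j)`. -/
def reflections (n : ℕ) : Finset (Fin n × Fin n) :=
  Finset.univ.filter fun p => p.1 < p.2

/-! ### The rational Cherednik algebra `H_k(n) = H_{1,k}(S_n, 𝔥)` -/

/-- Generators: elements of `S_n`, of `𝔥` and of `𝔥*`. -/
inductive Gen (n : ℕ) : Type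
  | w : Equiv.Perm (Fin n) → Gen n
  | y : Hsp n → Gen n
  | x : Module.Dual ℂ (Hsp n) → Gen n

/-- A group element as an element of the free algebra. -/
abbrev gw {n : ℕ} (g : Equiv.Perm (Fin n)) : FreeAlgebra ℂ (Gen n) := FreeAlgebra.ι ℂ (Gen.w g)
/-- An element of `𝔥` as an element of the free algebra. -/
abbrev gy {n : ℕ} (v : Hsp n) : FreeAlgebra ℂ (Gen n) := FreeAlgebra.ι ℂ (Gen.y v)
/-- An element of `𝔥*` as an element of the free algebra. -/
abbrev gx {n : ℕ} (f : Module.Dual ℂ (Hsp n)) : FreeAlgebra ℂ (Gen n) :=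
  FreeAlgebra.ι ℂ (Gen.x f)

/-- The relations. The first eight constructors present `ℂS_n ⋉ T(𝔥 ⊕ 𝔥*)`; the last three are
`[x, x'] = 0`, `[y, y'] = 0` and
`[y, x] = (y, x) - k ∑_{i<j} (y, α_{ij}) (x, α_{ij}^∨) s_{ij}`. -/
inductive Rel (n : ℕ) (k : ℂ) : FreeAlgebra ℂ (Gen n) → FreeAlgebra ℂ (Gen n) → Prop
  | w_one : Rel n k (gw 1) 1
  | w_mul (g h : Equiv.Perm (Fin n)) : Rel n k (gw (g * h)) (gw g * gw h)
  | y_add (u v : Hsp n) : Rel n k (gy (u + v)) (gy u + gy v)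
  | y_smul (a : ℂ) (v : Hsp n) : Rel n k (gy (a • v)) (a • gy v)
  | x_add (f g : Module.Dual ℂ (Hsp n)) : Rel n k (gx (f + g)) (gx f + gx g)
  | x_smul (a : ℂ) (f : Module.Dual ℂ (Hsp n)) : Rel n k (gx (a • f)) (a • gx f)
  | w_y (g : Equiv.Perm (Fin n)) (v : Hsp n) :
      Rel n k (gw g * gy v) (gy (reflRep n g v) * gw g)
  | w_x (g : Equiv.Perm (Fin n)) (f : Module.Dual ℂ (Hsp n)) :
      Rel n k (gw g * gx f) (gx ((reflRep n).dual g f) * gw g)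
  | x_x (f g : Module.Dual ℂ (Hsp n)) : Rel n k (gx f * gx g) (gx g * gx f)
  | y_y (u v : Hsp n) : Rel n k (gy u * gy v) (gy v * gy u)
  | y_x (v : Hsp n) (f : Module.Dual ℂ (Hsp n)) :
      Rel n k (gy v * gx f - gx f * gy v)
        (algebraMap ℂ _ (f v) - ∑ p ∈ reflections n,
          (k * root n p.1 p.2 v * f (coroot n p.1 p.2)) • gw (Equiv.swap p.1 p.2))

/-- The rational Cherednik algebra `H_k(n) = H_{1,k}(S_n, 𝔥)`. -/
def Alg (n : ℕ) (k : ℂ) : Type := RingQuot (Rel n k)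

instance (n : ℕ) (k : ℂ) : Ring (Alg n k) := inferInstanceAs (Ring (RingQuot (Rel n k)))
instance (n : ℕ) (k : ℂ) : Algebra ℂ (Alg n k) :=
  inferInstanceAs (Algebra ℂ (RingQuot (Rel n k)))

/-- The quotient map from the free algebra. -/
def Alg.mk (n : ℕ) (k : ℂ) : FreeAlgebra ℂ (Gen n) →ₐ[ℂ] Alg n k :=
  RingQuot.mkAlgHom ℂ (Rel n k)

variable {n : ℕ} {k : ℂ}

theorem Alg.mk_rel {a b : FreeAlgebra ℂ (Gen n)} (h : Rel n k a b) :
    Alg.mk n k a = Alg.mk n k b :=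
  RingQuot.mkAlgHom_rel ℂ h

/-- The image of a group element in `H_k(n)`. -/
def W (n : ℕ) (k : ℂ) : Equiv.Perm (Fin n) →* Alg n k where
  toFun g := Alg.mk n k (gw g)
  map_one' := by rw [Alg.mk_rel Rel.w_one, map_one]
  map_mul' g h := by rw [Alg.mk_rel (Rel.w_mul g h), map_mul]

/-- The map `𝔥 → H_k(n)`. -/
def Y (n : ℕ) (k : ℂ) : Hsp n →ₗ[ℂ] Alg n k where
  toFun v := Alg.mk n k (gy v)
  map_add' u v := by rw [Alg.mk_rel (Rel.y_add u v), map_add]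
  map_smul' a v := by rw [Alg.mk_rel (Rel.y_smul a v), map_smul]; rfl

/-- The map `𝔥* → H_k(n)`. -/
def X (n : ℕ) (k : ℂ) : Module.Dual ℂ (Hsp n) →ₗ[ℂ] Alg n k where
  toFun f := Alg.mk n k (gx f)
  map_add' f g := by rw [Alg.mk_rel (Rel.x_add f g), map_add]
  map_smul' a f := by rw [Alg.mk_rel (Rel.x_smul a f), map_smul]; rfl

theorem W_mul_Y (g : Equiv.Perm (Fin n)) (v : Hsp n) :
    W n k g * Y n k v = Y n k (reflRep n g v) * W n k g := by
  have := Alg.mk_rel (k := k) (Rel.w_y g v)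
  rw [map_mul, map_mul] at this
  exact this

theorem W_mul_X (g : Equiv.Perm (Fin n)) (f : Module.Dual ℂ (Hsp n)) :
    W n k g * X n k f = X n k ((reflRep n).dual g f) * W n k g := by
  have := Alg.mk_rel (k := k) (Rel.w_x g f)
  rw [map_mul, map_mul] at this
  exact this

theorem X_mul_X (f g : Module.Dual ℂ (Hsp n)) : X n k f * X n k g = X n k g * X n k f := by
  have := Alg.mk_rel (k := k) (Rel.x_x f g)
  rw [map_mul, map_mul] at this
  exact this

/-- The element `𝐡 = ∑ x_i y_i + (dim 𝔥) / 2 - k ∑_{i<j} s_{ij}`, where `y_i` is a basis of `𝔥`,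
`x_i` is the dual basis of `𝔥*`, and `dim 𝔥 = n - 1`. -/
def euler (n : ℕ) (k : ℂ) : Alg n k :=
  ∑ i, X n k ((Module.finBasis ℂ (Hsp n)).coord i) * Y n k (Module.finBasis ℂ (Hsp n) i)
    + algebraMap ℂ _ (((n : ℂ) - 1) / 2)
    - ∑ p ∈ reflections n, k • W n k (Equiv.swap p.1 p.2)

theorem W_mul_sum_swap (g : Equiv.Perm (Fin n)) :
    W n k g * ∑ p ∈ reflections n, k • W n k (Equiv.swap p.1 p.2) =
      (∑ p ∈ reflections n, k • W n k (Equiv.swap p.1 p.2)) * W n k g := by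
  have key : ∀ (h : Equiv.Perm (Fin n)), ∀ p ∈ reflections n,
      (if h p.1 < h p.2 then (h p.1, h p.2) else (h p.2, h p.1)) ∈ reflections n := by
    intro h p hp
    have hp' : p.1 < p.2 := by simpa [reflections] using hp
    have hne : h p.1 ≠ h p.2 := fun e => hp'.ne (h.injective e)
    split_ifs with hlt
    · simpa [reflections] using hlt
    · simpa [reflections] using lt_of_le_of_ne (not_lt.mp hlt) hne.symm
  have inv : ∀ (h h' : Equiv.Perm (Fin n)), (∀ i, h' (h i) = i) → ∀ p ∈ reflections n,
      (if h' (if h p.1 < h p.2 then (h p.1, h p.2) else (h p.2, h p.1)).1 <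
          h' (if h p.1 < h p.2 then (h p.1, h p.2) else (h p.2, h p.1)).2 then
        (h' (if h p.1 < h p.2 then (h p.1, h p.2) else (h p.2, h p.1)).1,
          h' (if h p.1 < h p.2 then (h p.1, h p.2) else (h p.2, h p.1)).2)
        else (h' (if h p.1 < h p.2 then (h p.1, h p.2) else (h p.2, h p.1)).2,
          h' (if h p.1 < h p.2 then (h p.1, h p.2) else (h p.2, h p.1)).1)) = p := by
    intro h h' hh p hp
    have hp' : p.1 < p.2 := by simpa [reflections] using hp
    by_cases hlt : h p.1 < h p.2
    · simp [hlt, hh, hp']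
    · simp [hlt, hh, hp'.not_gt]
  rw [Finset.mul_sum, Finset.sum_mul]
  refine Finset.sum_nbij'
    (fun p => if g p.1 < g p.2 then (g p.1, g p.2) else (g p.2, g p.1))
    (fun p => if g⁻¹ p.1 < g⁻¹ p.2 then (g⁻¹ p.1, g⁻¹ p.2) else (g⁻¹ p.2, g⁻¹ p.1))
    (key g) (key g⁻¹) (inv g g⁻¹ (by simp)) (inv g⁻¹ g (by simp)) ?_
  intro p _
  rw [mul_smul_comm, smul_mul_assoc, ← map_mul, ← map_mul]
  congr 2
  split_ifs
  · exact Equiv.mul_swap_eq_swap_mul g p.1 p.2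
  · rw [Equiv.swap_comm (g p.2, g p.1).1]
    exact Equiv.mul_swap_eq_swap_mul g p.1 p.2

theorem W_mul_sum_basis (g : Equiv.Perm (Fin n)) :
    W n k g * ∑ i, X n k ((Module.finBasis ℂ (Hsp n)).coord i) *
        Y n k (Module.finBasis ℂ (Hsp n) i) =
      (∑ i, X n k ((Module.finBasis ℂ (Hsp n)).coord i) *
        Y n k (Module.finBasis ℂ (Hsp n) i)) * W n k g := by
  set b := Module.finBasis ℂ (Hsp n) with hb
  have h1 : ∀ i, reflRep n g (b i) = ∑ j, b.coord j (reflRep n g (b i)) • b j := fun i =>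
    (b.sum_repr _).symm
  have h2 : ∀ j, ∑ i, b.coord j (reflRep n g (b i)) • (reflRep n).dual g (b.coord i)
      = b.coord j := by
    intro j
    refine LinearMap.ext fun v => ?_
    have hv : reflRep n g (reflRep n g⁻¹ v) = v := by
      rw [← Module.End.mul_apply, ← map_mul]; simp
    conv_rhs => rw [← hv, ← b.sum_repr (reflRep n g⁻¹ v), map_sum, map_sum]
    simp [Representation.dual_apply, Module.Dual.transpose_apply, mul_comm]
  calc W n k g * ∑ i, X n k (b.coord i) * Y n k (b i)
      = (∑ i, X n k ((reflRep n).dual g (b.coord i)) * Y n k (reflRep n g (b i))) * W n k g := by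
        rw [Finset.mul_sum, Finset.sum_mul]
        refine Finset.sum_congr rfl fun i _ => ?_
        rw [← mul_assoc, W_mul_X, mul_assoc, W_mul_Y, mul_assoc]
    _ = (∑ j, X n k (b.coord j) * Y n k (b j)) * W n k g := by
        congr 1
        calc _ = ∑ i, ∑ j, X n k (b.coord j (reflRep n g (b i)) •
                  (reflRep n).dual g (b.coord i)) * Y n k (b j) := by
              refine Finset.sum_congr rfl fun i _ => ?_
              conv_lhs => rw [h1 i, map_sum, Finset.mul_sum]
              refine Finset.sum_congr rfl fun j _ => ?_
              rw [map_smul, map_smul, mul_smul_comm, smul_mul_assoc]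
          _ = _ := by
              rw [Finset.sum_comm]
              refine Finset.sum_congr rfl fun j _ => ?_
              rw [← Finset.sum_mul, ← map_sum, h2 j]

/-- `𝐡` is `S_n`-invariant. -/
theorem euler_comm (g : Equiv.Perm (Fin n)) : Commute (euler n k) (W n k g) := by
  refine Commute.sub_left (Commute.add_left ?_ (Algebra.commutes _ _)) ?_
  · exact (W_mul_sum_basis g).symm
  · exact (W_mul_sum_swap g).symm

/-! ### Characters -/

section Character

variable (n k) (V : Type*) [AddCommGroup V] [Module ℂ V] [Module (Alg n k) V]
  [IsScalarTower ℂ (Alg n k) V]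

/-- The generalized eigenspace of `𝐡` on an `H_k(n)`-module, for the eigenvalue `μ`. -/
def genEigenspace (μ : ℂ) : Submodule ℂ V :=
  (Algebra.lsmul ℂ ℂ V (euler n k)).maxGenEigenspace μ

theorem mapsTo_genEigenspace (g : Equiv.Perm (Fin n)) (μ : ℂ) :
    Set.MapsTo (Algebra.lsmul ℂ ℂ V (W n k g)) (genEigenspace n k V μ)
      (genEigenspace n k V μ) :=
  Module.End.mapsTo_maxGenEigenspace_of_comm
    ((euler_comm g).map (Algebra.lsmul ℂ ℂ V)) μ

/-- The trace of `g ∈ S_n` on the generalized `μ`-eigenspace of `𝐡`. -/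
def weightTrace (g : Equiv.Perm (Fin n)) (μ : ℂ) : ℂ :=
  LinearMap.trace ℂ (genEigenspace n k V μ)
    ((Algebra.lsmul ℂ ℂ V (W n k g)).restrict (mapsTo_genEigenspace n k V g μ))

/-- The character `χ_V(g, t) = Tr|_V (g t^𝐡)`: since `g` commutes with `𝐡`, this is the sum of
`Tr(g|_{V[μ]}) t^μ` over the generalized eigenspaces `V[μ]` of `𝐡`. -/
def character (g : Equiv.Perm (Fin n)) (t : ℝ) : ℂ :=
  ∑' μ : ℂ, weightTrace n k V g μ * (t : ℂ) ^ μ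

end Character

/-! ### Standard modules -/

section Standard

variable (n k) {τ : Type*} [AddCommGroup τ] [Module ℂ τ]
  (ρ : Representation ℂ (Equiv.Perm (Fin n)) τ)

/-- The `H_k(n)`-submodule of `H_k(n) ⊗_ℂ τ` generated by `g ⊗ v - 1 ⊗ g v` (`g ∈ S_n`) and
`y ⊗ v` (`y ∈ 𝔥`). -/
def stdRel : Submodule (Alg n k) (Alg n k ⊗[ℂ] τ) :=
  Submodule.span (Alg n k)
    ({z | ∃ g v, z = W n k g ⊗ₜ[ℂ] v - 1 ⊗ₜ[ℂ] ρ g v} ∪ {z | ∃ y v, z = Y n k y ⊗ₜ[ℂ] v})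

/-- The standard (Verma) module `M_k(τ) = H_k(n) ⊗_{ℂS_n ⋉ ℂ[𝔥*]} τ`, where `𝔥` acts on `τ`
by `0`. -/
abbrev Std : Type _ := (Alg n k ⊗[ℂ] τ) ⧸ stdRel n k ρ

/-- The element `1 ⊗ v` of `M_k(τ)`. -/
def Std.lowest (v : τ) : Std n k ρ := Submodule.Quotient.mk (1 ⊗ₜ[ℂ] v)

end Standard

/-- The representation of `S_n` on the exterior power `⋀^j 𝔥`. -/
def extRep (n j : ℕ) : Representation ℂ (Equiv.Perm (Fin n)) (⋀[ℂ]^j (Hsp n)) where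
  toFun g := exteriorPower.map j (reflRep n g)
  map_one' := by
    rw [map_one]
    exact exteriorPower.map_id
  map_mul' g h := by
    rw [map_mul]
    exact exteriorPower.map_comp _ _

/-! ### The polynomial representation and the module `V_k` -/

/-- The polynomial representation `M_k = M_k(ℂ)`, the standard module of the trivial
representation; as a vector space it is identified with `ℂ[𝔥]` through `p ↦ p · 1`. -/
abbrev Pol (n : ℕ) (k : ℂ) : Type := Std n k (Representation.trivial ℂ (Equiv.Perm (Fin n)) ℂ)

/-- The commutative subalgebra of `H_k(n)` generated by `𝔥*`. -/
abbrev xSub (n : ℕ) (k : ℂ) : Subalgebra ℂ (Alg n k) :=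
  Algebra.adjoin ℂ (Set.range (X n k))

instance xSub_isMulCommutative (n : ℕ) (k : ℂ) : IsMulCommutative (xSub n k) :=
  Algebra.isMulCommutative_adjoin ℂ (by
    rintro _ ⟨f, rfl⟩ _ ⟨g, rfl⟩
    exact X_mul_X f g)

open scoped IsMulCommutative in
/-- Evaluation of a polynomial in `x_1, …, x_n` at the commuting elements `x̃_1, …, x̃_n ∈ 𝔥*`
of `H_k(n)`. As `p(x_1, …, x_n) = p(x̃_1, …, x̃_n)` for every translation invariant `p`, on
`ℂ[𝔥] = ℂ[x_1, …, x_n]^T` this is the canonical homomorphism `ℂ[𝔥] → H_k(n)`. -/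
def polyEval (n : ℕ) (k : ℂ) : MvPolynomial (Fin n) ℂ →ₐ[ℂ] Alg n k :=
  (xSub n k).val.comp (MvPolynomial.aeval fun i =>
    (⟨X n k (xfun n i), Algebra.subset_adjoin ⟨_, rfl⟩⟩ : xSub n k))

/-- The element of `M_k` corresponding to a translation invariant polynomial `p`, that is
`p · 1`. -/
def polyVec (n : ℕ) (k : ℂ) (p : MvPolynomial (Fin n) ℂ) : Pol n k :=
  polyEval n k p • Std.lowest n k _ (1 : ℂ)

/-- The polynomial `f_i = Res_{z=∞} [(z-x_1)⋯(z-x_n)]^{r/n} dz / (z-x_i)`. With `u = 1/z`, the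
integrand is `z^{r-1} ∏_j (1 - x_j u)^{r/n} (1 - x_i u)^{-1} dz`, and the residue at infinity is
minus the coefficient of `z^{-1} dz`, hence minus the coefficient of `u^r` in
`∏_j (1 - x_j u)^{r/n} · ∑_m x_i^m u^m`. -/
def fpoly (n r : ℕ) (i : Fin n) : MvPolynomial (Fin n) ℂ :=
  - PowerSeries.coeff r
    ((∏ j, PowerSeries.rescale (-MvPolynomial.X j)
        (PowerSeries.binomialSeries (MvPolynomial (Fin n) ℂ) ((r : ℂ) / n))) *
      PowerSeries.mk fun m => (MvPolynomial.X i : MvPolynomial (Fin n) ℂ) ^ m)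

/-- The parameter `k = r / n`. -/
abbrev kpar (n r : ℕ) : ℂ := (r : ℂ) / n

/-- The submodule `I_k ⊆ M_k` generated by the `f_i`, for `k = r / n`. -/
def Isub (n r : ℕ) : Submodule (Alg n (kpar n r)) (Pol n (kpar n r)) :=
  Submodule.span _ (Set.range fun i => polyVec n (kpar n r) (fpoly n r i))

/-- The module `V_k = M_k / I_k`, for `k = r / n`. -/
abbrev Vmod (n r : ℕ) : Type := Pol n (kpar n r) ⧸ Isub n r

/-- `V_k` has a BGG type resolution
`0 ← V_k ← M_k(⋀^0 𝔥) ← M_k(⋀^1 𝔥) ← ⋯ ← M_k(⋀^{n-1} 𝔥) ← 0`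
by `H_k(n)`-module homomorphisms. The augmentation is the projection
`M_k = M_k(⋀^0 𝔥) → V_k`, and the first differential `M_k(𝔥) → M_k` extends the map
`𝔥 → M_k`, `y_i ↦ f_i`, where `y_i` is the class of the `i`-th standard basis vector.
The standard modules `M_k(⋀^j 𝔥)` with `j > n - 1 = dim 𝔥` vanish, so exactness at `j = n - 1`
says that the last differential (out of `M_k(⋀^{n-1} 𝔥)`) is injective. -/
def HasBGGResolution (n r : ℕ) : Prop :=
  ∃ (ε : Std n (kpar n r) (extRep n 0) →ₗ[Alg n (kpar n r)] Vmod n r)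
    (d : ∀ j : ℕ, Std n (kpar n r) (extRep n (j + 1)) →ₗ[Alg n (kpar n r)]
      Std n (kpar n r) (extRep n j)),
    ε (Std.lowest n _ _ (exteriorPower.ιMulti ℂ 0 Fin.elim0)) =
      Submodule.Quotient.mk (Std.lowest n _ _ (1 : ℂ)) ∧
    (∀ i : Fin n,
      d 0 (Std.lowest n _ _ (exteriorPower.ιMulti ℂ 1 fun _ => yvec n i)) =
        polyEval n (kpar n r) (fpoly n r i) •
          Std.lowest n _ _ (exteriorPower.ιMulti ℂ 0 Fin.elim0)) ∧
    Function.Surjective ε ∧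
    Function.Exact (d 0) ε ∧
    (∀ j, Function.Exact (d (j + 1)) (d j)) ∧
    ∀ j, n ≤ j → Subsingleton (Std n (kpar n r) (extRep n j))

end Cherednik

end

noncomputable section

open scoped TensorProduct
open MvPolynomial

namespace Cherednik

/-! ### Coordinates on `𝔥` -/

/-! Write n = N + 1, so that ℂ[𝔥] is the polynomial ring in the N differences of x_1, …, x_{n-1}
with the last variable x_n. Dunkl operators turn ℂ[𝔥] ⊗ τ into an H_k(n)-module isomorphic to M_k(τ)
(`Std.equivDunkl`), and the theorem becomes a statement about the polynomials f_i = -[u^r] F(u) / (1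
- x_i u), where F(u) = ∏ (1 - x_j u)^k and kn = r. Put f_v for the linear extension of y_i ↦ f_i to
v ∈ 𝔥.

The f_i are singular vectors: ∂_v f_w = k ∑ α(v) α(w) g_α over the positive roots, where g_α is the
divided difference of the f's, because the discrepancy is a residue of a total derivative
(`der_fA_yvec`, `der_fLin`). More generally, since a reflection s_α fixes every contraction by α
(`extRep_transposition_contr`), the Koszul differentials of the f's send lowest vectors to singular
vectors and so are H_k(n)-linear (`koszul_isSingularMap`).

The f_i have no common zero but the origin: if all residues vanish at a point c, then F is a
polynomial with F^n = ∏ (1 - c_j u)^r, and comparing multiplicities of a root with gcd(r, n) = 1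
forces all c_j to be equal (`BinomialProduct.eq_zero_of_residues_vanish`). As ∑ f_i = 0, the same
holds for the first m of them on the subspace where the remaining coordinates vanish
(`eq_zero_of_fA_eq_zero`). This flag condition (`FlagSystem`) allows the coordinates to be exchanged
for the f's one at a time, which shows by elementary means that f_1, …, f_N is a regular sequence,
that the quotient by (f) is finite dimensional with one-dimensional socle, and that ℂ[𝔥] is free
over ℂ[f] (`IsLiftedBasis.freeMap_bijective`).

Freeness makes "differentiation by f_a" meaningful, and an Euler homotopy then contracts the Koszul
complex in positive degrees (`sumMap_exact`); this is the BGG resolution. Its end shows that I_k is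
the ideal (f) (`toPol_mem_Isub_iff`).

For irreducibility, a nonzero submodule of V_k contains the socle vector s, which lies in the top
degree D. The elements ∑ x_i², ∑ y_i² and 𝐡 form an sl₂-triple up to scalars; s is a highest and 1 a
lowest weight vector, and comparing the two weights shows that the last nonzero vector (∑ y_i²)^m s
has degree 0. So the submodule contains 1.

For the character, the graded trace of g on ℂ[𝔥] is computed with monomials in eigencoordinates and
with a basis adapted to ℂ[𝔥] = V_k ⊗ ℂ[f], where the f's span a copy of 𝔥 in degree r. Comparing the
two gives the quotient of determinants, and the case g = 1 gives the dimension. -/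

/-- Coordinates on `𝔥`: the values of the roots `x_a - x_N`. -/
def hEquiv (N : ℕ) : Hsp (N + 1) ≃ₗ[ℂ] (Fin N → ℂ) :=
  LinearEquiv.ofLinearMap (LinearMap.pi fun a => root (N + 1) a.castSucc (Fin.last N))
    ((Submodule.mkQ _).comp (LinearMap.pi
      (Fin.snoc (α := fun _ => (Fin N → ℂ) →ₗ[ℂ] ℂ) (fun a => LinearMap.proj a) 0)))
    (by
      refine LinearMap.ext fun v => funext fun a => ?_
      simp [root])
    (by
      refine Submodule.linearMap_qext _ (LinearMap.ext fun v => ?_)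
      refine (Submodule.Quotient.eq _).2 (Submodule.mem_span_singleton.2 ⟨- v (Fin.last N), ?_⟩)
      funext i
      refine Fin.lastCases ?_ (fun a => ?_) i <;> simp [root])

/-- The basis `y_0, …, y_{N-1}` of `𝔥`. -/
def hBasis (N : ℕ) : Module.Basis (Fin N) ℂ (Hsp (N + 1)) := Module.Basis.ofEquivFun (hEquiv N)

variable {N : ℕ}

theorem hBasis_coord (a : Fin N) :
    (hBasis N).coord a = root (N + 1) a.castSucc (Fin.last N) := by
  ext v
  simp [hBasis, hEquiv]

theorem hBasis_apply (a : Fin N) : hBasis N a = yvec (N + 1) a.castSucc := by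
  apply (hEquiv N).injective
  funext c
  have h1 : hEquiv N (hBasis N a) = Pi.single a 1 := by
    have := (hBasis N).equivFun_self a
    rw [hBasis, Module.Basis.equivFun_ofEquivFun] at this
    rw [hBasis]
    funext d
    rw [this, Pi.single_apply]
    simp only [eq_comm]
  rw [h1]
  simp [hEquiv, root, yvec, Pi.single_apply]

theorem finrank_Hsp : Module.finrank ℂ (Hsp (N + 1)) = N := by
  simpa using Module.finrank_eq_card_basis (hBasis N)

theorem root_yvec {n : ℕ} (i j l : Fin n) :
    root n i j (yvec n l) = (if i = l then 1 else 0) - (if j = l then 1 else 0) := by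
  simp [root, yvec, Pi.single_apply]

theorem root_self {n : ℕ} (i : Fin n) : root n i i = 0 := by
  refine Submodule.linearMap_qext _ (LinearMap.ext fun v => ?_)
  simp [root]

theorem root_swap {n : ℕ} (i j : Fin n) : root n i j = - root n j i := by
  refine Submodule.linearMap_qext _ (LinearMap.ext fun v => ?_)
  simp [root]

theorem coroot_swap {n : ℕ} (i j : Fin n) : coroot n i j = - coroot n j i := by
  simp [coroot]

theorem root_coroot {n : ℕ} {i j : Fin n} (h : i ≠ j) : root n i j (coroot n i j) = 2 := by
  simp only [coroot, map_sub, root_yvec, h, h.symm, if_true, if_false]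
  norm_num

theorem root_ne_zero {n : ℕ} {i j : Fin n} (h : i ≠ j) : root n i j ≠ 0 := by
  intro h0
  have := root_coroot h
  rw [h0] at this
  simp at this

theorem reflRep_yvec {n : ℕ} (g : Equiv.Perm (Fin n)) (i : Fin n) :
    reflRep n g (yvec n i) = yvec n (g i) := by
  change Submodule.Quotient.mk _ = Submodule.Quotient.mk _
  congr 1
  funext l
  simp [permRep, LinearMap.funLeft, Pi.single_apply, Equiv.Perm.inv_def, Equiv.symm_apply_eq]

theorem reflRep_coroot {n : ℕ} (g : Equiv.Perm (Fin n)) (i j : Fin n) :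
    reflRep n g (coroot n i j) = coroot n (g i) (g j) := by
  simp [coroot, reflRep_yvec]

theorem root_reflRep {n : ℕ} (g : Equiv.Perm (Fin n)) (i j : Fin n) (v : Hsp n) :
    root n (g i) (g j) (reflRep n g v) = root n i j v := by
  induction v using Submodule.Quotient.induction_on with
  | _ v => simp [root, reflRep, permRep, LinearMap.funLeft]

theorem dual_root {n : ℕ} (g : Equiv.Perm (Fin n)) (i j : Fin n) :
    (reflRep n).dual g (root n i j) = root n (g i) (g j) := by
  refine LinearMap.ext fun v => ?_
  have hv : reflRep n g (reflRep n g⁻¹ v) = v := by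
    rw [← Module.End.mul_apply, ← map_mul]; simp
  rw [Representation.dual_apply, Module.Dual.transpose_apply, LinearMap.comp_apply,
    ← root_reflRep g, hv]

/-- A transposition acts on `𝔥` by a reflection. -/
theorem reflRep_transposition {n : ℕ} (i j : Fin n) (v : Hsp n) :
    reflRep n (Equiv.swap i j) v = v - root n i j v • coroot n i j := by
  induction v using Submodule.Quotient.induction_on with
  | _ v =>
    change Submodule.Quotient.mk _ = Submodule.Quotient.mk _
    congr 1
    funext l
    rcases eq_or_ne l i with rfl | hi
    · by_cases h : l = j <;> simp [permRep, LinearMap.funLeft, root, h]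
    rcases eq_or_ne l j with rfl | hj
    · simp [permRep, LinearMap.funLeft, root, hi]
    · simp [permRep, LinearMap.funLeft, Equiv.swap_apply_of_ne_of_ne hi hj, hi, hj]

theorem dual_transposition {n : ℕ} (i j : Fin n) (φ : Module.Dual ℂ (Hsp n)) :
    (reflRep n).dual (Equiv.swap i j) φ = φ - φ (coroot n i j) • root n i j := by
  refine LinearMap.ext fun v => ?_
  rw [Representation.dual_apply, Module.Dual.transpose_apply, LinearMap.comp_apply, Equiv.swap_inv,
    reflRep_transposition]
  simp [mul_comm]

/-! ### Sums over reflections -/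

/-- The index set i < j is not stable under permutations, while the full double sum is. This lemma
passes from one to the other at the cost of a factor 2 and the diagonal. -/
theorem sum_reflections {n : ℕ} {M : Type*} [AddCommGroup M] [Module ℂ M]
    (F : Fin n → Fin n → M) (hF : ∀ i j, F i j = F j i) :
    ∑ i, ∑ j, F i j = (2 : ℂ) • ∑ p ∈ reflections n, F p.1 p.2 + ∑ i, F i i := by
  have h1 : ∑ i, ∑ j, F i j = ∑ p : Fin n × Fin n, F p.1 p.2 := by
    rw [Fintype.sum_prod_type]
  have h2 : ∑ i, F i i = ∑ p : Fin n × Fin n with p.1 = p.2, F p.1 p.2 := by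
    refine Finset.sum_bij' (fun i _ => (i, i)) (fun p _ => p.1) ?_ ?_ ?_ ?_ ?_ <;>
      simp +contextual
  have h3 : ∑ p ∈ reflections n, F p.1 p.2 = ∑ p : Fin n × Fin n with p.2 < p.1, F p.1 p.2 := by
    refine Finset.sum_bij' (fun p _ => p.swap) (fun p _ => p.swap) ?_ ?_ ?_ ?_ ?_ <;>
      simp +contextual [reflections, hF]
  rw [h1, h2, two_smul]
  conv_lhs => rw [← Finset.sum_filter_add_sum_filter_not _ (fun p : Fin n × Fin n => p.1 < p.2)]
  rw [add_assoc]
  refine congrArg₂ _ rfl ?_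
  rw [h3, ← Finset.sum_union]
  · refine Finset.sum_congr ?_ fun _ _ => rfl
    ext p
    simp only [Finset.mem_filter, Finset.mem_univ, true_and, Finset.mem_union, not_lt]
    rw [le_iff_lt_or_eq, eq_comm]
  · rw [Finset.disjoint_filter]
    intro p _ h h'
    exact h.ne' h'

theorem sum_reflections_perm {n : ℕ} {M : Type*} [AddCommGroup M] [Module ℂ M]
    (F : Fin n → Fin n → M) (hF : ∀ i j, F i j = F j i) (g : Equiv.Perm (Fin n)) :
    ∑ p ∈ reflections n, F (g p.1) (g p.2) = ∑ p ∈ reflections n, F p.1 p.2 := by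
  have h1 := sum_reflections F hF
  have h2 := sum_reflections (fun i j => F (g i) (g j)) (fun i j => hF _ _)
  rw [Equiv.sum_comp g (fun i => F i i), Equiv.sum_comp g (fun i => ∑ j, F i (g j))] at h2
  simp_rw [fun i => Equiv.sum_comp g (fun j => F i j)] at h2
  rw [h1] at h2
  have h3 := add_right_cancel h2
  exact (smul_right_injective M (two_ne_zero' ℂ) h3).symm

/-! ### The algebra of polynomial functions on `𝔥` -/

/-- The inclusion of `𝔥*` into `ℂ[𝔥] = ℂ[X_0, …, X_{N-1}]`. -/
def linForm (N : ℕ) : Module.Dual ℂ (Hsp (N + 1)) →ₗ[ℂ] MvPolynomial (Fin N) ℂ where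
  toFun φ := ∑ a, φ (hBasis N a) • MvPolynomial.X a
  map_add' φ ψ := by simp [add_smul, Finset.sum_add_distrib]
  map_smul' c φ := by simp [Finset.smul_sum, mul_smul]

theorem linForm_coord (a : Fin N) : linForm N ((hBasis N).coord a) = MvPolynomial.X a := by
  simp [linForm, Finsupp.single_apply]

theorem linForm_injective : Function.Injective (linForm N) := by
  rw [injective_iff_map_eq_zero]
  intro φ h
  refine (hBasis N).ext fun a => ?_
  have := congrArg (coeff (Finsupp.single a 1)) h
  simpa [linForm, coeff_sum, coeff_smul, coeff_X, Finsupp.single_left_inj] using this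

theorem linForm_isHomogeneous (φ : Module.Dual ℂ (Hsp (N + 1))) : (linForm N φ).IsHomogeneous 1 :=
  Submodule.sum_mem (homogeneousSubmodule _ _ 1) fun a _ =>
    Submodule.smul_mem _ _ (isHomogeneous_X ℂ a)

/-- The action of `S_n` on `ℂ[𝔥]`. -/
def act (N : ℕ) (g : Equiv.Perm (Fin (N + 1))) :
    MvPolynomial (Fin N) ℂ →ₐ[ℂ] MvPolynomial (Fin N) ℂ :=
  aeval fun a => linForm N ((reflRep (N + 1)).dual g ((hBasis N).coord a))

theorem act_linForm (g : Equiv.Perm (Fin (N + 1))) (φ : Module.Dual ℂ (Hsp (N + 1))) :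
    act N g (linForm N φ) = linForm N ((reflRep (N + 1)).dual g φ) := by
  have : (act N g).toLinearMap.comp (linForm N) =
      (linForm N).comp ((reflRep (N + 1)).dual g) := by
    refine (hBasis N).dualBasis.ext fun a => ?_
    rw [Module.Basis.coe_dualBasis, LinearMap.comp_apply, LinearMap.comp_apply, linForm_coord]
    exact aeval_X _ _
  exact LinearMap.congr_fun this φ

theorem act_X (g : Equiv.Perm (Fin (N + 1))) (a : Fin N) :
    act N g (MvPolynomial.X a) = linForm N ((reflRep (N + 1)).dual g ((hBasis N).coord a)) := by
  simp [act]

theorem act_one : act N 1 = AlgHom.id ℂ _ := by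
  refine MvPolynomial.algHom_ext fun a => ?_
  rw [act_X, map_one, Module.End.one_apply, linForm_coord, AlgHom.id_apply]

theorem act_mul (g h : Equiv.Perm (Fin (N + 1))) : act N (g * h) = (act N g).comp (act N h) := by
  refine MvPolynomial.algHom_ext fun a => ?_
  rw [act_X, AlgHom.comp_apply, act_X, act_linForm, map_mul, Module.End.mul_apply]

theorem act_isHomogeneous (g : Equiv.Perm (Fin (N + 1))) {p : MvPolynomial (Fin N) ℂ} {d : ℕ}
    (hp : p.IsHomogeneous d) : (act N g p).IsHomogeneous d := by
  have := hp.aeval _ (fun a => linForm_isHomogeneous ((reflRep (N + 1)).dual g ((hBasis N).coord a)))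
  rwa [one_mul] at this

/-- The derivative in the direction `v ∈ 𝔥`. -/
def der (N : ℕ) (v : Hsp (N + 1)) : Derivation ℂ (MvPolynomial (Fin N) ℂ) (MvPolynomial (Fin N) ℂ) :=
  mkDerivation ℂ fun a => C ((hBasis N).coord a v)

theorem der_linForm (v : Hsp (N + 1)) (φ : Module.Dual ℂ (Hsp (N + 1))) :
    der N v (linForm N φ) = C (φ v) := by
  conv_rhs => rw [← (hBasis N).sum_repr v, map_sum, map_sum]
  rw [linForm, LinearMap.coe_mk, AddHom.coe_mk, map_sum]
  refine Finset.sum_congr rfl fun a _ => ?_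
  rw [Derivation.map_smul, der, mkDerivation_X, smul_eq_C_mul, ← C_mul, map_smul, smul_eq_mul,
    mul_comm, Module.Basis.coord_apply]

theorem der_add (u v : Hsp (N + 1)) (p : MvPolynomial (Fin N) ℂ) :
    der N (u + v) p = der N u p + der N v p := by
  have : der N (u + v) = der N u + der N v :=
    MvPolynomial.derivation_ext fun a => by simp [der, mkDerivation_X]
  rw [this]; rfl

theorem der_smul (c : ℂ) (v : Hsp (N + 1)) (p : MvPolynomial (Fin N) ℂ) :
    der N (c • v) p = c • der N v p := by
  have : der N (c • v) = c • der N v :=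
    MvPolynomial.derivation_ext fun a => by simp [der, mkDerivation_X, smul_eq_C_mul]
  rw [this]; rfl

theorem act_der (g : Equiv.Perm (Fin (N + 1))) (v : Hsp (N + 1)) (p : MvPolynomial (Fin N) ℂ) :
    act N g (der N v p) = der N (reflRep (N + 1) g v) (act N g p) := by
  induction p using MvPolynomial.induction_on with
  | C a =>
    rw [← algebraMap_eq, Derivation.map_algebraMap, AlgHom.commutes, Derivation.map_algebraMap,
      map_zero]
  | add p q hp hq => simp only [map_add, hp, hq]
  | mul_X p a hp =>
    rw [← linForm_coord]
    simp only [Derivation.leibniz, map_add, map_mul, smul_eq_mul, hp, act_linForm, der_linForm]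
    congr 2
    rw [← algebraMap_eq, AlgHom.commutes]
    congr 1
    rw [Representation.dual_apply, Module.Dual.transpose_apply, LinearMap.comp_apply,
      ← Module.End.mul_apply, ← map_mul, inv_mul_cancel, map_one, Module.End.one_apply]

/-! ### Divided differences -/

/-- A transposition changes a coordinate by a multiple of the root, and the twisted Leibniz rule pX
- s(pX) = (p - sp)X + sp(X - sX) carries divisibility to products. -/
theorem exists_divDiff (i j : Fin (N + 1)) (p : MvPolynomial (Fin N) ℂ) :
    linForm N (root (N + 1) i j) ∣ p - act N (Equiv.swap i j) p := by
  induction p using MvPolynomial.induction_on with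
  | C a => rw [← algebraMap_eq, AlgHom.commutes, sub_self]; exact dvd_zero _
  | add p q hp hq =>
    rw [map_add, add_sub_add_comm]
    exact dvd_add hp hq
  | mul_X p a hp =>
    have : p * MvPolynomial.X a - act N (Equiv.swap i j) (p * MvPolynomial.X a) =
        (p - act N (Equiv.swap i j) p) * MvPolynomial.X a +
          act N (Equiv.swap i j) p * C ((hBasis N).coord a (coroot (N + 1) i j)) *
            linForm N (root (N + 1) i j) := by
      rw [map_mul, act_X, dual_transposition, map_sub, linForm_coord, map_smul, smul_eq_C_mul]
      ring
    rw [this]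
    exact dvd_add (hp.mul_right _) (Dvd.intro_left _ rfl)

theorem linForm_root_ne_zero {i j : Fin (N + 1)} (h : i ≠ j) :
    linForm N (root (N + 1) i j) ≠ 0 :=
  (map_ne_zero_iff _ linForm_injective).2 (root_ne_zero h)

/-- The divided difference `p ↦ (p - s_{ij} p) / (x_i - x_j)` (zero if `i = j`). -/
def divDiff (N : ℕ) (i j : Fin (N + 1)) : MvPolynomial (Fin N) ℂ →ₗ[ℂ] MvPolynomial (Fin N) ℂ :=
  if h : i = j then 0 else
  { toFun p := (exists_divDiff i j p).choose
    map_add' p q := by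
      apply mul_left_cancel₀ (linForm_root_ne_zero h)
      rw [mul_add, ← (exists_divDiff i j _).choose_spec, ← (exists_divDiff i j _).choose_spec,
        ← (exists_divDiff i j _).choose_spec, map_add]
      ring
    map_smul' c p := by
      apply mul_left_cancel₀ (linForm_root_ne_zero h)
      rw [RingHom.id_apply, mul_smul_comm, ← (exists_divDiff i j _).choose_spec,
        ← (exists_divDiff i j _).choose_spec, map_smul, smul_sub] }

theorem mul_divDiff (i j : Fin (N + 1)) (p : MvPolynomial (Fin N) ℂ) :
    linForm N (root (N + 1) i j) * divDiff N i j p = p - act N (Equiv.swap i j) p := by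
  by_cases h : i = j
  · subst h
    simp only [root_self, map_zero, zero_mul, Equiv.swap_self]
    rw [show (Equiv.refl (Fin (N + 1))) = 1 from rfl, act_one]
    simp
  · rw [divDiff, dif_neg h]
    exact (exists_divDiff i j p).choose_spec.symm

theorem divDiff_self (i : Fin (N + 1)) : divDiff N i i = 0 := by simp [divDiff]

theorem divDiff_eq_iff {i j : Fin (N + 1)} (h : i ≠ j) {p q : MvPolynomial (Fin N) ℂ} :
    divDiff N i j p = q ↔
      linForm N (root (N + 1) i j) * q = p - act N (Equiv.swap i j) p := by
  rw [← mul_divDiff]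
  exact ⟨fun e => by rw [e], fun e => (mul_left_cancel₀ (linForm_root_ne_zero h) e).symm⟩

theorem divDiff_C (i j : Fin (N + 1)) (c : ℂ) : divDiff N i j (C c) = 0 := by
  by_cases h : i = j
  · rw [h, divDiff_self]; rfl
  · rw [divDiff_eq_iff h, ← algebraMap_eq, AlgHom.commutes]; simp

theorem divDiff_swap (i j : Fin (N + 1)) : divDiff N i j = - divDiff N j i := by
  by_cases h : i = j
  · rw [h, divDiff_self]; simp
  · refine LinearMap.ext fun p => ?_
    rw [divDiff_eq_iff h, root_swap, map_neg, LinearMap.neg_apply, neg_mul_neg, mul_divDiff,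
      Equiv.swap_comm]

theorem act_divDiff (g : Equiv.Perm (Fin (N + 1))) (i j : Fin (N + 1))
    (p : MvPolynomial (Fin N) ℂ) :
    act N g (divDiff N i j p) = divDiff N (g i) (g j) (act N g p) := by
  by_cases h : i = j
  · simp [h, divDiff_self]
  · symm
    rw [divDiff_eq_iff (g.injective.ne h), ← dual_root, ← act_linForm, ← map_mul, mul_divDiff,
      map_sub]
    refine congrArg _ ?_
    rw [← AlgHom.comp_apply, ← AlgHom.comp_apply, ← act_mul, ← act_mul,
      Equiv.mul_swap_eq_swap_mul]

/-- The first term on the right is the source of the reflections in the relation for [y, x]. -/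
theorem divDiff_linForm_mul (i j : Fin (N + 1)) (φ : Module.Dual ℂ (Hsp (N + 1)))
    (p : MvPolynomial (Fin N) ℂ) :
    divDiff N i j (linForm N φ * p) =
      φ (coroot (N + 1) i j) • act N (Equiv.swap i j) p + linForm N φ * divDiff N i j p := by
  by_cases h : i = j
  · rw [h, divDiff_self, coroot, sub_self, map_zero, zero_smul, LinearMap.zero_apply,
      LinearMap.zero_apply, mul_zero, add_zero]
  · rw [divDiff_eq_iff h, mul_add, mul_left_comm, mul_divDiff, map_mul, act_linForm,
      dual_transposition, map_sub, map_smul, smul_eq_C_mul, smul_eq_C_mul]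
    generalize linForm N (root (N + 1) i j) = a
    generalize linForm N φ = b
    generalize act N (Equiv.swap i j) p = c
    ring

end Cherednik

end

noncomputable section

open scoped TensorProduct
open MvPolynomial

namespace Cherednik

variable {N : ℕ}

/-! ### The space `ℂ[𝔥] ⊗ τ` -/

/-- The space `ℂ[𝔥] ⊗ τ`. -/
def PT (N : ℕ) (τ : Type*) [AddCommGroup τ] [Module ℂ τ] : Type _ := MvPolynomial (Fin N) ℂ ⊗[ℂ] τ

section PT

variable {τ σ : Type*} [AddCommGroup τ] [Module ℂ τ] [AddCommGroup σ] [Module ℂ σ]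

instance : AddCommGroup (PT N τ) := inferInstanceAs (AddCommGroup (MvPolynomial (Fin N) ℂ ⊗[ℂ] τ))
instance : Module ℂ (PT N τ) := inferInstanceAs (Module ℂ (MvPolynomial (Fin N) ℂ ⊗[ℂ] τ))

/-- The pure tensors in `ℂ[𝔥] ⊗ τ`, as a bilinear map. -/
def PT.mk (N : ℕ) (τ : Type*) [AddCommGroup τ] [Module ℂ τ] :
    MvPolynomial (Fin N) ℂ →ₗ[ℂ] τ →ₗ[ℂ] PT N τ :=
  TensorProduct.mk ℂ (MvPolynomial (Fin N) ℂ) τ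

/-- The pure tensor `p ⊗ t`. -/
def PT.tmul (p : MvPolynomial (Fin N) ℂ) (t : τ) : PT N τ := PT.mk N τ p t

infixl:100 " ⊠ " => PT.tmul

/-- The map induced by a bilinear map. -/
def PT.lift {M : Type*} [AddCommGroup M] [Module ℂ M]
    (f : MvPolynomial (Fin N) ℂ →ₗ[ℂ] τ →ₗ[ℂ] M) : PT N τ →ₗ[ℂ] M := TensorProduct.lift f

@[simp]
theorem PT.lift_tmul {M : Type*} [AddCommGroup M] [Module ℂ M]
    (f : MvPolynomial (Fin N) ℂ →ₗ[ℂ] τ →ₗ[ℂ] M) (p : MvPolynomial (Fin N) ℂ) (t : τ) :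
    PT.lift f (p ⊠ t) = f p t := rfl

theorem PT.ext {M : Type*} [AddCommGroup M] [Module ℂ M] {f g : PT N τ →ₗ[ℂ] M}
    (h : ∀ p t, f (p ⊠ t) = g (p ⊠ t)) : f = g :=
  TensorProduct.ext' h

theorem PT.add_tmul (p q : MvPolynomial (Fin N) ℂ) (t : τ) : (p + q) ⊠ t = p ⊠ t + q ⊠ t := by
  simp [PT.tmul]

theorem PT.smul_tmul (c : ℂ) (p : MvPolynomial (Fin N) ℂ) (t : τ) : (c • p) ⊠ t = c • (p ⊠ t) := by
  simp [PT.tmul]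

theorem PT.neg_tmul (p : MvPolynomial (Fin N) ℂ) (t : τ) : (-p) ⊠ t = - (p ⊠ t) := by
  simp [PT.tmul]

theorem PT.zero_tmul (t : τ) : (0 : MvPolynomial (Fin N) ℂ) ⊠ t = 0 := by
  simp [PT.tmul]

theorem PT.tmul_smul (c : ℂ) (p : MvPolynomial (Fin N) ℂ) (t : τ) : p ⊠ (c • t) = c • (p ⊠ t) := by
  simp [PT.tmul]

theorem PT.tmul_add (p : MvPolynomial (Fin N) ℂ) (s t : τ) : p ⊠ (s + t) = p ⊠ s + p ⊠ t := by
  simp [PT.tmul]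

theorem PT.eq_top (S : Submodule ℂ (PT N τ)) (h : ∀ p t, p ⊠ t ∈ S) : S = ⊤ := by
  rw [eq_top_iff]
  rintro x -
  induction x using TensorProduct.induction_on with
  | zero => exact S.zero_mem
  | tmul p t => exact h p t
  | add x y hx hy => exact S.add_mem hx hy

/-- The tensor product of two maps. -/
def PT.map (f : MvPolynomial (Fin N) ℂ →ₗ[ℂ] MvPolynomial (Fin N) ℂ) (h : τ →ₗ[ℂ] σ) :
    PT N τ →ₗ[ℂ] PT N σ :=
  PT.lift (((PT.mk N σ).compl₂ h).comp f)

@[simp]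
theorem PT.map_tmul (f : MvPolynomial (Fin N) ℂ →ₗ[ℂ] MvPolynomial (Fin N) ℂ) (h : τ →ₗ[ℂ] σ)
    (p : MvPolynomial (Fin N) ℂ) (t : τ) : PT.map f h (p ⊠ t) = f p ⊠ h t := rfl

end PT

/-! ### The Dunkl representation on `ℂ[𝔥] ⊗ τ` -/

section Dunkl

variable {τ : Type*} [AddCommGroup τ] [Module ℂ τ]
  (ρ : Representation ℂ (Equiv.Perm (Fin (N + 1))) τ) (k : ℂ)

/-- Multiplication by a linear form on `ℂ[𝔥] ⊗ τ`. -/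
def opX (N : ℕ) (τ : Type*) [AddCommGroup τ] [Module ℂ τ] (φ : Module.Dual ℂ (Hsp (N + 1))) :
    Module.End ℂ (PT N τ) :=
  PT.map (LinearMap.mulLeft ℂ (linForm N φ)) LinearMap.id

/-- The diagonal action of `S_n` on `ℂ[𝔥] ⊗ τ`. -/
def opW (g : Equiv.Perm (Fin (N + 1))) : Module.End ℂ (PT N τ) :=
  PT.map (act N g).toLinearMap (ρ g)

/-- The Dunkl operators on `ℂ[𝔥] ⊗ τ`. -/
def opY (v : Hsp (N + 1)) : Module.End ℂ (PT N τ) :=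
  PT.map (der N v).toLinearMap LinearMap.id - ∑ p ∈ reflections (N + 1),
    (k * root (N + 1) p.1 p.2 v) •
      PT.map (divDiff N p.1 p.2) (ρ (Equiv.swap p.1 p.2))

@[simp]
theorem opX_tmul (φ : Module.Dual ℂ (Hsp (N + 1))) (p : MvPolynomial (Fin N) ℂ) (t : τ) :
    opX N τ φ (p ⊠ t) = (linForm N φ * p) ⊠ t := rfl

@[simp]
theorem opW_tmul (g : Equiv.Perm (Fin (N + 1))) (p : MvPolynomial (Fin N) ℂ) (t : τ) :
    opW ρ g (p ⊠ t) = (act N g p) ⊠ ρ g t := rfl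

@[simp]
theorem opY_tmul (v : Hsp (N + 1)) (p : MvPolynomial (Fin N) ℂ) (t : τ) :
    opY ρ k v (p ⊠ t) = (der N v p) ⊠ t - ∑ q ∈ reflections (N + 1),
      (k * root (N + 1) q.1 q.2 v) • (divDiff N q.1 q.2 p ⊠ ρ (Equiv.swap q.1 q.2) t) := by
  simp [opY, LinearMap.sum_apply]

theorem opW_one : opW ρ 1 = 1 := by
  refine PT.ext fun p t => ?_
  rw [opW_tmul, act_one, map_one]; rfl

theorem opW_mul (g h : Equiv.Perm (Fin (N + 1))) : opW ρ (g * h) = opW ρ g * opW ρ h := by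
  refine PT.ext fun p t => ?_
  rw [Module.End.mul_apply, opW_tmul, opW_tmul, opW_tmul, act_mul, map_mul]; rfl

theorem opX_add (φ ψ : Module.Dual ℂ (Hsp (N + 1))) : opX N τ (φ + ψ) = opX N τ φ + opX N τ ψ := by
  refine PT.ext fun p t => ?_
  simp [add_mul, PT.add_tmul]

theorem opX_smul (c : ℂ) (φ : Module.Dual ℂ (Hsp (N + 1))) : opX N τ (c • φ) = c • opX N τ φ := by
  refine PT.ext fun p t => ?_
  simp [PT.smul_tmul]

theorem opX_mul_opX (φ ψ : Module.Dual ℂ (Hsp (N + 1))) :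
    opX N τ φ * opX N τ ψ = opX N τ ψ * opX N τ φ := by
  refine PT.ext fun p t => ?_
  simp [mul_left_comm]

theorem opW_mul_opX (g : Equiv.Perm (Fin (N + 1))) (φ : Module.Dual ℂ (Hsp (N + 1))) :
    opW ρ g * opX N τ φ = opX N τ ((reflRep (N + 1)).dual g φ) * opW ρ g := by
  refine PT.ext fun p t => ?_
  simp only [Module.End.mul_apply, opX_tmul, opW_tmul, map_mul, act_linForm]

theorem opY_add (u v : Hsp (N + 1)) : opY ρ k (u + v) = opY ρ k u + opY ρ k v := by
  refine PT.ext fun p t => ?_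
  simp only [opY_tmul, LinearMap.add_apply, der_add, map_add, mul_add, add_smul,
    Finset.sum_add_distrib, PT.add_tmul]
  abel

theorem opY_smul (c : ℂ) (v : Hsp (N + 1)) : opY ρ k (c • v) = c • opY ρ k v := by
  refine PT.ext fun p t => ?_
  simp only [opY_tmul, LinearMap.smul_apply, der_smul, map_smul, smul_sub, Finset.smul_sum,
    smul_smul, PT.smul_tmul, smul_eq_mul, mul_left_comm]

theorem opW_mul_opY (g : Equiv.Perm (Fin (N + 1))) (v : Hsp (N + 1)) :
    opW ρ g * opY ρ k v = opY ρ k (reflRep (N + 1) g v) * opW ρ g := by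
  refine PT.ext fun p t => ?_
  simp only [Module.End.mul_apply, opY_tmul, opW_tmul, map_sub, map_sum, map_smul, act_der]
  congr 1
  rw [← sum_reflections_perm (fun i j => (k * root (N + 1) i j (reflRep (N + 1) g v)) •
    (divDiff N i j (act N g p) ⊠ ρ (Equiv.swap i j) (ρ g t))) _ g]
  · refine Finset.sum_congr rfl fun q _ => ?_
    rw [root_reflRep, act_divDiff, ← Module.End.mul_apply, ← Module.End.mul_apply, ← map_mul,
      ← map_mul, Equiv.mul_swap_eq_swap_mul]
  · intro i j
    rw [root_swap, divDiff_swap, Equiv.swap_comm]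
    simp [PT.neg_tmul]

theorem opY_mul_opX (v : Hsp (N + 1)) (φ : Module.Dual ℂ (Hsp (N + 1))) :
    opY ρ k v * opX N τ φ - opX N τ φ * opY ρ k v =
      algebraMap ℂ _ (φ v) - ∑ p ∈ reflections (N + 1),
        (k * root (N + 1) p.1 p.2 v * φ (coroot (N + 1) p.1 p.2)) •
          opW ρ (Equiv.swap p.1 p.2) := by
  refine PT.ext fun p t => ?_
  simp only [Module.End.mul_apply, opY_tmul, opX_tmul, LinearMap.sub_apply, map_sub, map_sum,
    map_smul, LinearMap.sum_apply, LinearMap.smul_apply, opW_tmul, Derivation.leibniz,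
    divDiff_linForm_mul, PT.add_tmul, smul_add, Finset.sum_add_distrib, der_linForm,
    Module.algebraMap_end_apply, smul_eq_mul]
  rw [mul_comm p, ← smul_eq_C_mul, PT.smul_tmul]
  simp only [← PT.smul_tmul, smul_smul]
  abel

theorem opY_one_tmul (v : Hsp (N + 1)) (t : τ) : opY ρ k v (1 ⊠ t) = 0 := by
  rw [opY_tmul, Derivation.map_one_eq_zero]
  rw [← C_1]
  simp only [divDiff_C, PT.zero_tmul, smul_zero, Finset.sum_const_zero, sub_zero]

theorem opY_mul_reflection (u : Hsp (N + 1)) (i j : Fin (N + 1)) :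
    opY ρ k u * opW ρ (Equiv.swap i j) - opW ρ (Equiv.swap i j) * opY ρ k u =
      root (N + 1) i j u • (opY ρ k (coroot (N + 1) i j) * opW ρ (Equiv.swap i j)) := by
  have h : opY ρ k u = opY ρ k (reflRep (N + 1) (Equiv.swap i j) u) +
      root (N + 1) i j u • opY ρ k (coroot (N + 1) i j) := by
    rw [← opY_smul, ← opY_add, reflRep_transposition, sub_add_cancel]
  rw [opW_mul_opY, ← sub_mul]
  conv_lhs => rw [h]
  rw [add_sub_cancel_left, smul_mul_assoc]

/-- The operator [Y_u, Y_v] commutes with all multiplications by linear forms and kills 1 ⊗ τ, so it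
kills ℂ[𝔥] ⊗ τ. This avoids any direct computation with products of divided differences. -/
theorem opY_mul_opY (u v : Hsp (N + 1)) : opY ρ k u * opY ρ k v = opY ρ k v * opY ρ k u := by
  have hS : ∀ (u v : Hsp (N + 1)) (φ : Module.Dual ℂ (Hsp (N + 1))),
      opY ρ k u * (opY ρ k v * opX N τ φ - opX N τ φ * opY ρ k v) -
        (opY ρ k v * opX N τ φ - opX N τ φ * opY ρ k v) * opY ρ k u =
      - ∑ p ∈ reflections (N + 1), (k * root (N + 1) p.1 p.2 v * φ (coroot (N + 1) p.1 p.2) *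
        root (N + 1) p.1 p.2 u) •
          (opY ρ k (coroot (N + 1) p.1 p.2) * opW ρ (Equiv.swap p.1 p.2)) := by
    intro u v φ
    rw [opY_mul_opX, mul_sub, sub_mul, ← Algebra.commutes, sub_sub_sub_cancel_left,
      Finset.mul_sum, Finset.sum_mul, ← Finset.sum_sub_distrib, ← Finset.sum_neg_distrib]
    refine Finset.sum_congr rfl fun p _ => ?_
    rw [mul_smul _ (root _ _ _ _), ← opY_mul_reflection, mul_smul_comm, smul_mul_assoc,
      ← smul_sub, ← smul_neg, neg_sub]
  -- By the Jacobi identity [[Y_u, Y_v], x] is the difference of two expressions computed in `hS`,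
  -- and these are symmetric in u and v.
  have hcomm : ∀ φ : Module.Dual ℂ (Hsp (N + 1)),
      (opY ρ k u * opY ρ k v - opY ρ k v * opY ρ k u) * opX N τ φ =
        opX N τ φ * (opY ρ k u * opY ρ k v - opY ρ k v * opY ρ k u) := by
    intro φ
    have h1 := hS u v φ
    have h2 := hS v u φ
    have h3 : ∑ p ∈ reflections (N + 1), (k * root (N + 1) p.1 p.2 v *
        φ (coroot (N + 1) p.1 p.2) * root (N + 1) p.1 p.2 u) •
          (opY ρ k (coroot (N + 1) p.1 p.2) * opW ρ (Equiv.swap p.1 p.2)) =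
        ∑ p ∈ reflections (N + 1), (k * root (N + 1) p.1 p.2 u *
        φ (coroot (N + 1) p.1 p.2) * root (N + 1) p.1 p.2 v) •
          (opY ρ k (coroot (N + 1) p.1 p.2) * opW ρ (Equiv.swap p.1 p.2)) :=
      Finset.sum_congr rfl fun p _ => by congr 1; ring
    rw [h3, ← h2] at h1
    rw [← sub_eq_zero] at h1 ⊢
    rw [← h1]
    noncomm_ring
  rw [← sub_eq_zero]
  refine PT.ext fun p t => ?_
  rw [LinearMap.zero_apply]
  induction p using MvPolynomial.induction_on with
  | C a =>
    rw [← mul_one (C a), ← smul_eq_C_mul, PT.smul_tmul, map_smul,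
      LinearMap.sub_apply, Module.End.mul_apply, Module.End.mul_apply, opY_one_tmul,
      opY_one_tmul, map_zero, map_zero, sub_zero, smul_zero]
  | add p q hp hq => rw [PT.add_tmul, map_add, hp, hq, add_zero]
  | mul_X p a hp =>
    rw [mul_comm, ← linForm_coord, ← opX_tmul, ← Module.End.mul_apply, hcomm,
      Module.End.mul_apply, hp, map_zero]

/-- The action of the generators of `H_k(n)` on `ℂ[𝔥] ⊗ τ`. -/
def genOp : Gen (N + 1) → Module.End ℂ (PT N τ)
  | .w g => opW ρ g
  | .y v => opY ρ k v
  | .x φ => opX N τ φ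

/-- The representation of `H_k(n)` on `ℂ[𝔥] ⊗ τ` by Dunkl operators. -/
def dunkl : Alg (N + 1) k →ₐ[ℂ] Module.End ℂ (PT N τ) :=
  RingQuot.liftAlgHom ℂ ⟨FreeAlgebra.lift ℂ (genOp ρ k), by
    intro a b h
    induction h <;> simp only [map_mul, map_add, map_sub, map_sum, map_smul, map_one,
      FreeAlgebra.lift_ι_apply, genOp, AlgHom.commutes]
    · exact opW_one ρ
    · exact opW_mul ρ _ _
    · exact opY_add ρ k _ _
    · exact opY_smul ρ k _ _
    · exact opX_add _ _
    · exact opX_smul _ _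
    · exact opW_mul_opY ρ k _ _
    · exact opW_mul_opX ρ _ _
    · exact opX_mul_opX _ _
    · exact opY_mul_opY ρ k _ _
    · exact opY_mul_opX ρ k _ _⟩

@[simp]
theorem dunkl_W (g : Equiv.Perm (Fin (N + 1))) : dunkl ρ k (W (N + 1) k g) = opW ρ g := by
  change RingQuot.liftAlgHom ℂ _ (RingQuot.mkAlgHom ℂ _ _) = _
  rw [RingQuot.liftAlgHom_mkAlgHom_apply]
  simp [genOp]

@[simp]
theorem dunkl_Y (v : Hsp (N + 1)) : dunkl ρ k (Y (N + 1) k v) = opY ρ k v := by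
  change RingQuot.liftAlgHom ℂ _ (RingQuot.mkAlgHom ℂ _ _) = _
  rw [RingQuot.liftAlgHom_mkAlgHom_apply]
  simp [genOp]

@[simp]
theorem dunkl_X (φ : Module.Dual ℂ (Hsp (N + 1))) :
    dunkl ρ k (X (N + 1) k φ) = opX N τ φ := by
  change RingQuot.liftAlgHom ℂ _ (RingQuot.mkAlgHom ℂ _ _) = _
  rw [RingQuot.liftAlgHom_mkAlgHom_apply]
  simp [genOp]

end Dunkl

/-! ### Generators of `H_k(n)` -/

theorem Y_mul_X {n : ℕ} {k : ℂ} (v : Hsp n) (f : Module.Dual ℂ (Hsp n)) :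
    Y n k v * X n k f - X n k f * Y n k v = algebraMap ℂ _ (f v) - ∑ p ∈ reflections n,
      (k * root n p.1 p.2 v * f (coroot n p.1 p.2)) • W n k (Equiv.swap p.1 p.2) := by
  have := Alg.mk_rel (k := k) (Rel.y_x v f)
  simp only [map_mul, map_sub, map_sum, map_smul, AlgHom.commutes] at this
  exact this

@[elab_as_elim]
theorem Alg.induction {n : ℕ} {k : ℂ} {P : Alg n k → Prop}
    (hc : ∀ c, P (algebraMap ℂ _ c)) (hW : ∀ g, P (W n k g)) (hY : ∀ v, P (Y n k v))
    (hX : ∀ f, P (X n k f)) (hmul : ∀ a b, P a → P b → P (a * b))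
    (hadd : ∀ a b, P a → P b → P (a + b)) (a : Alg n k) : P a := by
  obtain ⟨a, rfl⟩ := RingQuot.mkAlgHom_surjective ℂ (Rel n k) a
  induction a using FreeAlgebra.induction with
  | grade0 c => 
    rw [AlgHom.commutes]
    exact hc c
  | grade1 x => 
    cases x
    · exact hW _
    · exact hY _
    · exact hX _
  | mul a b ha hb => 
    rw [map_mul]
    exact hmul _ _ ha hb
  | add a b ha hb => 
    rw [map_add]
    exact hadd _ _ ha hb

/-- A subspace which is stable under the generators is a submodule. -/
theorem smul_mem_of_generators {n : ℕ} {k : ℂ} {M : Type*} [AddCommGroup M] [Module ℂ M]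
    [Module (Alg n k) M] [IsScalarTower ℂ (Alg n k) M] (S : Submodule ℂ M)
    (hW : ∀ g, ∀ m ∈ S, W n k g • m ∈ S) (hY : ∀ v, ∀ m ∈ S, Y n k v • m ∈ S)
    (hX : ∀ f, ∀ m ∈ S, X n k f • m ∈ S) (a : Alg n k) {m : M} (hm : m ∈ S) : a • m ∈ S := by
  induction a using Alg.induction generalizing m with
  | hc c => rw [algebraMap_smul]; exact S.smul_mem _ hm
  | hW g => exact hW g m hm
  | hY v => exact hY v m hm
  | hX f => exact hX f m hm
  | hmul a b ha hb => rw [mul_smul]; exact ha (hb hm)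
  | hadd a b ha hb => rw [add_smul]; exact S.add_mem (ha hm) (hb hm)

/-! ### Standard modules -/

section Standard

variable {τ : Type*} [AddCommGroup τ] [Module ℂ τ]

section lift

variable {n : ℕ} {k : ℂ} (ρ : Representation ℂ (Equiv.Perm (Fin n)) τ)
  {M : Type*} [AddCommGroup M] [Module ℂ M] [Module (Alg n k) M] [IsScalarTower ℂ (Alg n k) M]

/-- The universal property of standard modules. -/
def Std.lift (θ : τ →ₗ[ℂ] M) (hW : ∀ g t, W n k g • θ t = θ (ρ g t))
    (hY : ∀ v t, Y n k v • θ t = 0) : Std n k ρ →ₗ[Alg n k] M :=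
  Submodule.liftQ _ (TensorProduct.AlgebraTensorModule.lift
      (LinearMap.toSpanSingleton (Alg n k) (τ →ₗ[ℂ] M) θ)) (by
    rw [stdRel, Submodule.span_le]
    rintro _ (⟨g, v, rfl⟩ | ⟨y, v, rfl⟩)
    · simp [hW]
    · simp [hY])


@[simp]
theorem Std.lift_lowest (θ : τ →ₗ[ℂ] M) (hW : ∀ g t, W n k g • θ t = θ (ρ g t))
    (hY : ∀ v t, Y n k v • θ t = 0) (t : τ) :
    Std.lift ρ θ hW hY (Std.lowest n k ρ t) = θ t := by
  simp [Std.lift, Std.lowest, LinearMap.toSpanSingleton_apply]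

theorem Std.W_smul_lowest (g : Equiv.Perm (Fin n)) (t : τ) :
    W n k g • Std.lowest n k ρ t = Std.lowest n k ρ (ρ g t) := by
  refine (Submodule.Quotient.eq _).2 (Submodule.subset_span (Or.inl ⟨g, t, ?_⟩))
  change W n k g • (1 ⊗ₜ[ℂ] t) - _ = _
  rw [TensorProduct.smul_tmul', smul_eq_mul, mul_one]

theorem Std.Y_smul_lowest (v : Hsp n) (t : τ) : Y n k v • Std.lowest n k ρ t = 0 := by
  refine (Submodule.Quotient.mk_eq_zero _).2 (Submodule.subset_span (Or.inr ⟨v, t, ?_⟩))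
  change Y n k v • (1 ⊗ₜ[ℂ] t) = _
  rw [TensorProduct.smul_tmul', smul_eq_mul, mul_one]

/-- The vectors `1 ⊗ v` of a standard module, as a linear map. -/
def Std.lowestₗ (n : ℕ) (k : ℂ) (ρ : Representation ℂ (Equiv.Perm (Fin n)) τ) :
    τ →ₗ[ℂ] Std n k ρ where
  toFun := Std.lowest n k ρ
  map_add' s t := by simp [Std.lowest, TensorProduct.tmul_add]
  map_smul' c t := by
    rw [RingHom.id_apply, Std.lowest, TensorProduct.tmul_smul]
    rfl

theorem Std.span_lowest (S : Submodule (Alg n k) (Std n k ρ))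
    (h : ∀ t, Std.lowest n k ρ t ∈ S) : S = ⊤ := by
  rw [eq_top_iff]
  rintro x -
  obtain ⟨y, rfl⟩ := Submodule.Quotient.mk_surjective _ x
  induction y using TensorProduct.induction_on with
  | zero => exact S.zero_mem
  | tmul a t =>
    have := S.smul_mem a (h t)
    rwa [Std.lowest, ← Submodule.Quotient.mk_smul, TensorProduct.smul_tmul', smul_eq_mul,
      mul_one] at this
  | add x y hx hy => exact S.add_mem hx hy

omit [Module ℂ M] [IsScalarTower ℂ (Alg n k) M] in
theorem Std.hom_ext {f g : Std n k ρ →ₗ[Alg n k] M}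
    (h : ∀ t, f (Std.lowest n k ρ t) = g (Std.lowest n k ρ t)) : f = g := by
  rw [← LinearMap.eqLocus_eq_top]
  exact Std.span_lowest ρ _ h

end lift

/-- The homomorphism `ℂ[𝔥] → H_k(n)`. -/
def polyHom (N : ℕ) (k : ℂ) : MvPolynomial (Fin N) ℂ →ₐ[ℂ] Alg (N + 1) k :=
  open scoped IsMulCommutative in
  (xSub (N + 1) k).val.comp (aeval fun a =>
    (⟨X (N + 1) k ((hBasis N).coord a), Algebra.subset_adjoin ⟨_, rfl⟩⟩ : xSub (N + 1) k))

variable {k : ℂ}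

theorem polyHom_X (a : Fin N) : polyHom N k (.X a) = X (N + 1) k ((hBasis N).coord a) := by
  simp [polyHom]

theorem polyHom_linForm (φ : Module.Dual ℂ (Hsp (N + 1))) :
    polyHom N k (linForm N φ) = X (N + 1) k φ := by
  have : (polyHom N k).toLinearMap.comp (linForm N) = X (N + 1) k := by
    refine (hBasis N).dualBasis.ext fun a => ?_
    rw [Module.Basis.coe_dualBasis, LinearMap.comp_apply, linForm_coord]
    exact polyHom_X a
  exact LinearMap.congr_fun this φ

/-- The translation-invariant coordinates `x_i - (x_1 + ⋯ + x_n) / n` as polynomials on `𝔥`. -/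
def xPoly (N : ℕ) (i : Fin (N + 1)) : MvPolynomial (Fin N) ℂ := linForm N (xfun (N + 1) i)

theorem polyEval_eq (p : MvPolynomial (Fin (N + 1)) ℂ) :
    polyEval (N + 1) k p = polyHom N k (aeval (xPoly N) p) := by
  have : polyEval (N + 1) k = (polyHom N k).comp (aeval (xPoly N)) := by
    refine MvPolynomial.algHom_ext fun i => ?_
    rw [AlgHom.comp_apply, aeval_X, xPoly, polyHom_linForm]
    simp [polyEval]
  rw [this]; rfl

theorem W_mul_polyHom (g : Equiv.Perm (Fin (N + 1))) (p : MvPolynomial (Fin N) ℂ) :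
    W (N + 1) k g * polyHom N k p = polyHom N k (act N g p) * W (N + 1) k g := by
  induction p using MvPolynomial.induction_on with
  | C a => rw [← algebraMap_eq, AlgHom.commutes, AlgHom.commutes, AlgHom.commutes,
      Algebra.commutes]
  | add p q hp hq => rw [map_add, map_add, map_add, mul_add, add_mul, hp, hq]
  | mul_X p a hp =>
    rw [map_mul, ← mul_assoc, hp, mul_assoc, polyHom_X, W_mul_X, map_mul, map_mul, act_X,
      polyHom_linForm, mul_assoc]

section DunklMod

variable (k) (ρ : Representation ℂ (Equiv.Perm (Fin (N + 1))) τ)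

/-- The space `ℂ[𝔥] ⊗ τ` with the action of `H_k(n)` by Dunkl operators. -/
def DunklMod (_ : ℂ) (_ : Representation ℂ (Equiv.Perm (Fin (N + 1))) τ) : Type _ := PT N τ

instance : AddCommGroup (DunklMod k ρ) := inferInstanceAs (AddCommGroup (PT N τ))
instance : Module ℂ (DunklMod k ρ) := inferInstanceAs (Module ℂ (PT N τ))
instance : Module (Alg (N + 1) k) (DunklMod k ρ) :=
  letI : Module (Alg (N + 1) k) (PT N τ) := Module.compHom (PT N τ) (dunkl ρ k).toRingHom
  inferInstanceAs (Module (Alg (N + 1) k) (PT N τ))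

/-- The identity map from `ℂ[𝔥] ⊗ τ`. -/
def DunklMod.of : PT N τ ≃ₗ[ℂ] DunklMod k ρ := LinearEquiv.refl ℂ (PT N τ)

theorem DunklMod.smul_of (a : Alg (N + 1) k) (m : PT N τ) :
    a • DunklMod.of k ρ m = DunklMod.of k ρ (dunkl ρ k a m) := rfl

instance : IsScalarTower ℂ (Alg (N + 1) k) (DunklMod k ρ) where
  smul_assoc c a m := by
    obtain ⟨m, rfl⟩ := (DunklMod.of k ρ).surjective m
    rw [DunklMod.smul_of, map_smul (dunkl ρ k), LinearMap.smul_apply, map_smul, DunklMod.smul_of]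

theorem dunkl_polyHom (p q : MvPolynomial (Fin N) ℂ) (t : τ) :
    dunkl ρ k (polyHom N k p) (q ⊠ t) = (p * q) ⊠ t := by
  induction p using MvPolynomial.induction_on generalizing q with
  | C a =>
    rw [← algebraMap_eq, AlgHom.commutes, AlgHom.commutes, Module.algebraMap_end_apply,
      ← PT.smul_tmul, Algebra.smul_def]
  | add p p' hp hp' => rw [map_add, map_add, LinearMap.add_apply, hp, hp', add_mul, PT.add_tmul]
  | mul_X p a hp =>
    rw [map_mul, map_mul, Module.End.mul_apply, polyHom_X, dunkl_X, opX_tmul, hp, linForm_coord,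
      mul_assoc]

/-- The map from the standard module to `ℂ[𝔥] ⊗ τ`. -/
def Std.toDunkl : Std (N + 1) k ρ →ₗ[Alg (N + 1) k] DunklMod k ρ :=
  Std.lift ρ ((DunklMod.of k ρ).toLinearMap.comp (PT.mk N τ 1))
    (fun g t => by
      change W (N + 1) k g • DunklMod.of k ρ (1 ⊠ t) = DunklMod.of k ρ (1 ⊠ ρ g t)
      rw [DunklMod.smul_of, dunkl_W, opW_tmul, map_one])
    (fun v t => by
      change Y (N + 1) k v • DunklMod.of k ρ (1 ⊠ t) = 0
      rw [DunklMod.smul_of, dunkl_Y, opY_one_tmul, map_zero])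

theorem Std.toDunkl_lowest (t : τ) :
    Std.toDunkl k ρ (Std.lowest (N + 1) k ρ t) = DunklMod.of k ρ (1 ⊠ t) :=
  Std.lift_lowest ρ _ _ _ t

/-- The map `p ⊗ t ↦ p · t` from `ℂ[𝔥] ⊗ τ` to the standard module. -/
def Std.ofPT : PT N τ →ₗ[ℂ] Std (N + 1) k ρ :=
  PT.lift (((Algebra.lsmul ℂ ℂ (Std (N + 1) k ρ)).toLinearMap.compl₂ (Std.lowestₗ (N + 1) k ρ)).comp
    (polyHom N k).toLinearMap)

theorem Std.ofPT_tmul (p : MvPolynomial (Fin N) ℂ) (t : τ) :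
    Std.ofPT k ρ (p ⊠ t) = polyHom N k p • Std.lowest (N + 1) k ρ t := rfl

/-- This is the independence half of the PBW theorem: the Dunkl representation separates the vectors
p · t. The spanning half is `Std.ofPT_surjective`. -/
theorem Std.toDunkl_ofPT (m : PT N τ) :
    Std.toDunkl k ρ (Std.ofPT k ρ m) = DunklMod.of k ρ m := by
  have : ((Std.toDunkl k ρ).restrictScalars ℂ).comp (Std.ofPT k ρ) =
      (DunklMod.of k ρ).toLinearMap := by
    refine PT.ext fun p t => ?_
    change Std.toDunkl k ρ (polyHom N k p • Std.lowest (N + 1) k ρ t) = DunklMod.of k ρ (p ⊠ t)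
    rw [map_smul, Std.toDunkl_lowest, DunklMod.smul_of, dunkl_polyHom, mul_one]
  exact LinearMap.congr_fun this m

theorem Std.W_smul_ofPT (g : Equiv.Perm (Fin (N + 1))) (m : PT N τ) :
    W (N + 1) k g • Std.ofPT k ρ m ∈ LinearMap.range (Std.ofPT k ρ) := by
  have : (LinearMap.range (Std.ofPT k ρ)).comap
      ((Algebra.lsmul ℂ ℂ (Std (N + 1) k ρ) (W (N + 1) k g)).comp (Std.ofPT k ρ)) = ⊤ := by
    refine PT.eq_top _ fun p t => ?_
    refine ⟨act N g p ⊠ ρ g t, ?_⟩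
    change polyHom N k (act N g p) • Std.lowest (N + 1) k ρ (ρ g t) =
      W (N + 1) k g • polyHom N k p • Std.lowest (N + 1) k ρ t
    rw [← Std.W_smul_lowest, ← mul_smul, ← mul_smul, W_mul_polyHom]
  exact this.ge (Submodule.mem_top (x := m))

theorem Std.X_smul_ofPT (φ : Module.Dual ℂ (Hsp (N + 1))) (m : PT N τ) :
    X (N + 1) k φ • Std.ofPT k ρ m ∈ LinearMap.range (Std.ofPT k ρ) := by
  have : (LinearMap.range (Std.ofPT k ρ)).comap
      ((Algebra.lsmul ℂ ℂ (Std (N + 1) k ρ) (X (N + 1) k φ)).comp (Std.ofPT k ρ)) = ⊤ := by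
    refine PT.eq_top _ fun p t => ?_
    refine ⟨(linForm N φ * p) ⊠ t, ?_⟩
    change polyHom N k (linForm N φ * p) • Std.lowest (N + 1) k ρ t =
      X (N + 1) k φ • polyHom N k p • Std.lowest (N + 1) k ρ t
    rw [map_mul, polyHom_linForm, mul_smul]
  exact this.ge (Submodule.mem_top (x := m))

/-- An element of 𝔥 is moved to the right past one variable at a time until it kills the lowest
vector; each commutator contributes only scalars and group elements, which preserve the range. -/
theorem Std.Y_smul_ofPT (v : Hsp (N + 1)) (m : PT N τ) :
    Y (N + 1) k v • Std.ofPT k ρ m ∈ LinearMap.range (Std.ofPT k ρ) := by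
  have : (LinearMap.range (Std.ofPT k ρ)).comap
      ((Algebra.lsmul ℂ ℂ (Std (N + 1) k ρ) (Y (N + 1) k v)).comp (Std.ofPT k ρ)) = ⊤ := by
    refine PT.eq_top _ fun p t => ?_
    change Y (N + 1) k v • Std.ofPT k ρ (p ⊠ t) ∈ LinearMap.range (Std.ofPT k ρ)
    induction p using MvPolynomial.induction_on with
    | C a =>
      rw [Std.ofPT_tmul, ← algebraMap_eq, AlgHom.commutes, ← mul_smul, ← Algebra.commutes,
        mul_smul, Std.Y_smul_lowest, smul_zero]
      exact Submodule.zero_mem _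
    | add p q hp hq =>
      rw [PT.add_tmul, map_add, smul_add]
      exact Submodule.add_mem _ hp hq
    | mul_X p a hp =>
      have h1 : Std.ofPT k ρ ((p * MvPolynomial.X a) ⊠ t) =
          X (N + 1) k ((hBasis N).coord a) • Std.ofPT k ρ (p ⊠ t) := by
        rw [Std.ofPT_tmul, Std.ofPT_tmul, mul_comm, map_mul, polyHom_X, mul_smul]
      rw [h1, ← mul_smul, ← sub_add_cancel (Y (N + 1) k v * X (N + 1) k ((hBasis N).coord a))
        (X (N + 1) k ((hBasis N).coord a) * Y (N + 1) k v), Y_mul_X, add_smul, sub_smul,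
        algebraMap_smul, mul_smul, Finset.sum_smul]
      obtain ⟨m, hm⟩ := hp
      refine Submodule.add_mem _ (Submodule.sub_mem _ (Submodule.smul_mem _ _ ⟨_, rfl⟩)
        (Submodule.sum_mem _ fun q _ => ?_)) ?_
      · rw [smul_assoc]
        exact Submodule.smul_mem _ _ (Std.W_smul_ofPT k ρ _ _)
      · rw [← hm]
        exact Std.X_smul_ofPT k ρ _ _
  exact this.ge (Submodule.mem_top (x := m))

theorem Std.ofPT_surjective : Function.Surjective (Std.ofPT k ρ) := by
  let S : Submodule (Alg (N + 1) k) (Std (N + 1) k ρ) :=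
    { LinearMap.range (Std.ofPT k ρ) with
      smul_mem' := fun a m hm => smul_mem_of_generators (LinearMap.range (Std.ofPT k ρ))
        (by rintro g _ ⟨m, rfl⟩; exact Std.W_smul_ofPT k ρ g m)
        (by rintro g _ ⟨m, rfl⟩; exact Std.Y_smul_ofPT k ρ g m)
        (by rintro g _ ⟨m, rfl⟩; exact Std.X_smul_ofPT k ρ g m) a hm }
  have hS : S = ⊤ := by
    refine Std.span_lowest ρ S fun t => ?_
    refine ⟨1 ⊠ t, ?_⟩
    rw [Std.ofPT_tmul, map_one, one_smul]
  intro m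
  exact hS.ge (Submodule.mem_top (x := m))

/-- The PBW isomorphism `M_k(τ) ≅ ℂ[𝔥] ⊗ τ`. -/
def Std.equivDunkl : Std (N + 1) k ρ ≃ₗ[Alg (N + 1) k] DunklMod k ρ :=
  LinearEquiv.ofBijective (Std.toDunkl k ρ) ⟨by
    intro x y h
    obtain ⟨x, rfl⟩ := Std.ofPT_surjective k ρ x
    obtain ⟨y, rfl⟩ := Std.ofPT_surjective k ρ y
    rw [Std.toDunkl_ofPT, Std.toDunkl_ofPT] at h
    rw [(DunklMod.of k ρ).injective h], fun m => ⟨_, Std.toDunkl_ofPT k ρ m⟩⟩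

end DunklMod

end Standard

end Cherednik

end

noncomputable section

/-! ### Products of binomial series -/

namespace BinomialProduct

open PowerSeries

variable {B : Type*} [CommRing B] [Algebra ℂ B] {ι : Type*} [Fintype ι]

/-- The power series `(1 - c u)^k`. -/
def factor (k : ℂ) (c : B) : B⟦X⟧ := rescale (-c) (binomialSeries B k)

/-- The power series `1 / (1 - c u)`. -/
def geom (c : B) : B⟦X⟧ := mk fun m => c ^ m

/-- The power series `∏_j (1 - c_j u)^k`. -/
def binProd (k : ℂ) (c : ι → B) : B⟦X⟧ := ∏ j, factor k (c j)

theorem choose_succ (k : ℂ) (m : ℕ) :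
    ((m : ℂ) + 1) * Ring.choose k (m + 1) = (k - m) * Ring.choose k m := by
  have := Ring.choose_smul_choose k (Nat.le_succ m)
  simp only [Nat.succ_eq_add_one, Nat.choose_succ_self_right, nsmul_eq_mul, add_tsub_cancel_left,
    Ring.choose_one_right] at this
  push_cast at this
  rw [this, mul_comm]

theorem coeff_factor (k : ℂ) (c : B) (m : ℕ) :
    coeff m (factor k c) = (-c) ^ m * algebraMap ℂ B (Ring.choose k m) := by
  rw [factor, coeff_rescale, binomialSeries_coeff, Algebra.algebraMap_eq_smul_one]

omit [Algebra ℂ B] in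
theorem one_sub_mul_geom (c : B) : (1 - C c * X) * geom c = 1 := by
  ext m
  rw [sub_mul, one_mul, map_sub, mul_assoc, coeff_C_mul, geom, coeff_mk]
  cases m with
  | zero => simp
  | succ m => rw [coeff_succ_X_mul, coeff_mk, coeff_one, if_neg m.succ_ne_zero, pow_succ']; simp

omit [Algebra ℂ B] in
theorem geom_eq (c : B) : geom c = 1 + C c * X * geom c := by
  linear_combination one_sub_mul_geom c

omit [Algebra ℂ B] in
theorem eq_mul_geom {c : B} {p q : B⟦X⟧} (h : (1 - C c * X) * p = q) : p = q * geom c := by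
  linear_combination geom c * h - p * one_sub_mul_geom c

omit [Algebra ℂ B] in
theorem geom_sub_geom (a b : B) : geom a - geom b = C (a - b) * X * geom a * geom b := by
  rw [map_sub]
  linear_combination geom b * one_sub_mul_geom a - geom a * one_sub_mul_geom b

/-- After multiplication by 1 - cu the claim is the differential equation of the binomial series,
which is the recursion `choose_succ` on coefficients. -/
theorem derivative_factor (k : ℂ) (c : B) :
    d⁄dX B (factor k c) = - C (algebraMap ℂ B k * c) * geom c * factor k c := by
  have : (1 - C c * X) * d⁄dX B (factor k c) = - C (algebraMap ℂ B k * c) * factor k c := by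
    ext m
    rw [sub_mul, one_mul, map_sub, mul_assoc, coeff_C_mul, ← map_neg, coeff_C_mul,
      coeff_derivative, coeff_factor, coeff_factor]
    have h : ((m : B) + 1) * algebraMap ℂ B (Ring.choose k (m + 1)) =
        (algebraMap ℂ B k - m) * algebraMap ℂ B (Ring.choose k m) := by
      have := congrArg (algebraMap ℂ B) (choose_succ k m)
      simpa using this
    cases m with
    | zero =>
      simp only [zero_add, Ring.choose_zero_right, Ring.choose_one_right,
        coeff_zero_X_mul]
      simp [mul_comm]
    | succ m =>
      rw [coeff_succ_X_mul, coeff_derivative, coeff_factor]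
      push_cast at h ⊢
      linear_combination (-c) ^ (m + 1 + 1) * h
  rw [eq_mul_geom this]
  ring

omit [Algebra ℂ B] in
theorem X_mul_geom_mul (c : B) : C c * X * geom c = geom c - 1 := by
  linear_combination - one_sub_mul_geom c

omit [Algebra ℂ B] in
theorem derivative_geom (c : B) : d⁄dX B (geom c) = C c * geom c * geom c := by
  have h := congrArg (d⁄dX B) (one_sub_mul_geom c)
  simp only [Derivation.leibniz, map_sub, Derivation.map_one_eq_zero, derivative_X, smul_eq_mul,
    derivative_C] at h
  refine eq_mul_geom ?_
  linear_combination h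

theorem derivation_prod {M : Type*} [CommRing M] [Algebra ℂ M] (D : Derivation ℂ M M)
    (f u : ι → M) (h : ∀ j, D (f j) = u j * f j) : D (∏ j, f j) = (∑ j, u j) * ∏ j, f j := by
  classical
  suffices ∀ s : Finset ι, D (∏ j ∈ s, f j) = (∑ j ∈ s, u j) * ∏ j ∈ s, f j from this _
  intro s
  induction s using Finset.induction_on with
  | empty => simp
  | insert a s ha ih =>
    rw [Finset.prod_insert ha, Finset.sum_insert ha, Derivation.leibniz, ih, h, smul_eq_mul,
      smul_eq_mul]
    ring

/-- Logarithmic derivatives add up, and -cu / (1 - cu) = 1 - 1 / (1 - cu). -/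
theorem X_mul_derivative_binProd (k : ℂ) (c : ι → B) :
    X * d⁄dX B (binProd k c) =
      (algebraMap ℂ B⟦X⟧ (k * Fintype.card ι) - algebraMap ℂ B⟦X⟧ k * ∑ j, geom (c j)) *
        binProd k c := by
  have h := derivation_prod ((d⁄dX B).restrictScalars ℂ) (fun j => factor k (c j))
    (fun j => - C (algebraMap ℂ B k * c j) * geom (c j)) (fun j => derivative_factor k (c j))
  rw [Derivation.restrictScalars_apply] at h
  rw [binProd, h, ← mul_assoc, Finset.mul_sum]
  congr 1
  have : ∀ j, X * (- C (algebraMap ℂ B k * c j) * geom (c j)) =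
      algebraMap ℂ B⟦X⟧ k - algebraMap ℂ B⟦X⟧ k * geom (c j) := by
    intro j
    rw [map_mul]
    have h2 : algebraMap ℂ B⟦X⟧ k = C (algebraMap ℂ B k) := algebraMap_apply
    rw [h2]
    linear_combination - C (algebraMap ℂ B k) * X_mul_geom_mul (c j)
  simp_rw [this]
  rw [Finset.sum_sub_distrib, ← Finset.mul_sum, Finset.sum_const, Finset.card_univ, map_mul]
  simp [mul_comm]

omit [Algebra ℂ B] in
theorem X_mul_derivative_geom (c : B) : X * d⁄dX B (geom c) = geom c * (geom c - 1) := by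
  rw [derivative_geom, ← X_mul_geom_mul]
  ring

omit [Algebra ℂ B] in
theorem coeff_X_mul_derivative (p : B⟦X⟧) (m : ℕ) : coeff m (X * d⁄dX B p) = m * coeff m p := by
  cases m with
  | zero => simp
  | succ m => rw [coeff_succ_X_mul, coeff_derivative]; push_cast; ring

/-- The identity behind the singularity of the `f_i`: the expression is a total derivative. -/
theorem coeff_total_derivative (k : ℂ) (r : ℕ) (hr : 0 < r) (c : ι → B)
    (hk : k * Fintype.card ι = r) (i : ι) :
    coeff r (X * (binProd k c * geom (c i) *
      (geom (c i) - algebraMap ℂ B⟦X⟧ k * ∑ j, geom (c j)))) = 0 := by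
  obtain ⟨r, rfl⟩ := Nat.exists_eq_succ_of_ne_zero hr.ne'
  -- Here `r` is the predecessor of the original exponent, so that k times the number of factors is
  -- r + 1. The expression is (u d/du - r) applied to F(u) / (1 - c_i u), and this operator
  -- annihilates the coefficient of u^r.
  have h1 : binProd k c * geom (c i) * (geom (c i) - algebraMap ℂ B⟦X⟧ k * ∑ j, geom (c j)) =
      X * d⁄dX B (binProd k c * geom (c i)) - (r : B⟦X⟧) * (binProd k c * geom (c i)) := by
    rw [Derivation.leibniz, smul_eq_mul, smul_eq_mul]
    have h2 := X_mul_derivative_binProd k c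
    rw [hk] at h2
    push_cast at h2
    linear_combination - binProd k c * X_mul_derivative_geom (c i) - geom (c i) * h2
  rw [Nat.succ_eq_add_one, coeff_succ_X_mul, h1, map_sub, coeff_X_mul_derivative,
    ← nsmul_eq_mul, ← nsmul_eq_mul, map_nsmul, sub_self]

/-- In degree r the operator u d/du acts by r = kn, so the logarithmic derivative formula leaves
only the sum of the geometric terms. This is the relation ∑ f_i = 0. -/
theorem coeff_binProd_mul_sum_geom (k : ℂ) (r : ℕ) (hr : 0 < r) (c : ι → B)
    (hk : k * Fintype.card ι = r) : ∑ j, coeff r (binProd k c * geom (c j)) = 0 := by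
  have h := congrArg (coeff r) (X_mul_derivative_binProd k c)
  have hk0 : k ≠ 0 := by
    rintro rfl
    rw [zero_mul] at hk
    exact hr.ne (by exact_mod_cast hk)
  rw [coeff_X_mul_derivative, hk, sub_mul, map_sub, map_natCast, ← nsmul_eq_mul, ← nsmul_eq_mul,
    map_nsmul, eq_comm, sub_eq_self, mul_assoc, ← Algebra.smul_def, coeff_smul] at h
  have h2 : coeff r ((∑ j, geom (c j)) * binProd k c) = 0 := by
    have := congrArg (k⁻¹ • ·) h
    simpa [smul_smul, hk0] using this
  rw [← h2, Finset.sum_mul, map_sum]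
  exact Finset.sum_congr rfl fun j _ => by rw [mul_comm]

/-! ### Derivatives of the product in its parameters c_j -/

section Derivation

/-- The coefficientwise extension of a derivation to power series. -/
def coeffDerivation (D : Derivation ℂ B B) : Derivation ℂ B⟦X⟧ B⟦X⟧ :=
  Derivation.mk'
    { toFun := fun p => mk fun m => D (coeff m p)
      map_add' := fun p q => by ext; simp
      map_smul' := fun a p => by ext; simp }
    (fun p q => by
      ext m
      simp only [LinearMap.coe_mk, AddHom.coe_mk, coeff_mk, coeff_mul, map_sum, map_add,
        smul_eq_mul, Derivation.leibniz, Finset.sum_add_distrib]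
      congr 1
      rw [← Finset.Nat.sum_antidiagonal_swap]
      rfl)

theorem coeff_coeffDerivation (D : Derivation ℂ B B) (p : B⟦X⟧) (m : ℕ) :
    coeff m (coeffDerivation D p) = D (coeff m p) := by
  simp [coeffDerivation]

theorem coeffDerivation_C (D : Derivation ℂ B B) (c : B) :
    coeffDerivation D (C c) = C (D c) := by
  ext m
  rw [coeff_coeffDerivation, coeff_C, coeff_C]
  split_ifs <;> simp

theorem coeffDerivation_X (D : Derivation ℂ B B) : coeffDerivation D (X : B⟦X⟧) = 0 := by
  ext m
  rw [coeff_coeffDerivation, coeff_X]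
  split_ifs <;> simp

theorem coeffDerivation_geom (D : Derivation ℂ B B) (c : B) :
    coeffDerivation D (geom c) = C (D c) * X * geom c * geom c := by
  have h := congrArg (coeffDerivation D) (one_sub_mul_geom c)
  simp only [Derivation.leibniz, map_sub, Derivation.map_one_eq_zero, coeffDerivation_X,
    smul_eq_mul, coeffDerivation_C] at h
  refine eq_mul_geom ?_
  linear_combination h

theorem coeffDerivation_factor (D : Derivation ℂ B B) (k : ℂ) (c : B) :
    coeffDerivation D (factor k c) = - C (algebraMap ℂ B k * D c) * X * geom c * factor k c := by
  have : (1 - C c * X) * coeffDerivation D (factor k c) =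
      - C (algebraMap ℂ B k * D c) * X * factor k c := by
    ext m
    rw [sub_mul, one_mul, map_sub, mul_assoc, mul_assoc, coeff_C_mul, ← map_neg, coeff_C_mul,
      coeff_coeffDerivation, coeff_factor, Derivation.leibniz, Derivation.map_algebraMap, smul_zero,
      zero_add, smul_eq_mul, Derivation.leibniz_pow, map_neg]
    cases m with
    | zero => simp
    | succ m =>
      have h : ((m : B) + 1) * algebraMap ℂ B (Ring.choose k (m + 1)) =
          (algebraMap ℂ B k - m) * algebraMap ℂ B (Ring.choose k m) := by
        have := congrArg (algebraMap ℂ B) (choose_succ k m)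
        simpa using this
      rw [coeff_succ_X_mul, coeff_succ_X_mul, coeff_coeffDerivation, coeff_factor,
        Derivation.leibniz, Derivation.map_algebraMap, smul_zero, zero_add, smul_eq_mul,
        Derivation.leibniz_pow, map_neg]
      simp only [Nat.add_sub_cancel, smul_eq_mul, nsmul_eq_mul]
      push_cast
      -- The power rule involves a truncated subtraction of exponents, so the lowest exponent is
      -- treated separately.
      cases m with
      | zero =>
        simp only [Nat.cast_zero, zero_add] at h ⊢
        linear_combination - D c * h
      | succ m =>
        simp only [Nat.add_sub_cancel]
        push_cast at h ⊢
        linear_combination - D c * (-c) ^ (m + 1) * h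
  rw [eq_mul_geom this]
  ring

theorem coeffDerivation_binProd (D : Derivation ℂ B B) (k : ℂ) (c : ι → B) :
    coeffDerivation D (binProd k c) =
      - algebraMap ℂ B⟦X⟧ k * X * (∑ j, C (D (c j)) * geom (c j)) * binProd k c := by
  have h := derivation_prod (coeffDerivation D) (fun j => factor k (c j))
    (fun j => - C (algebraMap ℂ B k * D (c j)) * X * geom (c j))
    (fun j => coeffDerivation_factor D k (c j))
  rw [binProd, h, Finset.mul_sum]
  congr 1
  refine Finset.sum_congr rfl fun j _ => ?_
  have h2 : algebraMap ℂ B⟦X⟧ k = C (algebraMap ℂ B k) := algebraMap_apply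
  rw [h2, map_mul]
  ring

end Derivation

/-! ### Vanishing of the residues -/

/-- Vanishing propagates upwards. With F_m the coefficients of F and G_{j,m} those of F / (1 - c_j
u), one has (m+1) F_{m+1} = -k ∑ c_j G_{j,m} and G_{j,m+1} = F_{m+1} + c_j G_{j,m}. Hence F is a
polynomial of degree at most r. -/
theorem coeff_eq_zero_of_le (k : ℂ) (r : ℕ) (c : ι → ℂ)
    (h : ∀ j, coeff r (binProd k c * geom (c j)) = 0) :
    ∀ m, r < m → coeff m (binProd k c) = 0 := by
  have key : ∀ m, (∀ j, coeff m (binProd k c * geom (c j)) = 0) →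
      coeff (m + 1) (binProd k c) = 0 ∧ ∀ j, coeff (m + 1) (binProd k c * geom (c j)) = 0 := by
    intro m hm
    have h1 : coeff (m + 1) (binProd k c) = 0 := by
      have h2 := X_mul_derivative_binProd k c
      have h3 : (algebraMap ℂ ℂ⟦X⟧ (k * Fintype.card ι) - algebraMap ℂ ℂ⟦X⟧ k * ∑ j, geom (c j)) *
          binProd k c = X * ∑ j, C (- k * c j) * (binProd k c * geom (c j)) := by
        rw [map_mul, map_natCast, Finset.mul_sum, Finset.mul_sum]
        have : ∀ j, X * (C (-k * c j) * (binProd k c * geom (c j))) =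
            (algebraMap ℂ ℂ⟦X⟧ k - algebraMap ℂ ℂ⟦X⟧ k * geom (c j)) * binProd k c := by
          intro j
          have h4 : algebraMap ℂ ℂ⟦X⟧ k = C k := rfl
          rw [h4, map_mul, map_neg]
          linear_combination - C k * binProd k c * X_mul_geom_mul (c j)
        simp_rw [this]
        rw [← Finset.sum_mul, Finset.sum_sub_distrib, Finset.sum_const, Finset.card_univ]
        simp [mul_comm]
      rw [h3] at h2
      have h5 := congrArg (coeff (m + 1)) h2
      rw [coeff_X_mul_derivative, coeff_succ_X_mul, map_sum] at h5
      simp only [coeff_C_mul, hm, mul_zero, Finset.sum_const_zero] at h5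
      refine (mul_eq_zero.1 h5).resolve_left ?_
      exact_mod_cast m.succ_ne_zero
    refine ⟨h1, fun j => ?_⟩
    have h2 : binProd k c * geom (c j) = binProd k c + X * (C (c j) * (binProd k c * geom (c j))) := by
      linear_combination binProd k c * geom_eq (c j)
    rw [h2, map_add, h1, coeff_succ_X_mul, coeff_C_mul, hm, mul_zero, zero_add]
  have all : ∀ m, ∀ j, coeff (r + m) (binProd k c * geom (c j)) = 0 := by
    intro m
    induction m with
    | zero => exact h
    | succ m ih => exact (key _ ih).2
  intro m hm
  obtain ⟨l, rfl⟩ := Nat.exists_eq_add_of_lt hm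
  exact (key _ (all l)).1

theorem factor_pow (k : ℂ) (n : ℕ) (c : B) : factor k c ^ n = factor (k * n) c := by
  rw [factor, factor, ← map_pow]
  congr 1
  induction n with
  | zero => simp
  | succ n ih => rw [pow_succ, ih, ← binomialSeries_add]; push_cast; ring_nf

theorem factor_nat (r : ℕ) (c : B) : factor (r : ℂ) c = (1 - C c * X) ^ r := by
  rw [factor, binomialSeries_nat, map_pow, map_add, map_one, rescale_X, map_neg]
  ring

/-- The product F is a polynomial p with p^n = ∏ (1 - c_j u)^r. If c_i ≠ 0, comparing multiplicities
at 1 / c_i shows that n divides r · #{j : c_j = c_i}, hence divides the cardinality by coprimality.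
All c_j are then equal, against ∑ c_j = 0. -/
theorem eq_zero_of_residues_vanish (k : ℂ) (n r : ℕ) (hrn : Nat.Coprime r n)
    (c : Fin n → ℂ) (hk : k * n = r) (hc : ∑ j, c j = 0)
    (h : ∀ j, coeff r (binProd k c * geom (c j)) = 0) : c = 0 := by
  have hv := coeff_eq_zero_of_le k r c h
  set p : Polynomial ℂ := trunc (r + 1) (binProd k c) with hp
  have hpF : (p : ℂ⟦X⟧) = binProd k c := by
    ext m
    rw [Polynomial.coeff_coe, hp, coeff_trunc]
    split_ifs with hm
    · rfl
    · exact (hv m (by omega)).symm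
  have hpow : p ^ n = ∏ j, (1 - Polynomial.C (c j) * Polynomial.X) ^ r := by
    apply Polynomial.coe_injective
    rw [Polynomial.coe_pow, hpF, binProd, ← Finset.prod_pow]
    simp_rw [factor_pow, hk, factor_nat]
    rw [← Polynomial.coeToPowerSeries.ringHom_apply, map_prod]
    simp
  by_contra hne
  obtain ⟨i, hi⟩ := Function.ne_iff.1 hne
  have hi : c i ≠ 0 := hi
  have hq0 : ∀ j, (1 - Polynomial.C (c j) * Polynomial.X : Polynomial ℂ) ≠ 0 := by
    intro j h0
    have := congrArg (Polynomial.eval 0) h0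
    simp at this
  have hmult : ∀ j, (1 - Polynomial.C (c j) * Polynomial.X : Polynomial ℂ).rootMultiplicity (c i)⁻¹ =
      if c j = c i then 1 else 0 := by
    intro j
    split_ifs with hj
    · have : (1 - Polynomial.C (c j) * Polynomial.X : Polynomial ℂ) =
          Polynomial.C (- c i) * (Polynomial.X - Polynomial.C (c i)⁻¹) := by
        rw [hj, mul_sub, ← Polynomial.C_mul]
        simp [hi]
        ring
      rw [this, Polynomial.rootMultiplicity_mul, Polynomial.rootMultiplicity_C,
        Polynomial.rootMultiplicity_X_sub_C_self]
      rw [← this]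
      exact hq0 j
    · apply Polynomial.rootMultiplicity_eq_zero
      intro h0
      simp only [Polynomial.IsRoot.def, Polynomial.eval_sub, Polynomial.eval_one,
        Polynomial.eval_mul, Polynomial.eval_C, Polynomial.eval_X] at h0
      apply hj
      field_simp at h0
      linear_combination - h0
  have hpowmult : ∀ (q : Polynomial ℂ) (hq : q ≠ 0) (x : ℂ) (m : ℕ),
      (q ^ m).rootMultiplicity x = m * q.rootMultiplicity x := by
    intro q hq x m
    rw [← Polynomial.count_roots, ← Polynomial.count_roots, Polynomial.roots_pow,
      Multiset.count_nsmul]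
  have hp0 : p ≠ 0 := by
    rintro h0
    have h1 := congrArg constantCoeff hpF
    have h2 : ∀ j, constantCoeff (factor k (c j)) = 1 := fun j => by
      rw [← coeff_zero_eq_constantCoeff_apply, coeff_factor]
      simp
    rw [h0, binProd, map_prod] at h1
    simp [h2] at h1
  have hrm := congrArg (Polynomial.rootMultiplicity (c i)⁻¹) hpow
  have hprod : ∀ s : Finset (Fin n), (∏ j ∈ s, (1 - Polynomial.C (c j) * Polynomial.X : Polynomial ℂ)
      ^ r).rootMultiplicity (c i)⁻¹ = r * (s.filter fun j => c j = c i).card := by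
    intro s
    rw [← Polynomial.count_roots, Polynomial.roots_prod _ _
      (Finset.prod_ne_zero_iff.2 fun j _ => pow_ne_zero _ (hq0 j)), Multiset.count_bind,
      Finset.card_filter, Finset.mul_sum]
    refine congrArg Multiset.sum (Multiset.map_congr rfl fun j _ => ?_)
    rw [Polynomial.count_roots, hpowmult _ (hq0 j), hmult]
  rw [hpowmult p hp0, hprod] at hrm
  -- At this point `hrm` reads n · (multiplicity in p) = r · #{j : c_j = c_i}.
  have hdvd : n ∣ (Finset.univ.filter fun j => c j = c i).card :=
    (hrn.symm).dvd_of_dvd_mul_left ⟨_, hrm.symm⟩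
  have hall : (Finset.univ.filter fun j => c j = c i) = Finset.univ := by
    apply Finset.eq_univ_of_card
    apply le_antisymm (Finset.card_le_univ _)
    rw [Fintype.card_fin]
    exact Nat.le_of_dvd (Finset.card_pos.2 ⟨i, by simp⟩) hdvd
  have hconst : ∀ j, c j = c i := fun j => by
    have := Finset.mem_univ j
    rw [← hall] at this
    simpa using this
  simp_rw [hconst] at hc
  rw [Finset.sum_const, Finset.card_univ, Fintype.card_fin, nsmul_eq_mul] at hc
  have hn : (n : ℂ) ≠ 0 := by exact_mod_cast i.pos.ne'
  exact (mul_ne_zero hn hi) hc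

end BinomialProduct

end

noncomputable section

open MvPolynomial

namespace Cherednik

variable {N : ℕ}

/-! ### The polynomials `f_i` on `𝔥` -/

-- Stated for an arbitrary algebra map, this serves at once for the passage to coordinates on 𝔥, for
-- the action of S_n and for evaluation at a point.
open BinomialProduct in
theorem map_fpoly {n r : ℕ} {B : Type*} [CommRing B] [Algebra ℂ B]
    (φ : MvPolynomial (Fin n) ℂ →ₐ[ℂ] B) (i : Fin n) :
    φ (fpoly n r i) = - PowerSeries.coeff r
      (binProd ((r : ℂ) / n) (fun j => φ (.X j)) * geom (φ (.X i))) := by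
  have h1 : ∀ j, PowerSeries.map (φ : MvPolynomial (Fin n) ℂ →+* B)
      (PowerSeries.rescale (-MvPolynomial.X j)
        (PowerSeries.binomialSeries (MvPolynomial (Fin n) ℂ) ((r : ℂ) / n))) =
      factor ((r : ℂ) / n) (φ (.X j)) := by
    intro j
    rw [← PowerSeries.rescale_map, factor, map_neg]
    congr 1
    ext m
    rw [PowerSeries.coeff_map, PowerSeries.binomialSeries_coeff, PowerSeries.binomialSeries_coeff,
      RingHom.coe_coe, map_smul, map_one]
  have h2 : PowerSeries.map (φ : MvPolynomial (Fin n) ℂ →+* B)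
      (PowerSeries.mk fun m => (MvPolynomial.X i : MvPolynomial (Fin n) ℂ) ^ m) =
      geom (φ (.X i)) := by
    ext m
    rw [PowerSeries.coeff_map, geom, PowerSeries.coeff_mk, PowerSeries.coeff_mk, RingHom.coe_coe,
      map_pow]
  rw [fpoly, map_neg, ← RingHom.coe_coe, ← PowerSeries.coeff_map, map_mul, map_prod, h2]
  simp_rw [h1]
  rfl

/-- The polynomial `f_i` as a polynomial on `𝔥`. -/
def fA (N r : ℕ) (i : Fin (N + 1)) : MvPolynomial (Fin N) ℂ := aeval (xPoly N) (fpoly (N + 1) r i)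

open BinomialProduct in
theorem map_fA {r : ℕ} {B : Type*} [CommRing B] [Algebra ℂ B]
    (φ : MvPolynomial (Fin N) ℂ →ₐ[ℂ] B) (i : Fin (N + 1)) :
    φ (fA N r i) = - PowerSeries.coeff r
      (binProd (kpar (N + 1) r) (fun j => φ (xPoly N j)) * geom (φ (xPoly N i))) := by
  have := map_fpoly (r := r) (φ.comp (aeval (xPoly N))) i
  simp only [AlgHom.comp_apply, aeval_X] at this
  exact this

open BinomialProduct in
theorem fA_eq (r : ℕ) (i : Fin (N + 1)) :
    fA N r i = - PowerSeries.coeff r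
      (binProd (kpar (N + 1) r) (xPoly N) * geom (xPoly N i)) :=
  map_fA (AlgHom.id ℂ _) i

theorem xfun_sub_xfun {n : ℕ} (i j : Fin n) : xfun n i - xfun n j = root n i j := by
  refine Submodule.linearMap_qext _ (LinearMap.ext fun v => ?_)
  simp [xfun, root]

theorem sum_xfun {n : ℕ} : ∑ i, xfun n i = 0 := by
  refine Submodule.linearMap_qext _ (LinearMap.ext fun v => ?_)
  rcases Nat.eq_zero_or_pos n with rfl | hn
  · simp
  have hn' : (n : ℂ) ≠ 0 := by exact_mod_cast hn.ne'
  simp [xfun, LinearMap.sum_apply, Finset.sum_sub_distrib, hn']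

theorem xfun_yvec {n : ℕ} (i l : Fin n) :
    xfun n i (yvec n l) = (if i = l then 1 else 0) - (n : ℂ)⁻¹ := by
  simp [xfun, yvec, Pi.single_apply]

theorem dual_xfun {n : ℕ} (g : Equiv.Perm (Fin n)) (i : Fin n) :
    (reflRep n).dual g (xfun n i) = xfun n (g i) := by
  refine Submodule.linearMap_qext _ (LinearMap.ext fun v => ?_)
  simp only [Representation.dual_apply, Module.Dual.transpose_apply]
  simp only [xfun, reflRep, permRep, LinearMap.funLeft, MonoidHom.coe_mk, OneHom.coe_mk, inv_inv,
    LinearMap.comp_apply, Submodule.mkQ_apply, Submodule.mapQ_apply, Submodule.liftQ_apply,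
    LinearMap.sub_apply, LinearMap.smul_apply, LinearMap.sum_apply, LinearMap.proj_apply,
    LinearMap.coe_mk, AddHom.coe_mk, Function.comp_apply]
  rw [Equiv.sum_comp g v]

theorem xPoly_sub_xPoly (i j : Fin (N + 1)) :
    xPoly N i - xPoly N j = linForm N (root (N + 1) i j) := by
  rw [xPoly, xPoly, ← map_sub, xfun_sub_xfun]

theorem sum_xPoly : ∑ i, xPoly N i = 0 := by
  simp_rw [xPoly]
  rw [← map_sum, sum_xfun, map_zero]

theorem act_xPoly (g : Equiv.Perm (Fin (N + 1))) (i : Fin (N + 1)) :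
    act N g (xPoly N i) = xPoly N (g i) := by
  rw [xPoly, act_linForm, dual_xfun, xPoly]

theorem X_eq_xPoly (a : Fin N) :
    (MvPolynomial.X a : MvPolynomial (Fin N) ℂ) = xPoly N a.castSucc - xPoly N (Fin.last N) := by
  rw [xPoly_sub_xPoly, ← hBasis_coord, linForm_coord]

theorem act_fA (r : ℕ) (g : Equiv.Perm (Fin (N + 1))) (i : Fin (N + 1)) :
    act N g (fA N r i) = fA N r (g i) := by
  rw [map_fA, fA_eq]
  simp_rw [act_xPoly, BinomialProduct.binProd]
  rw [Equiv.prod_comp g (fun j => BinomialProduct.factor (kpar (N + 1) r) (xPoly N j))]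

theorem kpar_mul (N r : ℕ) : kpar (N + 1) r * Fintype.card (Fin (N + 1)) = r := by
  rw [Fintype.card_fin, kpar, div_mul_cancel₀]
  exact_mod_cast N.succ_ne_zero

theorem sum_fA (r : ℕ) (hr : 0 < r) : ∑ i, fA N r i = 0 := by
  simp_rw [fA_eq]
  rw [Finset.sum_neg_distrib,
    BinomialProduct.coeff_binProd_mul_sum_geom _ r hr _ (kpar_mul N r), neg_zero]

theorem isHomogeneous_coeff_binProd {n : ℕ} (k : ℂ) {c : Fin n → MvPolynomial (Fin N) ℂ}
    (hc : ∀ i, (c i).IsHomogeneous 1) (i : Fin n) (m : ℕ) :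
    (PowerSeries.coeff m (BinomialProduct.binProd k c * BinomialProduct.geom (c i))).IsHomogeneous
      m := by
  have hmul : ∀ p q : PowerSeries (MvPolynomial (Fin N) ℂ),
      (∀ m, (PowerSeries.coeff m p).IsHomogeneous m) →
      (∀ m, (PowerSeries.coeff m q).IsHomogeneous m) →
      ∀ m, (PowerSeries.coeff m (p * q)).IsHomogeneous m := by
    intro p q hp hq m
    rw [PowerSeries.coeff_mul]
    refine IsHomogeneous.sum _ _ _ fun x hx => ?_
    rw [← Finset.HasAntidiagonal.mem_antidiagonal.1 hx]
    exact (hp _).mul (hq _)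
  refine hmul _ _ ?_ ?_ m
  · rw [BinomialProduct.binProd]
    refine Finset.prod_induction _
      (fun p : PowerSeries (MvPolynomial (Fin N) ℂ) => ∀ m, (PowerSeries.coeff m p).IsHomogeneous m) hmul
      ?_ ?_
    · intro m
      rw [PowerSeries.coeff_one]
      split_ifs with h
      · rw [h]; exact isHomogeneous_one _ _
      · exact isHomogeneous_zero _ _ _
    · intro j _ m
      rw [BinomialProduct.coeff_factor]
      have h1 := ((hc j).neg.pow m).mul (isHomogeneous_C (Fin N) (Ring.choose k m))
      rwa [one_mul, add_zero] at h1
  · intro m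
    rw [BinomialProduct.geom, PowerSeries.coeff_mk]
    simpa using (hc i).pow m

theorem fA_isHomogeneous (r : ℕ) (i : Fin (N + 1)) : (fA N r i).IsHomogeneous r := by
  rw [fA_eq]
  exact (isHomogeneous_coeff_binProd _ (fun i => linForm_isHomogeneous _) i r).neg

/-- The only common zero of the `f_i` with `i ≤ m`, on the locus where the other coordinates agree,
is the origin. -/
theorem eq_zero_of_fA_eq_zero {r : ℕ} (hr : 0 < r) (hrn : Nat.gcd r (N + 1) = 1) (m : ℕ)
    (x : Fin N → ℂ) (h1 : ∀ a : Fin N, a.1 < m → aeval x (fA N r a.castSucc) = 0)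
    (h2 : ∀ a : Fin N, m ≤ a.1 → x a = 0) : x = 0 := by
  set c : Fin (N + 1) → ℂ := fun j => aeval x (xPoly N j) with hc
  have hxc : ∀ a : Fin N, x a = c a.castSucc - c (Fin.last N) := by
    intro a
    have := congrArg (aeval x) (X_eq_xPoly a)
    simpa [hc] using this
  have hf : ∀ j, aeval x (fA N r j) = - PowerSeries.coeff r
      (BinomialProduct.binProd (kpar (N + 1) r) c * BinomialProduct.geom (c j)) :=
    fun j => map_fA (aeval x) j
  -- On this subspace the a-th and the last of the x_j take the same value, hence so do the
  -- corresponding residues.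
  have hlast : ∀ a : Fin N, m ≤ a.1 →
      aeval x (fA N r a.castSucc) = aeval x (fA N r (Fin.last N)) := by
    intro a ha
    have : c a.castSucc = c (Fin.last N) := by
      rw [← sub_eq_zero, ← hxc, h2 a ha]
    rw [hf, hf, this]
  have hsum : ∑ j, aeval x (fA N r j) = 0 := by rw [← map_sum, sum_fA r hr, map_zero]
  -- The terms of ∑ f_j = 0 that are not already zero are all equal to the last one, and their
  -- number is positive.
  have hzero : aeval x (fA N r (Fin.last N)) = 0 := by
    rw [Fin.sum_univ_castSucc] at hsum
    have h3 : ∀ a : Fin N, aeval x (fA N r a.castSucc) =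
        (if m ≤ a.1 then 1 else 0) * aeval x (fA N r (Fin.last N)) := by
      intro a
      split_ifs with ha
      · rw [hlast a ha, one_mul]
      · rw [h1 a (not_le.1 ha), zero_mul]
    simp_rw [h3] at hsum
    rw [← Finset.sum_mul, ← add_one_mul, Finset.sum_boole] at hsum
    refine (mul_eq_zero.1 hsum).resolve_left ?_
    exact Nat.cast_add_one_ne_zero _
  have hall : ∀ j, aeval x (fA N r j) = 0 := by
    intro j
    refine Fin.lastCases hzero (fun a => ?_) j
    rcases lt_or_ge a.1 m with ha | ha
    · exact h1 a ha
    · rw [hlast a ha, hzero]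
  have hcz : c = 0 := by
    refine BinomialProduct.eq_zero_of_residues_vanish (kpar (N + 1) r) (N + 1) r hrn c ?_ ?_ ?_
    · simpa using kpar_mul N r
    · rw [hc, ← map_sum, sum_xPoly, map_zero]
    · intro j
      have := hf j
      rw [hall j] at this
      exact neg_eq_zero.1 this.symm
  funext a
  rw [hxc, hcz]
  simp

/-! ### The `f_i` are singular vectors -/

/-- The quotient `(f_a - f_b) / (x_a - x_b)`. -/
def gA (N r : ℕ) (a b : Fin (N + 1)) : MvPolynomial (Fin N) ℂ :=
  - PowerSeries.coeff r (PowerSeries.X * (BinomialProduct.binProd (kpar (N + 1) r) (xPoly N) *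
    (BinomialProduct.geom (xPoly N a) * BinomialProduct.geom (xPoly N b))))

theorem gA_symm (r : ℕ) (a b : Fin (N + 1)) : gA N r a b = gA N r b a := by
  rw [gA, gA, mul_comm (BinomialProduct.geom (xPoly N a))]

theorem fA_sub_fA (r : ℕ) (a b : Fin (N + 1)) :
    fA N r a - fA N r b = linForm N (root (N + 1) a b) * gA N r a b := by
  have h : BinomialProduct.binProd (kpar (N + 1) r) (xPoly N) * BinomialProduct.geom (xPoly N a) -
      BinomialProduct.binProd (kpar (N + 1) r) (xPoly N) * BinomialProduct.geom (xPoly N b) =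
      PowerSeries.C (linForm N (root (N + 1) a b)) * (PowerSeries.X *
        (BinomialProduct.binProd (kpar (N + 1) r) (xPoly N) *
        (BinomialProduct.geom (xPoly N a) * BinomialProduct.geom (xPoly N b)))) := by
    rw [← mul_sub, BinomialProduct.geom_sub_geom, xPoly_sub_xPoly]
    ring
  have h2 := congrArg (PowerSeries.coeff r) h
  rw [map_sub, PowerSeries.coeff_C_mul] at h2
  rw [fA_eq, fA_eq, gA, mul_neg, ← h2, neg_sub_neg, neg_sub]

/-- Up to sign, the two sides differ by δ_{il} - 1/n times the coefficient of the total derivative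
in `coeff_total_derivative`. Since the divided difference of f_i along a root α is α(y_i) g_α, the
formula says that the Dunkl operators kill f_i; it is kept symmetric in i and l so as to serve the
whole Koszul complex. -/
theorem der_fA_yvec {r : ℕ} (hr : 0 < r) (i l : Fin (N + 1)) :
    der N (yvec (N + 1) l) (fA N r i) = kpar (N + 1) r • ∑ p ∈ reflections (N + 1),
      (root (N + 1) p.1 p.2 (yvec (N + 1) l) * root (N + 1) p.1 p.2 (yvec (N + 1) i)) •
        gA N r p.1 p.2 := by
  set k := kpar (N + 1) r with hk
  set F := BinomialProduct.binProd k (xPoly N) with hF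
  set E : Fin (N + 1) → PowerSeries (MvPolynomial (Fin N) ℂ) :=
    fun j => BinomialProduct.geom (xPoly N j) with hE
  set δ : ℂ := if i = l then 1 else 0 with hδ
  -- For i ≠ l only the root of the pair {i, l} is nonzero on both vectors, with values of opposite
  -- sign; for i = l all pairs containing i contribute.
  have hrhs : ∑ p ∈ reflections (N + 1), (root (N + 1) p.1 p.2 (yvec (N + 1) l) *
      root (N + 1) p.1 p.2 (yvec (N + 1) i)) • gA N r p.1 p.2 =
      δ • ∑ j, gA N r i j - gA N r i l := by
    have h := sum_reflections (fun a b => (root (N + 1) a b (yvec (N + 1) l) *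
      root (N + 1) a b (yvec (N + 1) i)) • gA N r a b) (fun a b => by
        rw [root_swap a b, gA_symm]; simp)
    have h0 : ∑ a, (root (N + 1) a a (yvec (N + 1) l) *
        root (N + 1) a a (yvec (N + 1) i)) • gA N r a a = 0 := by
      simp [root_self]
    rw [h0, add_zero] at h
    apply smul_right_injective _ (two_ne_zero' ℂ)
    simp only
    rw [← h]
    simp only [root_yvec, sub_mul, mul_sub, sub_smul, Finset.sum_sub_distrib, mul_smul, ite_smul,
      one_smul, zero_smul, Finset.sum_ite_eq', Finset.mem_univ, if_true, hδ,
      Finset.sum_ite_irrel, Finset.sum_const_zero]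
    have h1 : ∑ j, gA N r j i = ∑ j, gA N r i j := Finset.sum_congr rfl fun j _ => gA_symm r j i
    by_cases hil : i = l
    · subst hil
      simp only [if_true, two_smul, h1]
      abel
    · simp only [if_neg hil, if_neg (Ne.symm hil), two_smul, gA_symm r l i]
      abel
  have hlhs : BinomialProduct.coeffDerivation (der N (yvec (N + 1) l)) (F * E i) =
      PowerSeries.X * (F * ((algebraMap ℂ _ δ - algebraMap ℂ _ ((N + 1 : ℕ) : ℂ)⁻¹) * (E i * E i) -
        algebraMap ℂ _ k * (E i * E l) +
        algebraMap ℂ _ ((N + 1 : ℕ) : ℂ)⁻¹ * algebraMap ℂ _ k * (E i * ∑ j, E j))) := by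
    have hd : ∀ j, der N (yvec (N + 1) l) (xPoly N j) =
        C ((if j = l then 1 else 0) - ((N + 1 : ℕ) : ℂ)⁻¹) := by
      intro j
      rw [xPoly, der_linForm, xfun_yvec]
    have hCC : ∀ z : ℂ, PowerSeries.C (C z : MvPolynomial (Fin N) ℂ) = algebraMap ℂ _ z :=
      fun z => PowerSeries.algebraMap_apply.symm
    rw [Derivation.leibniz, hF, BinomialProduct.coeffDerivation_binProd, ← hF, hE]
    simp only [BinomialProduct.coeffDerivation_geom, hd, hCC, smul_eq_mul, sub_mul, map_sub,
      Finset.sum_sub_distrib]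
    have h2 : ∑ j, algebraMap ℂ (PowerSeries (MvPolynomial (Fin N) ℂ)) (if j = l then 1 else 0) *
        BinomialProduct.geom (xPoly N j) = BinomialProduct.geom (xPoly N l) := by
      rw [Finset.sum_eq_single l]
      · simp
      · intro b _ hb; simp [hb]
      · simp
    rw [h2, ← Finset.mul_sum]
    ring
  have htot := BinomialProduct.coeff_total_derivative k r hr (xPoly N) (kpar_mul N r) i
  rw [hrhs, fA_eq, map_neg, ← BinomialProduct.coeff_coeffDerivation]
  change - PowerSeries.coeff r (BinomialProduct.coeffDerivation _ (F * E i)) = _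
  have hg : ∀ a b, gA N r a b = - PowerSeries.coeff r (PowerSeries.X * (F * (E a * E b))) :=
    fun a b => rfl
  have hr2 : k • (δ • ∑ j, gA N r i j - gA N r i l) = - PowerSeries.coeff r
      (k • (δ • ∑ j, PowerSeries.X * (F * (E i * E j)) - PowerSeries.X * (F * (E i * E l)))) := by
    simp only [hg, PowerSeries.coeff_smul, map_sub, map_sum, Finset.sum_neg_distrib, smul_neg,
      smul_sub]
    abel
  -- This is the discrepancy between the two sides. The terms with 1/n come from subtracting the
  -- mean in the invariant coordinates x_j.
  have hfin : PowerSeries.coeff r (algebraMap ℂ _ (δ - ((N + 1 : ℕ) : ℂ)⁻¹) *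
      (PowerSeries.X * (F * E i * (E i - algebraMap ℂ _ k * ∑ j, E j)))) = 0 := by
    rw [← Algebra.smul_def, PowerSeries.coeff_smul]
    exact (congrArg ((δ - ((N + 1 : ℕ) : ℂ)⁻¹) • ·) htot).trans (smul_zero _)
  rw [hlhs, hr2, neg_inj, ← sub_eq_zero, ← map_sub, ← hfin]
  refine congrArg _ ?_
  simp only [Algebra.smul_def, map_sub, ← Finset.mul_sum]
  ring

end Cherednik

end

noncomputable section

open MvPolynomial

/-! ### Regular sequences of homogeneous polynomials -/

namespace GradedRegular

attribute [local instance] MvPolynomial.gradedAlgebra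

section General

variable {σ : Type*}

/-- `u` is a nonzerodivisor modulo `I`. -/
def NonZeroDiv {R : Type*} [CommRing R] (I : Ideal R) (u : R) : Prop := ∀ a, u * a ∈ I → a ∈ I

theorem mem_sup_span {R : Type*} [CommRing R] {I : Ideal R} {u x : R} :
    x ∈ I ⊔ Ideal.span {u} ↔ ∃ i ∈ I, ∃ b, x = i + u * b := by
  rw [Submodule.mem_sup]
  constructor
  · rintro ⟨i, hi, y, hy, rfl⟩
    obtain ⟨b, rfl⟩ := Ideal.mem_span_singleton'.1 hy
    exact ⟨i, hi, b, by rw [mul_comm]⟩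
  · rintro ⟨i, hi, b, rfl⟩
    exact ⟨i, hi, u * b, Ideal.mul_mem_right _ _ (Ideal.mem_span_singleton_self u), rfl⟩

theorem NonZeroDiv.pow {R : Type*} [CommRing R] {I : Ideal R} {u : R} (h : NonZeroDiv I u) (k : ℕ) :
    NonZeroDiv I (u ^ k) := by
  induction k with
  | zero => intro a ha; simpa using ha
  | succ k ih => intro a ha; exact h a (ih _ (by rwa [← mul_assoc, ← pow_succ]))

/-- The exchange argument: if some power of the nonzerodivisor `u` lies in `I + (f)`, then
`f` is also a nonzerodivisor modulo `I`. -/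
theorem NonZeroDiv.exchange {R : Type*} [CommRing R] {I : Ideal R} {u f : R}
    (h : NonZeroDiv I u) {k : ℕ} (hk : u ^ k ∈ I ⊔ Ideal.span {f}) : NonZeroDiv I f := by
  intro a ha
  obtain ⟨i, hi, b, hb⟩ := mem_sup_span.1 hk
  apply h.pow k
  rw [hb, add_mul, mul_right_comm]
  exact I.add_mem (I.mul_mem_right _ hi) (I.mul_mem_right _ ha)

theorem homogeneousComponent_mul {f : MvPolynomial σ ℂ} {r : ℕ} (hf : f.IsHomogeneous r)
    (b : MvPolynomial σ ℂ) (d : ℕ) :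
    homogeneousComponent d (f * b) =
      if r ≤ d then f * homogeneousComponent (d - r) b else 0 := by
  have h : homogeneousComponent d (f * b) = ∑ j ∈ Finset.range (b.totalDegree + 1),
      if r + j = d then f * homogeneousComponent j b else 0 := by
    conv_lhs => rw [← sum_homogeneousComponent b, Finset.mul_sum, map_sum]
    refine Finset.sum_congr rfl fun j _ => ?_
    rw [homogeneousComponent_of_mem (hf.mul (homogeneousComponent_isHomogeneous j b))]
    simp only [eq_comm]
  rw [h]
  split_ifs with hd
  · rw [Finset.sum_eq_single (d - r)]
    · rw [if_pos (by omega)]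
    · intro j _ hj
      rw [if_neg (by omega)]
    · intro hj
      rw [if_pos (by omega), homogeneousComponent_eq_zero _ _ (by simp only [Finset.mem_range] at hj; omega), mul_zero]
  · exact Finset.sum_eq_zero fun j _ => if_neg (by omega)

/-- The ideal `I` is homogeneous. -/
def IsGraded (I : Ideal (MvPolynomial σ ℂ)) : Prop :=
  ∀ p ∈ I, ∀ d, homogeneousComponent d p ∈ I

theorem isGraded_span {s : Set (MvPolynomial σ ℂ)} (h : ∀ p ∈ s, ∃ d, p.IsHomogeneous d) :
    IsGraded (Ideal.span s) := fun _ hp d =>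
  homogeneousComponent_mem_of_mem (Ideal.homogeneous_span _ _ h) hp d

/-- A graded form of Krull's intersection theorem: u^(e+1) b has no component of degree e, so the
degree e component of a lies in I. -/
theorem IsGraded.mem_of_forall_pow {I : Ideal (MvPolynomial σ ℂ)} (hI : IsGraded I)
    {u : MvPolynomial σ ℂ} {d : ℕ} (hu : u.IsHomogeneous d) (hd : 0 < d) {a : MvPolynomial σ ℂ}
    (h : ∀ k, ∃ b, a - u ^ k * b ∈ I) : a ∈ I := by
  rw [← sum_homogeneousComponent a]
  refine I.sum_mem fun e _ => ?_
  obtain ⟨b, hb⟩ := h (e + 1)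
  have := hI _ hb e
  rwa [map_sub, homogeneousComponent_mul (hu.pow (e + 1)), if_neg, sub_zero] at this
  nlinarith

/-- Homogeneous regular sequences may be permuted. If fc ∈ I, then c = i + ub with i ∈ I, and again
fb ∈ I because u is a nonzerodivisor; iterating, c lies in I + (u^k) for every k. The second half
divides by u in the same way and needs no grading. -/
theorem NonZeroDiv.swap {I : Ideal (MvPolynomial σ ℂ)} (hI : IsGraded I) {u f : MvPolynomial σ ℂ}
    {d : ℕ} (hu : u.IsHomogeneous d) (hd : 0 < d) (h1 : NonZeroDiv I u)
    (h2 : NonZeroDiv (I ⊔ Ideal.span {u}) f) :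
    NonZeroDiv I f ∧ NonZeroDiv (I ⊔ Ideal.span {f}) u := by
  constructor
  · intro c hc
    have key : ∀ k, ∃ c', c - u ^ k * c' ∈ I ∧ f * c' ∈ I := by
      intro k
      induction k with
      | zero => exact ⟨c, by simp, hc⟩
      | succ k ih =>
        obtain ⟨c', h3, h4⟩ := ih
        obtain ⟨i, hi, b, rfl⟩ := mem_sup_span.1 (h2 c' (Ideal.mem_sup_left h4))
        refine ⟨b, ?_, h1 _ ?_⟩
        · have := I.add_mem h3 (I.mul_mem_left (u ^ k) hi)
          convert this using 1
          ring
        · have := I.sub_mem h4 (I.mul_mem_left f hi)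
          convert this using 1
          ring
    exact hI.mem_of_forall_pow hu hd fun k => (key k).imp fun _ h => h.1
  · intro a ha
    obtain ⟨i, hi, b, hb⟩ := mem_sup_span.1 ha
    have hfb : f * b ∈ I ⊔ Ideal.span {u} := mem_sup_span.2 ⟨-i, I.neg_mem hi, a, by rw [hb]; ring⟩
    obtain ⟨i', hi', b', rfl⟩ := mem_sup_span.1 (h2 b hfb)
    refine mem_sup_span.2 ⟨a - f * b', h1 _ ?_, b', by ring⟩
    have := I.add_mem hi (I.mul_mem_left f hi')
    convert this using 1
    linear_combination hb

/-- The socle of the quotient by `I` is one-dimensional. -/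
def HasSimpleSocle (I : Ideal (MvPolynomial σ ℂ)) : Prop :=
  ∃ s, s ∉ I ∧ (∀ a, X a * s ∈ I) ∧ ∀ t, (∀ a, X a * t ∈ I) → ∃ c : ℂ, t - C c * s ∈ I

theorem mem_span_X_of_isHomogeneous {h : MvPolynomial σ ℂ} {d : ℕ} (hh : h.IsHomogeneous d)
    (hd : 0 < d) : h ∈ Ideal.span (Set.range (X : σ → MvPolynomial σ ℂ)) := by
  rw [← Set.image_univ, mem_ideal_span_X_image]
  intro m hm
  by_contra! hc
  have : m = 0 := Finsupp.ext fun i => hc i (Set.mem_univ i)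
  subst this
  have := hh.degree_eq_sum_deg_support hm
  simp at this
  omega

theorem mul_mem_of_X_mul_mem {h t : MvPolynomial σ ℂ} {I : Ideal (MvPolynomial σ ℂ)}
    (hh : h ∈ Ideal.span (Set.range (X : σ → MvPolynomial σ ℂ))) (ht : ∀ a, X a * t ∈ I) :
    h * t ∈ I := by
  induction hh using Submodule.span_induction with
  | mem x hx => obtain ⟨a, rfl⟩ := hx; exact ht a
  | zero => simp
  | add x y _ _ hx hy => rw [add_mul]; exact I.add_mem hx hy
  | smul c x _ hx => rw [smul_eq_mul, mul_assoc]; exact I.mul_mem_left _ hx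

/-- Conceptually the socle of R / (J, h) is Ext¹(ℂ, R / J), which does not depend on the
nonzerodivisor h. The explicit correspondence s ↔ s' is h' s ≡ h s' modulo J, and it is symmetric in
h and h'. -/
theorem HasSimpleSocle.transfer {J : Ideal (MvPolynomial σ ℂ)} {h h' : MvPolynomial σ ℂ}
    (hn : NonZeroDiv J h) (hn' : NonZeroDiv J h')
    (hm : h ∈ Ideal.span (Set.range (X : σ → MvPolynomial σ ℂ)))
    (hm' : h' ∈ Ideal.span (Set.range (X : σ → MvPolynomial σ ℂ)))
    (hs : HasSimpleSocle (J ⊔ Ideal.span {h})) : HasSimpleSocle (J ⊔ Ideal.span {h'}) := by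
  obtain ⟨s, h1, h2, h3⟩ := hs
  have step : ∀ (h h' s : MvPolynomial σ ℂ), NonZeroDiv J h →
      h' ∈ Ideal.span (Set.range (X : σ → MvPolynomial σ ℂ)) →
      (∀ a, X a * s ∈ J ⊔ Ideal.span {h}) →
      ∃ s', h' * s - h * s' ∈ J ∧ ∀ a, X a * s' ∈ J ⊔ Ideal.span {h'} := by
    intro h h' s hn hm' h2
    obtain ⟨j, hj, s', hs'⟩ := mem_sup_span.1 (mul_mem_of_X_mul_mem hm' h2)
    refine ⟨s', by rw [hs', add_sub_cancel_right]; exact hj, fun a => ?_⟩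
    obtain ⟨i, hi, t, ht⟩ := mem_sup_span.1 (h2 a)
    refine mem_sup_span.2 ⟨X a * s' - h' * t, hn _ ?_, t, by ring⟩
    have := J.sub_mem (J.mul_mem_left h' hi) (J.mul_mem_left (X a) hj)
    convert this using 1
    linear_combination h' * ht - (X a) * hs'
  obtain ⟨s', hs', h4⟩ := step h h' s hn hm' h2
  refine ⟨s', fun hc => h1 ?_, h4, fun t ht => ?_⟩
  · obtain ⟨j, hj, b, rfl⟩ := mem_sup_span.1 hc
    refine mem_sup_span.2 ⟨s - h * b, hn' _ ?_, b, by ring⟩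
    have := J.add_mem hs' (J.mul_mem_left h hj)
    convert this using 1
    ring
  · obtain ⟨t', ht', h5⟩ := step h' h t hn' hm ht
    obtain ⟨c, hc⟩ := h3 t' h5
    obtain ⟨j, hj, b, hb⟩ := mem_sup_span.1 hc
    refine ⟨c, mem_sup_span.2 ⟨t - C c * s' - h' * b, hn _ ?_, b, by ring⟩⟩
    have := J.add_mem (J.add_mem ht' (J.mul_mem_left (C c) hs')) (J.mul_mem_left h' hj)
    convert this using 1
    linear_combination h' * hb

end General

/-! ### Systems of parameters compatible with the coordinate flag -/

/-- A system of homogeneous polynomials of degree `r` such that, for each `m`, the first `m` of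
them have no nontrivial common zero on the subspace where the last coordinates vanish. -/
structure FlagSystem {N : ℕ} (r : ℕ) (f : Fin N → MvPolynomial (Fin N) ℂ) : Prop where
  pos : 0 < r
  homogeneous : ∀ a, (f a).IsHomogeneous r
  eq_zero : ∀ (m : ℕ) (x : Fin N → ℂ), (∀ a, a.1 < m → aeval x (f a) = 0) →
    (∀ a, m ≤ a.1 → x a = 0) → x = 0

section Flag

variable {N r : ℕ} {f : Fin N → MvPolynomial (Fin N) ℂ}

/-- The ideal generated by the first `i` members of the system and the coordinates from the
`m`-th on. -/
def flagIdeal (f : Fin N → MvPolynomial (Fin N) ℂ) (i m : ℕ) : Ideal (MvPolynomial (Fin N) ℂ) :=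
  Ideal.span (f '' {a | a.1 < i} ∪ X '' {a | m ≤ a.1})

theorem flagIdeal_succ_left (a : Fin N) (m : ℕ) :
    flagIdeal f (a.1 + 1) m = flagIdeal f a.1 m ⊔ Ideal.span {f a} := by
  rw [flagIdeal, flagIdeal, ← Ideal.span_union]
  congr 1
  have : {b : Fin N | b.1 < a.1 + 1} = insert a {b | b.1 < a.1} := by
    ext b
    simp only [Set.mem_ofPred_eq, Set.mem_insert_iff, Fin.ext_iff]
    omega
  rw [this, Set.image_insert_eq, Set.union_singleton, Set.insert_union]

theorem flagIdeal_eq_sup_X (i : ℕ) (a : Fin N) :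
    flagIdeal f i a.1 = flagIdeal f i (a.1 + 1) ⊔ Ideal.span {X a} := by
  rw [flagIdeal, flagIdeal, ← Ideal.span_union]
  congr 1
  have : {b : Fin N | a.1 ≤ b.1} = insert a {b | a.1 + 1 ≤ b.1} := by
    ext b
    simp only [Set.mem_ofPred_eq, Set.mem_insert_iff, Fin.ext_iff]
    omega
  rw [this, Set.image_insert_eq, Set.union_singleton, Set.union_insert]

theorem flagIdeal_last (i : ℕ) : flagIdeal f i N = Ideal.span (f '' {a | a.1 < i}) := by
  rw [flagIdeal]
  have : {a : Fin N | N ≤ a.1} = ∅ := Set.eq_empty_of_forall_notMem fun a ha => by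
    have := a.2
    simp only [Set.mem_ofPred_eq] at ha
    omega
  rw [this, Set.image_empty, Set.union_empty]

theorem flagIdeal_zero (m : ℕ) : flagIdeal f 0 m = Ideal.span (X '' {a | m ≤ a.1}) := by
  simp [flagIdeal]

theorem flagIdeal_last_last : flagIdeal f N N = Ideal.span (Set.range f) := by
  simp [flagIdeal_last]

theorem FlagSystem.isGraded_flagIdeal (hf : FlagSystem r f) (i m : ℕ) :
    IsGraded (flagIdeal f i m) := by
  refine isGraded_span ?_
  rintro _ (⟨a, _, rfl⟩ | ⟨a, _, rfl⟩)
  · exact ⟨r, hf.homogeneous a⟩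
  · exact ⟨1, isHomogeneous_X ℂ a⟩

/-- The flag condition says that the zero locus of this ideal is at most the origin, so the
Nullstellensatz applies. -/
theorem FlagSystem.exists_X_pow_mem (hf : FlagSystem r f) (m : ℕ) (a : Fin N) :
    ∃ k, (X a : MvPolynomial (Fin N) ℂ) ^ k ∈ flagIdeal f m m := by
  have : (X a : MvPolynomial (Fin N) ℂ) ∈ (flagIdeal f m m).radical := by
    rw [← vanishingIdeal_zeroLocus_eq_radical (K := ℂ), mem_vanishingIdeal_iff]
    intro x hx
    rw [mem_zeroLocus_iff] at hx
    have : x = 0 := by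
      refine hf.eq_zero m x (fun b hb => hx _ (Ideal.subset_span (Or.inl ⟨b, hb, rfl⟩)))
        fun b hb => ?_
      simpa using hx _ (Ideal.subset_span (Or.inr ⟨b, hb, rfl⟩))
    simp [this]
  exact this

theorem nonZeroDiv_X (a : Fin N) (m : ℕ) (h : a.1 < m) : NonZeroDiv (flagIdeal f 0 m) (X a) := by
  intro p hp
  rw [flagIdeal_zero, mem_ideal_span_X_image] at hp ⊢
  intro e he
  obtain ⟨b, hb, hb'⟩ := hp (Finsupp.single a 1 + e) (by
    rw [mem_support_iff, coeff_X_mul]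
    exact mem_support_iff.1 he)
  refine ⟨b, hb, ?_⟩
  have hab : a ≠ b := fun hab => by
    subst hab
    simp only [Set.mem_ofPred_eq] at hb
    omega
  simpa [Finsupp.single_apply, hab] using hb'

/-- Modulo the coordinates beyond the i-th, f_i takes the place of X_i by the exchange argument, a
power of X_i being in the larger ideal. The other coordinates are then removed from the ideal one by
one with `NonZeroDiv.swap`. -/
theorem FlagSystem.nonZeroDiv_of_X (hf : FlagSystem r f) (i : Fin N)
    (hZ : ∀ m : Fin N, i.1 ≤ m.1 → NonZeroDiv (flagIdeal f i.1 (m.1 + 1)) (X m)) (j : ℕ) 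
    (hj : i.1 + 1 + j ≤ N) : NonZeroDiv (flagIdeal f i.1 (i.1 + 1 + j)) (f i) := by
  induction j with
  | zero =>
    obtain ⟨k, hk⟩ := hf.exists_X_pow_mem (i.1 + 1) i
    rw [flagIdeal_succ_left] at hk
    exact (hZ i le_rfl).exchange hk
  | succ j ih =>
    have h1 := ih (by omega)
    let m : Fin N := ⟨i.1 + 1 + j, by omega⟩
    have h2 := flagIdeal_eq_sup_X (f := f) i.1 m
    change flagIdeal f i.1 (i.1 + 1 + j) = _ at h2
    rw [h2] at h1
    exact ((hZ m (by change i.1 ≤ i.1 + 1 + j; omega)).swap (hf.isGraded_flagIdeal _ _)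
      (isHomogeneous_X ℂ m) one_pos h1).1

/-- Induction on the number of f's in the ideal: the induction hypothesis and `nonZeroDiv_of_X` make
X_m, f_i a regular sequence, and swapping the two adjoins f_i to the ideal. The case of no f's
concerns monomial ideals. -/
theorem FlagSystem.nonZeroDiv_X (hf : FlagSystem r f) (i : ℕ) (m : Fin N) (him : i ≤ m.1) :
    NonZeroDiv (flagIdeal f i (m.1 + 1)) (X m) := by
  induction i generalizing m with
  | zero => exact GradedRegular.nonZeroDiv_X m _ (by omega)
  | succ i ih =>
    let a : Fin N := ⟨i, by omega⟩
    rw [show i + 1 = a.1 + 1 from rfl, flagIdeal_succ_left]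
    have h1 : NonZeroDiv (flagIdeal f a.1 m.1) (f a) := by
      have := hf.nonZeroDiv_of_X a (fun m hm => ih m hm) (m.1 - (i + 1)) (by
        change i + 1 + _ ≤ N; omega)
      rwa [show a.1 + 1 + (m.1 - (i + 1)) = m.1 by change i + 1 + _ = _; omega] at this
    rw [flagIdeal_eq_sup_X] at h1
    exact ((ih m (by omega)).swap (hf.isGraded_flagIdeal _ _) (isHomogeneous_X ℂ m) one_pos h1).2

theorem FlagSystem.nonZeroDiv_flag (hf : FlagSystem r f) (a : Fin N) (m : ℕ) (h : a.1 < m)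
    (hm : m ≤ N) : NonZeroDiv (flagIdeal f a.1 m) (f a) := by
  have := hf.nonZeroDiv_of_X a (fun m hm => hf.nonZeroDiv_X a.1 m hm) (m - (a.1 + 1)) (by omega)
  rwa [show a.1 + 1 + (m - (a.1 + 1)) = m by omega] at this

/-- A flag system is a regular sequence. -/
theorem FlagSystem.nonZeroDiv (hf : FlagSystem r f) (a : Fin N) :
    NonZeroDiv (Ideal.span (f '' {b | b.1 < a.1})) (f a) := by
  have := hf.nonZeroDiv_flag a N a.2 le_rfl
  rwa [flagIdeal_last] at this

theorem FlagSystem.exists_X_pow_mem_span (hf : FlagSystem r f) (a : Fin N) :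
    ∃ k, (X a : MvPolynomial (Fin N) ℂ) ^ k ∈ Ideal.span (Set.range f) := by
  have := hf.exists_X_pow_mem N a
  rwa [flagIdeal_last_last] at this

/-- The quotient by a flag system is Gorenstein. -/
theorem FlagSystem.hasSimpleSocle (hf : FlagSystem r f) :
    HasSimpleSocle (Ideal.span (Set.range f)) := by
  rw [← flagIdeal_last_last]
  -- The ideal with i = 0 is the maximal ideal of the origin, whose quotient is ℂ. Each step
  -- replaces the generator X_i by f_i, both being nonzerodivisors modulo the remaining generators.
  have key : ∀ i ≤ N, HasSimpleSocle (flagIdeal f i i) := by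
    intro i
    induction i with
    | zero =>
      intro _
      have h0 : flagIdeal f 0 0 = Ideal.span (X '' Set.univ) := by
        rw [flagIdeal_zero]
        congr 2
        ext; simp
      rw [h0]
      refine ⟨1, fun h => ?_, fun a => ?_, fun t _ => ⟨coeff 0 t, ?_⟩⟩
      · rw [mem_ideal_span_X_image] at h
        obtain ⟨i, _, hi⟩ := h 0 (by simp)
        simp at hi
      · rw [mul_one]
        exact Ideal.subset_span ⟨a, trivial, rfl⟩
      · rw [mem_ideal_span_X_image]
        intro m hm
        by_contra! hc
        have : m = 0 := Finsupp.ext fun i => hc i (Set.mem_univ i)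
        subst this
        rw [mem_support_iff] at hm
        simp at hm
    | succ i ih =>
      intro hi
      let a : Fin N := ⟨i, by omega⟩
      have h1 := ih (by omega)
      rw [show i = a.1 from rfl, flagIdeal_eq_sup_X] at h1
      rw [show i + 1 = a.1 + 1 from rfl, flagIdeal_succ_left]
      exact h1.transfer (hf.nonZeroDiv_X a.1 a le_rfl)
        (hf.nonZeroDiv_flag a (a.1 + 1) (by omega) (by omega))
        (mem_span_X_of_isHomogeneous (isHomogeneous_X ℂ a) one_pos)
        (mem_span_X_of_isHomogeneous (hf.homogeneous a) hf.pos)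
  exact key N le_rfl

/-! ### Freeness over the subalgebra generated by a flag system -/

/-- A family of homogeneous polynomials lifting a basis of the quotient by `I`. -/
structure IsLiftedBasis {S : Type*} [Fintype S] (I : Ideal (MvPolynomial (Fin N) ℂ))
    (u : S → MvPolynomial (Fin N) ℂ) (δ : S → ℕ) : Prop where
  homogeneous : ∀ s, (u s).IsHomogeneous (δ s)
  indep : ∀ c : S → ℂ, ∑ s, C (c s) * u s ∈ I → c = 0
  span : ∀ p, ∃ c : S → ℂ, p - ∑ s, C (c s) * u s ∈ I

section Free

variable {S : Type*} [Fintype S] {u : S → MvPolynomial (Fin N) ℂ} {δ : S → ℕ}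

/-- The map `p ↦ ∑ u_s p_s(f)`. -/
def freeMap (f : Fin N → MvPolynomial (Fin N) ℂ) (u : S → MvPolynomial (Fin N) ℂ) :
    (S → MvPolynomial (Fin N) ℂ) →ₗ[ℂ] MvPolynomial (Fin N) ℂ :=
  ∑ s, (LinearMap.mulLeft ℂ (u s)).comp ((aeval f).toLinearMap.comp (LinearMap.proj s))

theorem freeMap_apply (p : S → MvPolynomial (Fin N) ℂ) :
    freeMap f u p = ∑ s, u s * aeval f (p s) := by
  simp [freeMap, LinearMap.sum_apply]

theorem freeMap_mul (q : MvPolynomial (Fin N) ℂ) (p : S → MvPolynomial (Fin N) ℂ) :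
    freeMap f u (fun s => q * p s) = aeval f q * freeMap f u p := by
  simp only [freeMap_apply, map_mul, Finset.mul_sum]
  exact Finset.sum_congr rfl fun s _ => by ring

theorem homogeneousComponent_of_isHomogeneous {σ : Type*} {p : MvPolynomial σ ℂ} {d : ℕ}
    (hp : p.IsHomogeneous d) (e : ℕ) :
    homogeneousComponent e p = if e = d then p else 0 :=
  homogeneousComponent_of_mem hp

/-- Graded Nakayama: modulo the u_s a homogeneous polynomial is a combination of the f_a with
coefficients of degree smaller by r > 0, to which induction applies. -/
theorem IsLiftedBasis.freeMap_surjective (hf : FlagSystem r f)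
    (hu : IsLiftedBasis (Ideal.span (Set.range f)) u δ) : Function.Surjective (freeMap f u) := by
  have key : ∀ d, ∀ p : MvPolynomial (Fin N) ℂ, p.IsHomogeneous d →
      p ∈ LinearMap.range (freeMap f u) := by
    intro d
    induction d using Nat.strong_induction_on with
    | _ d ih =>
      intro p hp
      obtain ⟨c, hc⟩ := hu.span p
      obtain ⟨b, hb⟩ := (Ideal.mem_span_range_iff_exists_fun).1 hc
      have h1 : p = ∑ s, C (c s) * u s + ∑ a, f a * b a := by
        simp only [mul_comm (f _)]
        rw [hb]; ring
      have h2 : p = homogeneousComponent d p := by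
        rw [homogeneousComponent_of_isHomogeneous hp, if_pos rfl]
      -- The coefficients b_a need not be homogeneous; projecting the whole identity to degree d
      -- replaces them by their components of degree d - r.
      rw [h2, h1, map_add, map_sum, map_sum]
      refine Submodule.add_mem _ (Submodule.sum_mem _ fun s _ => ?_)
        (Submodule.sum_mem _ fun a _ => ?_)
      · classical
        rw [homogeneousComponent_C_mul, homogeneousComponent_of_isHomogeneous (hu.homogeneous s)]
        split_ifs
        · refine ⟨Pi.single s (C (c s)), ?_⟩
          rw [freeMap_apply, Finset.sum_eq_single s]
          · simp [mul_comm, algebraMap_eq]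
          · intro t _ ht
            simp [Pi.single_eq_of_ne ht]
          · simp
        · simp
      · rw [homogeneousComponent_mul (hf.homogeneous a)]
        split_ifs with hd
        · obtain ⟨q, hq⟩ := ih (d - r) (by have := hf.pos; omega)
            (homogeneousComponent (d - r) (b a)) (homogeneousComponent_isHomogeneous _ _)
          refine ⟨fun s => X a * q s, ?_⟩
          rw [freeMap_mul, hq, aeval_X]
        · exact Submodule.zero_mem _
  intro p
  rw [← LinearMap.mem_range, ← sum_homogeneousComponent p]
  exact Submodule.sum_mem _ fun d _ => key d _ (homogeneousComponent_isHomogeneous _ _)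

theorem aeval_mem_span {i : ℕ} {p : MvPolynomial (Fin N) ℂ}
    (hp : p ∈ Ideal.span (X '' {a : Fin N | a.1 < i})) :
    aeval f p ∈ Ideal.span (f '' {a | a.1 < i}) := by
  have : Ideal.span (X '' {a : Fin N | a.1 < i}) ≤
      (Ideal.span (f '' {a | a.1 < i})).comap (aeval (R := ℂ) f) := by
    rw [Ideal.span_le]
    rintro _ ⟨a, ha, rfl⟩
    simp only [SetLike.mem_coe, Ideal.mem_comap, aeval_X]
    exact Ideal.subset_span ⟨a, ha, rfl⟩
  exact this hp

theorem span_image_succ {R : Type*} [CommRing R] (g : Fin N → R) (a : Fin N) :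
    Ideal.span (g '' {b | b.1 < a.1 + 1}) =
      Ideal.span (g '' {b | b.1 < a.1}) ⊔ Ideal.span {g a} := by
  rw [← Ideal.span_union]
  congr 1
  have : {b : Fin N | b.1 < a.1 + 1} = insert a {b | b.1 < a.1} := by
    ext b
    simp only [Set.mem_ofPred_eq, Set.mem_insert_iff, Fin.ext_iff]
    omega
  rw [this, Set.image_insert_eq, Set.union_singleton]

/-- The generators are dropped from the ideal one at a time: j = 0 is the independence of the u_s in
the quotient, and j = N is injectivity of the free map. -/
theorem IsLiftedBasis.mem_of_freeMap_mem (hf : FlagSystem r f)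
    (hu : IsLiftedBasis (Ideal.span (Set.range f)) u δ) (j : ℕ) (hj : j ≤ N)
    (p : S → MvPolynomial (Fin N) ℂ)
    (hp : freeMap f u p ∈ Ideal.span (f '' {a | a.1 < N - j})) (s : S) :
    p s ∈ Ideal.span (X '' {a : Fin N | a.1 < N - j}) := by
  induction j generalizing p s with
  | zero =>
    have e1 : f '' {a : Fin N | a.1 < N - 0} = Set.range f := by simp
    have e2 : (X : Fin N → MvPolynomial (Fin N) ℂ) '' {a : Fin N | a.1 < N - 0} = Set.range X := by
      simp
    rw [e1] at hp
    have h0 : ∀ q : MvPolynomial (Fin N) ℂ, q - C (coeff 0 q) ∈ Ideal.span (Set.range X) := by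
      intro q
      rw [← Set.image_univ, mem_ideal_span_X_image]
      intro m hm
      by_contra! hc
      have : m = 0 := Finsupp.ext fun i => hc i (Set.mem_univ i)
      subst this
      simp at hm
    have h1 : ∑ s, C (coeff 0 (p s)) * u s ∈ Ideal.span (Set.range f) := by
      have : freeMap f u p - freeMap f u (fun s => p s - C (coeff 0 (p s))) =
          ∑ s, C (coeff 0 (p s)) * u s := by
        rw [← map_sub, freeMap_apply]
        refine Finset.sum_congr rfl fun s _ => ?_
        simp [mul_comm, algebraMap_eq]
      rw [← this]
      refine Ideal.sub_mem _ hp ?_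
      rw [freeMap_apply]
      refine Ideal.sum_mem _ fun s _ => Ideal.mul_mem_left _ _ ?_
      rw [← e1]
      refine aeval_mem_span ?_
      rw [e2]
      exact h0 _
    have h2 := congrFun (hu.indep _ h1) s
    have := h0 (p s)
    rw [show coeff 0 (p s) = 0 from h2, map_zero, sub_zero] at this
    rwa [e2]
  | succ j ih =>
    let a : Fin N := ⟨N - (j + 1), by omega⟩
    have ha : N - j = a.1 + 1 := by change N - j = N - (j + 1) + 1; omega
    have ih' := ih (by omega)
    rw [ha] at ih'
    change freeMap f u p ∈ Ideal.span (f '' {b | b.1 < a.1}) at hp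
    change p s ∈ Ideal.span (X '' {b : Fin N | b.1 < a.1})
    -- By induction each coefficient is a multiple of X_a modulo the earlier variables. Regularity
    -- of f_a allows division by it, and the argument repeats; the graded intersection argument then
    -- concludes.
    have key : ∀ k, ∃ q : S → MvPolynomial (Fin N) ℂ,
        (∀ s, p s - X a ^ k * q s ∈ Ideal.span (X '' {b : Fin N | b.1 < a.1})) ∧
          freeMap f u q ∈ Ideal.span (f '' {b | b.1 < a.1}) := by
      intro k
      induction k with
      | zero => exact ⟨p, by simp, hp⟩
      | succ k ihk =>
        obtain ⟨q, h1, h2⟩ := ihk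
        have h3 : ∀ s, ∃ t ∈ Ideal.span (X '' {b : Fin N | b.1 < a.1}), ∃ q', q s = t + X a * q' := by
          intro s
          have := ih' q (by rw [span_image_succ]; exact Ideal.mem_sup_left h2) s
          rw [span_image_succ] at this
          exact mem_sup_span.1 this
        choose t ht q' hq' using h3
        refine ⟨q', fun s => ?_, hf.nonZeroDiv a _ ?_⟩
        · have := Ideal.add_mem _ (h1 s) (Ideal.mul_mem_left _ (X a ^ k) (ht s))
          convert this using 1
          rw [hq' s]; ring
        · have e : f a * freeMap f u q' = freeMap f u q - freeMap f u t := by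
            rw [← map_sub, ← aeval_X (R := ℂ) f a, ← freeMap_mul]
            congr 1
            funext s
            simp [hq' s]
          rw [e]
          refine Ideal.sub_mem _ h2 ?_
          rw [freeMap_apply]
          exact Ideal.sum_mem _ fun s _ => Ideal.mul_mem_left _ _ (aeval_mem_span (ht s))
    refine IsGraded.mem_of_forall_pow (isGraded_span ?_) (isHomogeneous_X ℂ a) one_pos
      fun k => (key k).elim fun q h => ⟨_, h.1 s⟩
    rintro _ ⟨b, _, rfl⟩
    exact ⟨1, isHomogeneous_X ℂ b⟩

theorem IsLiftedBasis.freeMap_bijective (hf : FlagSystem r f)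
    (hu : IsLiftedBasis (Ideal.span (Set.range f)) u δ) : Function.Bijective (freeMap f u) := by
  refine ⟨?_, hu.freeMap_surjective hf⟩
  rw [injective_iff_map_eq_zero]
  intro p hp
  funext s
  have := hu.mem_of_freeMap_mem hf N le_rfl p (by rw [hp]; exact Ideal.zero_mem _) s
  simpa using this

end Free

/-- The quotient by a flag system is finite-dimensional. -/
theorem FlagSystem.finite_quotient (hf : FlagSystem r f) :
    Module.Finite ℂ (MvPolynomial (Fin N) ℂ ⧸ Ideal.span (Set.range f)) := by
  set I := Ideal.span (Set.range f)
  have h1 : Algebra.adjoin ℂ (Set.range fun a => Ideal.Quotient.mkₐ ℂ I (X a)) = ⊤ := by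
    have := congrArg (Subalgebra.map (Ideal.Quotient.mkₐ ℂ I)) (adjoin_range_X (R := ℂ) (σ := Fin N))
    rw [AlgHom.map_adjoin, ← Set.range_comp, Algebra.map_top,
      (AlgHom.range_eq_top _).2 (Ideal.Quotient.mkₐ_surjective ℂ I)] at this
    exact this
  have h2 : (Algebra.adjoin ℂ (Set.range fun a => Ideal.Quotient.mkₐ ℂ I (X a))).toSubmodule.FG := by
    refine fg_adjoin_of_finite (Set.finite_range _) ?_
    rintro _ ⟨a, rfl⟩
    obtain ⟨k, hk⟩ := hf.exists_X_pow_mem_span a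
    refine ⟨Polynomial.X ^ k, Polynomial.monic_X_pow k, ?_⟩
    rw [Polynomial.eval₂_pow, Polynomial.eval₂_X, ← map_pow]
    exact Ideal.Quotient.eq_zero_iff_mem.2 hk
  rw [h1] at h2
  exact ⟨h2⟩

/-- A homogeneous spanning family contains the lift of a basis of the quotient. -/
theorem FlagSystem.exists_isLiftedBasis (hf : FlagSystem r f) {ι : Type*}
    (v : ι → MvPolynomial (Fin N) ℂ) (d : ι → ℕ) (hv : ∀ i, (v i).IsHomogeneous (d i))
    (hs : Submodule.span ℂ (Set.range v) = ⊤) :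
    ∃ (m : ℕ) (e : Fin m → ι), 
      IsLiftedBasis (Ideal.span (Set.range f)) (fun s => v (e s)) (fun s => d (e s)) := by
  set I := Ideal.span (Set.range f)
  have := hf.finite_quotient
  let π := (Ideal.Quotient.mkₐ ℂ I).toLinearMap
  have hπ : ∀ p, π p = 0 ↔ p ∈ I := fun p => Ideal.Quotient.eq_zero_iff_mem
  have hπC : ∀ (m : ℕ) (c : Fin m → ℂ) (u : Fin m → MvPolynomial (Fin N) ℂ),
      π (∑ s, C (c s) * u s) = ∑ s, c s • π (u s) := by
    intro m c u
    simp only [← smul_eq_C_mul, map_sum, map_smul]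
  obtain ⟨κ, a, _, hsp, hli⟩ := exists_linearIndependent' ℂ (π ∘ v)
  have : Finite κ := hli.finite
  have := Fintype.ofFinite κ
  let e := (Fintype.equivFin κ).symm
  refine ⟨_, a ∘ e, fun s => hv _, fun c hc => ?_, fun p => ?_⟩
  · rw [← hπ, hπC] at hc
    have hli' := hli.comp e e.injective
    rw [Fintype.linearIndependent_iff] at hli'
    exact funext (hli' c hc)
  · have hp : π p ∈ Submodule.span ℂ (Set.range ((π ∘ v) ∘ a ∘ e)) := by
      rw [← Function.comp_assoc, e.surjective.range_comp, hsp, Set.range_comp, 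
        ← Submodule.map_span, hs]
      exact ⟨p, trivial, rfl⟩
    obtain ⟨c, hc⟩ := (Submodule.mem_span_range_iff_exists_fun ℂ).1 hp
    refine ⟨c, ?_⟩
    rw [← hπ, map_sub, hπC, ← hc]
    exact sub_self _

end Flag

end GradedRegular
end

noncomputable section

open MvPolynomial

namespace Cherednik

/-! ### Contraction and wedge product on exterior powers -/

section Exterior

variable {V : Type*} [AddCommGroup V] [Module ℂ V]

/-- Contraction by a linear form on the exterior algebra. -/
def contrE (φ : Module.Dual ℂ V) : ExteriorAlgebra ℂ V →ₗ[ℂ] ExteriorAlgebra ℂ V :=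
  CliffordAlgebra.contractLeft (Q := 0) φ

theorem contrE_ι_mul (φ : Module.Dual ℂ V) (v : V) (x : ExteriorAlgebra ℂ V) :
    contrE φ (ExteriorAlgebra.ι ℂ v * x) = φ v • x - ExteriorAlgebra.ι ℂ v * contrE φ x :=
  CliffordAlgebra.contractLeft_ι_mul (Q := 0) φ v x

theorem contrE_algebraMap (φ : Module.Dual ℂ V) (c : ℂ) :
    contrE φ (algebraMap ℂ (ExteriorAlgebra ℂ V) c) = 0 :=
  CliffordAlgebra.contractLeft_algebraMap (Q := 0) φ c

theorem contrE_contrE (φ : Module.Dual ℂ V) (x : ExteriorAlgebra ℂ V) :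
    contrE φ (contrE φ x) = 0 :=
  CliffordAlgebra.contractLeft_contractLeft (Q := 0) φ x

theorem contrE_comm (φ ψ : Module.Dual ℂ V) (x : ExteriorAlgebra ℂ V) :
    contrE φ (contrE ψ x) = - contrE ψ (contrE φ x) :=
  CliffordAlgebra.contractLeft_comm (Q := 0) φ ψ x

theorem exterior_induction {P : ExteriorAlgebra ℂ V → Prop}
    (algebraMap : ∀ r : ℂ, P (algebraMap _ _ r)) (add : ∀ x y, P x → P y → P (x + y))
    (ι_mul : ∀ x m, P x → P (ExteriorAlgebra.ι ℂ m * x)) : ∀ x, P x :=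
  CliffordAlgebra.left_induction (Q := (0 : QuadraticForm ℂ V)) algebraMap add ι_mul

theorem exteriorPower_zero_eq (x : ExteriorAlgebra ℂ V) (hx : x ∈ ⋀[ℂ]^0 V) :
    ∃ c : ℂ, x = algebraMap ℂ _ c := by
  obtain ⟨c, hc⟩ := Submodule.mem_one.1 (by simpa using hx)
  exact ⟨c, hc.symm⟩

theorem exteriorPower_succ_induction {j : ℕ} {S : Submodule ℂ (ExteriorAlgebra ℂ V)}
    (h : ∀ v, ∀ x ∈ ⋀[ℂ]^j V, ExteriorAlgebra.ι ℂ v * x ∈ S) : ⋀[ℂ]^(j + 1) V ≤ S := by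
  rw [ExteriorAlgebra.exteriorPower, pow_succ', Submodule.mul_le]
  rintro _ ⟨v, rfl⟩ x hx
  exact h v x hx

theorem ι_mul_mem {j : ℕ} (v : V) {x : ExteriorAlgebra ℂ V} (hx : x ∈ ⋀[ℂ]^j V) :
    ExteriorAlgebra.ι ℂ v * x ∈ ⋀[ℂ]^(j + 1) V := by
  rw [ExteriorAlgebra.exteriorPower, pow_succ']
  exact Submodule.mul_mem_mul ⟨v, rfl⟩ hx

theorem contrE_mem {j : ℕ} (φ : Module.Dual ℂ V) {x : ExteriorAlgebra ℂ V}
    (hx : x ∈ ⋀[ℂ]^(j + 1) V) : contrE φ x ∈ ⋀[ℂ]^j V := by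
  induction j generalizing x with
  | zero =>
    refine exteriorPower_succ_induction (S := (⋀[ℂ]^0 V).comap (contrE φ)) (fun v x hx => ?_) hx
    rw [Submodule.mem_comap, contrE_ι_mul]
    obtain ⟨c, rfl⟩ := exteriorPower_zero_eq x hx
    rw [contrE_algebraMap, mul_zero, sub_zero]
    exact Submodule.smul_mem _ _ hx
  | succ j ih =>
    refine exteriorPower_succ_induction (S := (⋀[ℂ]^(j + 1) V).comap (contrE φ))
      (fun v x hx => ?_) hx
    rw [Submodule.mem_comap, contrE_ι_mul]
    exact Submodule.sub_mem _ (Submodule.smul_mem _ _ hx) (ι_mul_mem v (ih hx))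

/-- Contraction by a linear form on exterior powers. -/
def contr (j : ℕ) : Module.Dual ℂ V →ₗ[ℂ] (⋀[ℂ]^(j + 1) V) →ₗ[ℂ] (⋀[ℂ]^j V) where
  toFun φ := (contrE φ).restrict fun _ hx => contrE_mem φ hx
  map_add' φ ψ := LinearMap.ext fun x => Subtype.ext (by
    change CliffordAlgebra.contractLeft (Q := 0) (φ + ψ) _ = _
    rw [map_add]; rfl)
  map_smul' c φ := LinearMap.ext fun x => Subtype.ext (by
    change CliffordAlgebra.contractLeft (Q := 0) (c • φ) _ = _
    rw [map_smul]; rfl)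

theorem coe_contr {j : ℕ} (φ : Module.Dual ℂ V) (x : ⋀[ℂ]^(j + 1) V) :
    (contr j φ x : ExteriorAlgebra ℂ V) = contrE φ x := rfl

/-- Exterior multiplication by a vector. -/
def wedge (j : ℕ) (v : V) : (⋀[ℂ]^j V) →ₗ[ℂ] (⋀[ℂ]^(j + 1) V) :=
  (LinearMap.mulLeft ℂ (ExteriorAlgebra.ι ℂ v)).restrict fun _ hx => ι_mul_mem v hx

theorem contr_wedge {j : ℕ} (φ : Module.Dual ℂ V) (v : V) (x : ⋀[ℂ]^(j + 1) V) :
    contr (j + 1) φ (wedge (j + 1) v x) = φ v • x - wedge j v (contr j φ x) :=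
  Subtype.ext (contrE_ι_mul φ v x)

theorem sum_contr_coord {ι : Type*} [Fintype ι] (b : Module.Basis ι ℂ V) {j : ℕ}
    (φ : Module.Dual ℂ V) (x : ⋀[ℂ]^(j + 1) V) :
    ∑ a, φ (b a) • contr j (b.coord a) x = contr j φ x := by
  classical
  have h : ∑ a, φ (b a) • b.coord a = φ := by
    refine b.ext fun c => ?_
    rw [LinearMap.sum_apply, Finset.sum_eq_single c]
    · simp
    · intro a _ ha
      simp [ha.symm]
    · simp
  rw [← congrArg (fun ψ => contr j ψ x) h, map_sum, LinearMap.sum_apply]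
  exact Finset.sum_congr rfl fun a _ => by rw [map_smul, LinearMap.smul_apply]

theorem contr_comm {j : ℕ} (φ ψ : Module.Dual ℂ V) (x : ⋀[ℂ]^(j + 1 + 1) V) :
    contr j φ (contr (j + 1) ψ x) = - contr j ψ (contr (j + 1) φ x) :=
  Subtype.ext (contrE_comm φ ψ x)

/-- The Euler identity of the exterior algebra: when v is wedged on, the terms contracting v
contribute one further copy and the others pass through v with two sign changes. It gives the
exterior part of the Koszul homotopy. -/
theorem sum_wedge_contrE {ι : Type*} [Fintype ι] (b : Module.Basis ι ℂ V) (j : ℕ)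
    {x : ExteriorAlgebra ℂ V} (hx : x ∈ ⋀[ℂ]^j V) :
    ∑ a, ExteriorAlgebra.ι ℂ (b a) * contrE (b.coord a) x = (j : ℂ) • x := by
  induction j generalizing x with
  | zero =>
    obtain ⟨c, rfl⟩ := exteriorPower_zero_eq x hx
    simp [contrE_algebraMap]
  | succ j ih =>
    refine exteriorPower_succ_induction (S := LinearMap.eqLocus
      (∑ a, (LinearMap.mulLeft ℂ (ExteriorAlgebra.ι ℂ (b a))).comp (contrE (b.coord a)))
      (((j + 1 : ℕ) : ℂ) • LinearMap.id)) (fun v x hx => ?_) hx |> fun h => by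
        simpa [LinearMap.sum_apply] using h
    have hanti : ∀ a, ExteriorAlgebra.ι ℂ (b a) * (ExteriorAlgebra.ι ℂ v * contrE (b.coord a) x) =
        - (ExteriorAlgebra.ι ℂ v * (ExteriorAlgebra.ι ℂ (b a) * contrE (b.coord a) x)) := by
      intro a
      rw [← mul_assoc, ← mul_assoc, eq_neg_iff_add_eq_zero, ← add_mul,
        ExteriorAlgebra.ι_add_mul_swap, zero_mul]
    have hsum : ∑ a, b.coord a v • ExteriorAlgebra.ι ℂ (b a) = ExteriorAlgebra.ι ℂ v := by
      conv_rhs => rw [← b.sum_repr v, map_sum]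
      simp
    simp only [LinearMap.mem_eqLocus, LinearMap.sum_apply, LinearMap.comp_apply,
      LinearMap.mulLeft_apply, contrE_ι_mul, mul_sub, hanti, sub_neg_eq_add,
      Finset.sum_add_distrib, ← Finset.mul_sum, ih hx, LinearMap.smul_apply, LinearMap.id_apply,
      mul_smul_comm, ← smul_mul_assoc, ← Finset.sum_mul, hsum]
    push_cast
    rw [add_smul, one_smul, add_comm, add_mul]

theorem sum_wedge_contr {ι : Type*} [Fintype ι] (b : Module.Basis ι ℂ V) (j : ℕ)
    (x : ⋀[ℂ]^(j + 1) V) :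
    ∑ a, wedge j (b a) (contr j (b.coord a) x) = ((j : ℂ) + 1) • x := by
  apply Subtype.ext
  have := sum_wedge_contrE b (j + 1) x.2
  push_cast at this
  rw [Submodule.coe_smul, ← this, AddSubmonoidClass.coe_finsetSum]
  rfl

theorem coe_exteriorPower_map {V' : Type*} [AddCommGroup V'] [Module ℂ V'] (j : ℕ)
    (f : V →ₗ[ℂ] V') (x : ⋀[ℂ]^j V) :
    (exteriorPower.map j f x : ExteriorAlgebra ℂ V') = ExteriorAlgebra.map f x := by
  have : (Submodule.subtype _).comp (exteriorPower.map j f) =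
      (ExteriorAlgebra.map f).toLinearMap.comp (Submodule.subtype _) := by
    refine exteriorPower.linearMap_ext (AlternatingMap.ext fun v => ?_)
    simp [LinearMap.compAlternatingMap_apply]
  exact LinearMap.congr_fun this x

theorem map_contrE (f : V →ₗ[ℂ] V) (φ ψ : Module.Dual ℂ V) (h : ∀ v, ψ (f v) = φ v)
    (x : ExteriorAlgebra ℂ V) :
    ExteriorAlgebra.map f (contrE φ x) = contrE ψ (ExteriorAlgebra.map f x) := by
  induction x using exterior_induction with
  | algebraMap r => rw [AlgHom.commutes, contrE_algebraMap, contrE_algebraMap, map_zero]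
  | add x y hx hy => simp only [map_add, hx, hy]
  | ι_mul x v hx =>
    rw [contrE_ι_mul, map_sub, map_smul, map_mul, map_mul, ExteriorAlgebra.map_apply_ι,
      contrE_ι_mul, hx, h]

/-- All terms of second and higher order in the perturbation v ↦ φ(v) c contain c ∧ c and vanish. -/
theorem map_reflection (f : V →ₗ[ℂ] V) (φ : Module.Dual ℂ V) (c : V)
    (h : ∀ v, f v = v - φ v • c) (x : ExteriorAlgebra ℂ V) :
    ExteriorAlgebra.map f x = x - ExteriorAlgebra.ι ℂ c * contrE φ x := by
  induction x using exterior_induction with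
  | algebraMap r => rw [AlgHom.commutes, contrE_algebraMap, mul_zero, sub_zero]
  | add x y hx hy => rw [map_add, hx, hy, map_add, mul_add]; abel
  | ι_mul x v hx =>
    have h1 : ExteriorAlgebra.ι ℂ c * (ExteriorAlgebra.ι ℂ v * contrE φ x) =
        - (ExteriorAlgebra.ι ℂ v * (ExteriorAlgebra.ι ℂ c * contrE φ x)) := by
      rw [← mul_assoc, ← mul_assoc, eq_neg_iff_add_eq_zero, ← add_mul,
        ExteriorAlgebra.ι_add_mul_swap, zero_mul]
    have h2 : ExteriorAlgebra.ι ℂ c * (ExteriorAlgebra.ι ℂ c * contrE φ x) = 0 := by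
      rw [← mul_assoc, ExteriorAlgebra.ι_sq_zero, zero_mul]
    rw [map_mul, ExteriorAlgebra.map_apply_ι, hx, contrE_ι_mul, h, map_sub, map_smul, sub_mul,
      mul_sub, mul_sub, mul_sub, h1, smul_mul_assoc, smul_mul_assoc, h2, mul_smul_comm]
    simp only [smul_zero, sub_zero]
    abel

end Exterior

variable {N : ℕ}

theorem extRep_contr (g : Equiv.Perm (Fin (N + 1))) (j : ℕ) (φ : Module.Dual ℂ (Hsp (N + 1)))
    (x : ⋀[ℂ]^(j + 1) (Hsp (N + 1))) :
    extRep (N + 1) j g (contr j φ x) =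
      contr j ((reflRep (N + 1)).dual g φ) (extRep (N + 1) (j + 1) g x) := by
  apply Subtype.ext
  change ((exteriorPower.map j (reflRep (N + 1) g) _ : ⋀[ℂ]^j (Hsp (N + 1))) :
    ExteriorAlgebra ℂ (Hsp (N + 1))) = contrE _ (exteriorPower.map (j + 1) (reflRep (N + 1) g) x :
    ⋀[ℂ]^(j + 1) (Hsp (N + 1)))
  rw [coe_exteriorPower_map, coe_exteriorPower_map, coe_contr]
  refine map_contrE _ _ _ (fun v => ?_) _
  rw [Representation.dual_apply, Module.Dual.transpose_apply, LinearMap.comp_apply,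
    ← Module.End.mul_apply, ← map_mul]
  simp

/-- By `map_reflection` the reflection changes this vector by a term containing two contractions by
the same form. This is what makes the Koszul differential produce singular vectors. -/
theorem extRep_transposition_contr (i l : Fin (N + 1)) (j : ℕ) (x : ⋀[ℂ]^(j + 1) (Hsp (N + 1))) :
    extRep (N + 1) j (Equiv.swap i l) (contr j (root (N + 1) i l) x) =
      contr j (root (N + 1) i l) x := by
  apply Subtype.ext
  change ((exteriorPower.map j (reflRep (N + 1) _) _ : ⋀[ℂ]^j (Hsp (N + 1))) :
    ExteriorAlgebra ℂ (Hsp (N + 1))) = _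
  rw [coe_exteriorPower_map, coe_contr,
    map_reflection _ (root (N + 1) i l) (coroot (N + 1) i l) (reflRep_transposition i l),
    contrE_contrE, mul_zero, sub_zero]

/-! ### The Koszul-BGG differential -/

section Differential

variable (r : ℕ)

/-- The linear map `𝔥 → ℂ[𝔥]` with `y_i ↦ f_i`. -/
def fLin (N r : ℕ) : Hsp (N + 1) →ₗ[ℂ] MvPolynomial (Fin N) ℂ :=
  (hBasis N).constr ℂ fun a => fA N r a.castSucc

theorem fLin_hBasis (a : Fin N) : fLin N r (hBasis N a) = fA N r a.castSucc := by
  rw [fLin, Module.Basis.constr_basis]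

theorem sum_yvec : ∑ i, yvec (N + 1) i = 0 := by
  have : ∑ i, yvec (N + 1) i = (Submodule.mkQ _) (∑ i, Pi.single i (1 : ℂ)) := by
    rw [map_sum]; rfl
  rw [this, Submodule.mkQ_apply, Submodule.Quotient.mk_eq_zero]
  refine Submodule.mem_span_singleton.2 ⟨1, ?_⟩
  rw [one_smul]
  exact (Finset.univ_sum_single (1 : Fin (N + 1) → ℂ)).symm

variable {r}

/-- Only the first N vectors enter the definition of `fLin`; the last one is recovered from ∑ y_i =
0 and ∑ f_i = 0. -/
theorem fLin_yvec (hr : 0 < r) (i : Fin (N + 1)) : fLin N r (yvec (N + 1) i) = fA N r i := by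
  have h : ∀ a : Fin N, fLin N r (yvec (N + 1) a.castSucc) = fA N r a.castSucc := fun a => by
    rw [← hBasis_apply, fLin_hBasis]
  refine Fin.lastCases ?_ h i
  have h1 : ∑ i, fLin N r (yvec (N + 1) i) = ∑ i, fA N r i := by
    rw [← map_sum, sum_yvec, map_zero, sum_fA r hr]
  rw [Fin.sum_univ_castSucc, Fin.sum_univ_castSucc (f := fA N r)] at h1
  simp only [h] at h1
  exact add_left_cancel h1

theorem hom_ext_yvec {M : Type*} [AddCommGroup M] [Module ℂ M] {f g : Hsp (N + 1) →ₗ[ℂ] M}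
    (h : ∀ i, f (yvec (N + 1) i) = g (yvec (N + 1) i)) : f = g :=
  (hBasis N).ext fun a => by rw [hBasis_apply]; exact h _

theorem act_fLin (hr : 0 < r) (g : Equiv.Perm (Fin (N + 1))) (v : Hsp (N + 1)) :
    act N g (fLin N r v) = fLin N r (reflRep (N + 1) g v) := by
  have : (act N g).toLinearMap.comp (fLin N r) = (fLin N r).comp (reflRep (N + 1) g) := by
    refine hom_ext_yvec fun i => ?_
    simp only [LinearMap.comp_apply, AlgHom.toLinearMap_apply]
    rw [fLin_yvec hr, act_fA, reflRep_yvec, fLin_yvec hr]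
  exact LinearMap.congr_fun this v

/-- By equivariance f_v - s f_v = f_{v - sv}, and v - sv is the multiple α(v) of y_i - y_j. -/
theorem divDiff_fLin (hr : 0 < r) {i j : Fin (N + 1)} (h : i ≠ j) (v : Hsp (N + 1)) :
    divDiff N i j (fLin N r v) = root (N + 1) i j v • gA N r i j := by
  rw [divDiff_eq_iff h, act_fLin hr, reflRep_transposition, map_sub, sub_sub_cancel, map_smul,
    coroot, map_sub, fLin_yvec hr, fLin_yvec hr, fA_sub_fA, mul_smul_comm]

theorem der_fLin (hr : 0 < r) (u v : Hsp (N + 1)) :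
    der N u (fLin N r v) = ∑ p ∈ reflections (N + 1), (kpar (N + 1) r *
      root (N + 1) p.1 p.2 u * root (N + 1) p.1 p.2 v) • gA N r p.1 p.2 := by
  let B1 : Hsp (N + 1) →ₗ[ℂ] Hsp (N + 1) →ₗ[ℂ] MvPolynomial (Fin N) ℂ :=
    LinearMap.mk₂ ℂ (fun u v => der N u (fLin N r v)) (fun _ _ _ => der_add _ _ _)
      (fun _ _ _ => der_smul _ _ _) (fun _ _ _ => by simp) (fun _ _ _ => by simp)
  let B2 : Hsp (N + 1) →ₗ[ℂ] Hsp (N + 1) →ₗ[ℂ] MvPolynomial (Fin N) ℂ :=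
    LinearMap.mk₂ ℂ (fun u v => ∑ p ∈ reflections (N + 1), (kpar (N + 1) r *
      root (N + 1) p.1 p.2 u * root (N + 1) p.1 p.2 v) • gA N r p.1 p.2)
      (fun _ _ _ => by simp only [map_add, mul_add, add_mul, add_smul, Finset.sum_add_distrib])
      (fun c _ _ => by
        simp only [map_smul, Finset.smul_sum, smul_smul, smul_eq_mul]
        exact Finset.sum_congr rfl fun p _ => by ring_nf)
      (fun _ _ _ => by simp only [map_add, mul_add, add_smul, Finset.sum_add_distrib])
      (fun c _ _ => by
        simp only [map_smul, Finset.smul_sum, smul_smul, smul_eq_mul]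
        exact Finset.sum_congr rfl fun p _ => by ring_nf)
  have : B1 = B2 := by
    refine hom_ext_yvec fun l => hom_ext_yvec fun i => ?_
    change der N (yvec (N + 1) l) (fLin N r (yvec (N + 1) i)) = ∑ p ∈ reflections (N + 1), _
    rw [fLin_yvec hr, der_fA_yvec hr, Finset.smul_sum]
    exact Finset.sum_congr rfl fun p _ => by rw [smul_smul, mul_assoc]
  exact LinearMap.congr_fun (LinearMap.congr_fun this u) v

/-- The Koszul differential of `f_1, …, f_N`. -/
def koszul (N r j : ℕ) : PT N (⋀[ℂ]^(j + 1) (Hsp (N + 1))) →ₗ[ℂ] PT N (⋀[ℂ]^j (Hsp (N + 1))) :=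
  ∑ a, PT.map (LinearMap.mulLeft ℂ (fLin N r (hBasis N a))) (contr j ((hBasis N).coord a))

theorem koszul_tmul (j : ℕ) (p : MvPolynomial (Fin N) ℂ) (x : ⋀[ℂ]^(j + 1) (Hsp (N + 1))) :
    koszul N r j (p ⊠ x) =
      ∑ a, (fLin N r (hBasis N a) * p) ⊠ contr j ((hBasis N).coord a) x := by
  simp [koszul, LinearMap.sum_apply]

theorem PT.tmul_sum {τ ι : Type*} [AddCommGroup τ] [Module ℂ τ] (s : Finset ι)
    (p : MvPolynomial (Fin N) ℂ) (t : ι → τ) : p ⊠ (∑ i ∈ s, t i) = ∑ i ∈ s, p ⊠ t i :=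
  map_sum (PT.mk N τ p) _ _

theorem PT.sum_tmul {τ ι : Type*} [AddCommGroup τ] [Module ℂ τ] (s : Finset ι)
    (p : ι → MvPolynomial (Fin N) ℂ) (t : τ) : (∑ i ∈ s, p i) ⊠ t = ∑ i ∈ s, p i ⊠ t := by
  change PT.mk N τ (∑ i ∈ s, p i) t = _
  rw [map_sum, LinearMap.sum_apply]; rfl

theorem opW_koszul (hr : 0 < r) (j : ℕ) (g : Equiv.Perm (Fin (N + 1)))
    (x : ⋀[ℂ]^(j + 1) (Hsp (N + 1))) :
    opW (extRep (N + 1) j) g (koszul N r j (1 ⊠ x)) =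
      koszul N r j (1 ⊠ extRep (N + 1) (j + 1) g x) := by
  have h2 : ∀ c, ∑ a, (hBasis N).coord c (reflRep (N + 1) g (hBasis N a)) •
      (reflRep (N + 1)).dual g ((hBasis N).coord a) = (hBasis N).coord c := by
    intro c
    refine LinearMap.ext fun v => ?_
    have hv : reflRep (N + 1) g (reflRep (N + 1) g⁻¹ v) = v := by
      rw [← Module.End.mul_apply, ← map_mul]; simp
    conv_rhs => rw [← hv, ← (hBasis N).sum_repr (reflRep (N + 1) g⁻¹ v), map_sum, map_sum]
    simp [Representation.dual_apply, Module.Dual.transpose_apply, mul_comm]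
  simp only [koszul_tmul, mul_one, map_sum, opW_tmul, act_fLin hr, extRep_contr]
  have h1 : ∀ a, fLin N r (reflRep (N + 1) g (hBasis N a)) =
      ∑ c, (hBasis N).coord c (reflRep (N + 1) g (hBasis N a)) • fLin N r (hBasis N c) := by
    intro a
    conv_lhs => rw [← (hBasis N).sum_repr (reflRep (N + 1) g (hBasis N a)), map_sum]
    simp
  simp only [h1, PT.sum_tmul, PT.smul_tmul]
  rw [Finset.sum_comm]
  refine Finset.sum_congr rfl fun c _ => ?_
  conv_rhs => rw [← h2 c]
  simp only [map_sum, map_smul, LinearMap.sum_apply, LinearMap.smul_apply, PT.tmul_sum,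
    PT.tmul_smul]

/-- The derivative and the divided differences of f_v have the same coefficients k α(u) α(v) g_α, so
they combine into the operators 1 - s_α on τ. -/
theorem opY_fLin_tmul (hr : 0 < r) {τ : Type*} [AddCommGroup τ] [Module ℂ τ]
    (ρ : Representation ℂ (Equiv.Perm (Fin (N + 1))) τ) (u v : Hsp (N + 1)) (t : τ) :
    opY ρ (kpar (N + 1) r) u (fLin N r v ⊠ t) = ∑ q ∈ reflections (N + 1),
      (kpar (N + 1) r * root (N + 1) q.1 q.2 u) • (gA N r q.1 q.2 ⊠
        (root (N + 1) q.1 q.2 v • (t - ρ (Equiv.swap q.1 q.2) t))) := by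
  rw [opY_tmul, der_fLin hr, PT.sum_tmul, ← Finset.sum_sub_distrib]
  refine Finset.sum_congr rfl fun q hq => ?_
  have hne : q.1 ≠ q.2 := by
    simp only [reflections, Finset.mem_filter] at hq
    exact hq.2.ne
  rw [divDiff_fLin hr hne, PT.smul_tmul, PT.smul_tmul, PT.tmul_smul, mul_smul, ← smul_sub,
    ← smul_sub, sub_eq_add_neg t, PT.tmul_add, ← neg_one_smul ℂ (ρ _ t), PT.tmul_smul,
    neg_one_smul, ← sub_eq_add_neg]

/-- Summing over the basis turns the α-term into (1 - s_α) applied to the contraction of x by α,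
which vanishes. -/
theorem opY_koszul (hr : 0 < r) (j : ℕ) (u : Hsp (N + 1)) (x : ⋀[ℂ]^(j + 1) (Hsp (N + 1))) :
    opY (extRep (N + 1) j) (kpar (N + 1) r) u (koszul N r j (1 ⊠ x)) = 0 := by
  rw [koszul_tmul, map_sum]
  simp only [mul_one, opY_fLin_tmul hr]
  rw [Finset.sum_comm]
  refine Finset.sum_eq_zero fun q _ => ?_
  rw [← Finset.smul_sum, ← PT.tmul_sum]
  simp only [smul_sub]
  rw [Finset.sum_sub_distrib, sum_contr_coord]
  simp only [← map_smul (extRep (N + 1) j (Equiv.swap q.1 q.2))]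
  rw [← map_sum, sum_contr_coord, extRep_transposition_contr, sub_self]
  simp [PT.tmul]

end Differential

end Cherednik
end

/-! ### Contracting homotopy for the Koszul complex of a flag system -/

noncomputable section

open MvPolynomial

namespace GradedRegular

variable {N r : ℕ} {f : Fin N → MvPolynomial (Fin N) ℂ}

/-- The operator which divides the monomials of degree `d` by `d + c`. -/
def degreeInv (N c : ℕ) : MvPolynomial (Fin N) ℂ →ₗ[ℂ] MvPolynomial (Fin N) ℂ :=
  (basisMonomials (Fin N) ℂ).constr ℂ fun e => monomial e (((e.degree + c : ℕ) : ℂ)⁻¹)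

theorem degreeInv_monomial (c : ℕ) (e : Fin N →₀ ℕ) :
    degreeInv N c (monomial e 1) = monomial e (((e.degree + c : ℕ) : ℂ)⁻¹) := by
  have := (basisMonomials (Fin N) ℂ).constr_basis ℂ
    (fun e => (monomial e (((e.degree + c : ℕ) : ℂ)⁻¹) : MvPolynomial (Fin N) ℂ)) e
  rwa [coe_basisMonomials] at this

theorem X_mul_degreeInv (c : ℕ) (a : Fin N) (p : MvPolynomial (Fin N) ℂ) :
    X a * degreeInv N (c + 1) p = degreeInv N c (X a * p) := by
  have : (LinearMap.mulLeft ℂ (X a)).comp (degreeInv N (c + 1)) =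
      (degreeInv N c).comp (LinearMap.mulLeft ℂ (X a)) := by
    refine (basisMonomials (Fin N) ℂ).ext fun e => ?_
    rw [coe_basisMonomials]
    simp only [LinearMap.comp_apply, LinearMap.mulLeft_apply, degreeInv_monomial]
    rw [X, monomial_mul, monomial_mul, one_mul, one_mul, degreeInv_monomial]
    congr 3
    rw [map_add, Finsupp.degree_single]
    ring
  exact LinearMap.congr_fun this p

theorem sum_X_mul_pderiv_degreeInv (c : ℕ) (hc : 0 < c) (p : MvPolynomial (Fin N) ℂ) :
    ∑ a, X a * pderiv a (degreeInv N c p) + (c : ℂ) • degreeInv N c p = p := by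
  have : (∑ a, (LinearMap.mulLeft ℂ (X a)).comp
      ((pderiv (R := ℂ) a).toLinearMap.comp (degreeInv N c))) + (c : ℂ) • degreeInv N c =
      LinearMap.id := by
    refine (basisMonomials (Fin N) ℂ).ext fun e => ?_
    rw [coe_basisMonomials]
    simp only [LinearMap.add_apply, LinearMap.sum_apply, LinearMap.comp_apply,
      LinearMap.mulLeft_apply, LinearMap.smul_apply, degreeInv_monomial, LinearMap.id_apply,
      Derivation.coeFn_coe, X_mul_pderiv_monomial, ← Finset.sum_smul]
    rw [← Finsupp.degree_eq_sum, ← Nat.cast_smul_eq_nsmul ℂ, ← add_smul, smul_monomial, smul_eq_mul]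
    push_cast
    rw [mul_inv_cancel₀]
    have : ((e.degree + c : ℕ) : ℂ) ≠ 0 := by
      norm_cast
      omega
    exact_mod_cast this
  have := LinearMap.congr_fun this p
  simpa [LinearMap.sum_apply] using this

/-- Operators which contract the Koszul complex of a flag system. -/
theorem FlagSystem.exists_homotopy (hf : FlagSystem r f) :
    ∃ (T : Fin N → MvPolynomial (Fin N) ℂ →ₗ[ℂ] MvPolynomial (Fin N) ℂ)
      (R : ℕ → MvPolynomial (Fin N) ℂ →ₗ[ℂ] MvPolynomial (Fin N) ℂ),
      (∀ a b p, T a (f b * p) = (if a = b then p else 0) + f b * T a p) ∧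
      (∀ c, 0 < c → ∀ p, ∑ a, f a * T a (R c p) + (c : ℂ) • R c p = p) ∧
      ∀ c a p, f a * R (c + 1) p = R c (f a * p) := by
  obtain ⟨m, e, hu⟩ := hf.exists_isLiftedBasis (fun e : Fin N →₀ ℕ => monomial e (1 : ℂ))
    (fun e => e.degree) (fun e => isHomogeneous_monomial _ rfl) (by
      rw [← coe_basisMonomials]
      exact (basisMonomials (Fin N) ℂ).span_eq)
  -- Under Φ, ℂ[𝔥] becomes a sum of polynomial rings on which f_b acts as X_b. The operators T_a and
  -- R_c are the partial derivative and the division by degree + c, transported through Φ; c > 0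
  -- keeps the divisor nonzero.
  let Φ := LinearEquiv.ofBijective _ (hu.freeMap_bijective hf)
  have hΦ : ∀ b p, Φ (fun s => X b * p s) = f b * Φ p := fun b p => by
    have := freeMap_mul (f := f) (u := fun s => monomial (e s) (1 : ℂ)) (X b) p
    rwa [aeval_X] at this
  have hΦ' : ∀ b p, Φ.symm (f b * p) = fun s => X b * Φ.symm p s := fun b p => by
    rw [LinearEquiv.symm_apply_eq, hΦ, LinearEquiv.apply_symm_apply]
  let lft : (MvPolynomial (Fin N) ℂ →ₗ[ℂ] MvPolynomial (Fin N) ℂ) →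
      MvPolynomial (Fin N) ℂ →ₗ[ℂ] MvPolynomial (Fin N) ℂ := fun h =>
    Φ.toLinearMap.comp ((LinearMap.pi fun s => h.comp (LinearMap.proj s)).comp Φ.symm.toLinearMap)
  have hl : ∀ h p, lft h p = Φ fun s => h (Φ.symm p s) := fun h p => rfl
  refine ⟨fun a => lft (pderiv (R := ℂ) a).toLinearMap, fun c => lft (degreeInv N c),
    fun a b p => ?_, fun c hc p => ?_, fun c a p => ?_⟩
  · rw [hl, hΦ', hl, ← hΦ]
    have : (if a = b then p else 0) = Φ (fun s => if a = b then Φ.symm p s else 0) := by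
      split_ifs
      · exact (Φ.apply_symm_apply p).symm
      · exact (map_zero Φ).symm
    rw [this, ← map_add]
    congr 1
    funext s
    simp only [Derivation.coeFn_coe, Derivation.leibniz,
      smul_eq_mul, pderiv_X, Pi.add_apply, Pi.single_apply]
    split_ifs with h1 h2 h2
    · ring
    · exact absurd h1.symm h2
    · exact absurd h2.symm h1
    · ring
  · simp only [hl, LinearEquiv.symm_apply_apply, ← hΦ]
    rw [← map_smul, ← map_sum, ← map_add, ← LinearEquiv.eq_symm_apply]
    funext s
    simpa using sum_X_mul_pderiv_degreeInv c hc (Φ.symm p s)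
  · rw [hl, ← hΦ, hl, hΦ']
    congr 1
    funext s
    exact X_mul_degreeInv c a _

end GradedRegular

namespace Cherednik

variable {N r : ℕ}

theorem flagSystem_fA (hr : 0 < r) (hrn : Nat.gcd r (N + 1) = 1) :
    GradedRegular.FlagSystem r fun a : Fin N => fA N r a.castSucc :=
  ⟨hr, fun _ => fA_isHomogeneous r _, fun m x h1 h2 => eq_zero_of_fA_eq_zero hr hrn m x h1 h2⟩

/-! ### Exactness of the Koszul complex -/

section KoszulHomotopy

variable {τ₀ τ₁ τ₂ : Type*} [AddCommGroup τ₀] [Module ℂ τ₀] [AddCommGroup τ₁] [Module ℂ τ₁]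
  [AddCommGroup τ₂] [Module ℂ τ₂] {f : Fin N → MvPolynomial (Fin N) ℂ}

/-- The sum of the maps `f_a ⊗ c_a`. -/
def sumMap (f : Fin N → MvPolynomial (Fin N) ℂ) (c : Fin N → τ₁ →ₗ[ℂ] τ₀) :
    PT N τ₁ →ₗ[ℂ] PT N τ₀ :=
  ∑ a, PT.map (LinearMap.mulLeft ℂ (f a)) (c a)

theorem sumMap_tmul (c : Fin N → τ₁ →ₗ[ℂ] τ₀) (p : MvPolynomial (Fin N) ℂ) (x : τ₁) :
    sumMap f c (p ⊠ x) = ∑ a, (f a * p) ⊠ c a x := by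
  simp [sumMap, LinearMap.sum_apply]

theorem sumMap_sumMap {c₁ : Fin N → τ₁ →ₗ[ℂ] τ₀} {c₂ : Fin N → τ₂ →ₗ[ℂ] τ₁}
    (h : ∀ a b x, c₁ a (c₂ b x) = - c₁ b (c₂ a x)) (z : PT N τ₂) :
    sumMap f c₁ (sumMap f c₂ z) = 0 := by
  have : (sumMap f c₁).comp (sumMap f c₂) = 0 := by
    refine PT.ext fun p x => ?_
    simp only [LinearMap.comp_apply, sumMap_tmul, map_sum, LinearMap.zero_apply]
    have h0 : ∀ S : PT N τ₀, S = -S → S = 0 := fun S hS => by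
      have h2 : (2 : ℂ) • S = 0 := by
        rw [two_smul]
        nth_rewrite 1 [hS]
        exact neg_add_cancel S
      exact (smul_eq_zero.1 h2).resolve_left two_ne_zero
    refine h0 _ ?_
    conv_lhs => rw [Finset.sum_comm]
    rw [← Finset.sum_neg_distrib]
    refine Finset.sum_congr rfl fun a _ => ?_
    rw [← Finset.sum_neg_distrib]
    refine Finset.sum_congr rfl fun b _ => ?_
    rw [h, mul_left_comm, ← neg_one_smul ℂ (c₁ _ _), PT.tmul_smul, neg_one_smul]
  exact LinearMap.congr_fun this z

/-- With d the differential and δ = ∑ T_a ⊗ w_a, the operator dδ + δd is multiplication by the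
degree in the f's plus the exterior degree j + 1. The latter is positive, so R_{j+1} inverts the
operator; R intertwines with d up to a shift of its index, so it preserves cycles. -/
theorem sumMap_exact (hf : GradedRegular.FlagSystem r f) (j : ℕ)
    {c₁ : Fin N → τ₁ →ₗ[ℂ] τ₀} {c₂ : Fin N → τ₂ →ₗ[ℂ] τ₁} {w₀ : Fin N → τ₀ →ₗ[ℂ] τ₁}
    {w₁ : Fin N → τ₁ →ₗ[ℂ] τ₂}
    (hcw : ∀ a b x, c₂ b (w₁ a x) = (if a = b then x else 0) - w₀ a (c₁ b x))
    (hw : ∀ x, ∑ a, w₀ a (c₁ a x) = ((j : ℂ) + 1) • x) (z : PT N τ₁) (hz : sumMap f c₁ z = 0) :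
    ∃ w, sumMap f c₂ w = z := by
  obtain ⟨T, R, hT, hR, hc⟩ := hf.exists_homotopy
  let δ₀ : PT N τ₀ →ₗ[ℂ] PT N τ₁ := ∑ a, PT.map (T a) (w₀ a)
  let δ₁ : PT N τ₁ →ₗ[ℂ] PT N τ₂ := ∑ a, PT.map (T a) (w₁ a)
  have hδ₀ : ∀ p x, δ₀ (p ⊠ x) = ∑ a, T a p ⊠ w₀ a x := fun p x => by
    simp [δ₀, LinearMap.sum_apply]
  have hδ₁ : ∀ p x, δ₁ (p ⊠ x) = ∑ a, T a p ⊠ w₁ a x := fun p x => by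
    simp [δ₁, LinearMap.sum_apply]
  have hcomm : sumMap f c₁ (PT.map (R (j + 1)) LinearMap.id z) = 0 := by
    have : (sumMap f c₁).comp (PT.map (R (j + 1)) LinearMap.id) =
        (PT.map (R j) LinearMap.id).comp (sumMap f c₁) := by
      refine PT.ext fun p x => ?_
      simp only [LinearMap.comp_apply, sumMap_tmul, PT.map_tmul, map_sum, LinearMap.id_apply, hc]
    have := LinearMap.congr_fun this z
    rwa [LinearMap.comp_apply, LinearMap.comp_apply, hz, map_zero] at this
  have hhom : (sumMap f c₂).comp (δ₁.comp (PT.map (R (j + 1)) LinearMap.id)) +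
      δ₀.comp ((sumMap f c₁).comp (PT.map (R (j + 1)) LinearMap.id)) = LinearMap.id := by
    refine PT.ext fun p x => ?_
    simp only [LinearMap.add_apply, LinearMap.comp_apply, PT.map_tmul, LinearMap.id_apply, hδ₀,
      hδ₁, sumMap_tmul, map_sum, hT]
    have hRp := hR (j + 1) j.succ_pos p
    generalize R (j + 1) p = q at *
    rw [Finset.sum_comm, ← Finset.sum_add_distrib]
    -- The terms with a ≠ b in dδ and δd cancel. The diagonal ones give the Euler operator in the
    -- f's and the term w_b c_b, which sum to the two degrees.
    have step : ∀ b : Fin N, (∑ a, (f b * T a q) ⊠ c₂ b (w₁ a x)) +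
        ∑ a, ((if a = b then q else 0) + f b * T a q) ⊠ w₀ a (c₁ b x) =
        (f b * T b q) ⊠ x + q ⊠ w₀ b (c₁ b x) := by
      intro b
      rw [← Finset.sum_add_distrib]
      have : ∀ a, (f b * T a q) ⊠ c₂ b (w₁ a x) +
          ((if a = b then q else 0) + f b * T a q) ⊠ w₀ a (c₁ b x) =
          if a = b then (f b * T b q) ⊠ x + q ⊠ w₀ b (c₁ b x) else 0 := by
        intro a
        rw [hcw, PT.add_tmul, sub_eq_add_neg, PT.tmul_add, ← neg_one_smul ℂ (w₀ _ _),
          PT.tmul_smul]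
        split_ifs with h
        · subst h
          rw [neg_one_smul]
          abel
        · rw [PT.zero_tmul, neg_one_smul, zero_add]
          simp [PT.tmul]
      rw [Finset.sum_congr rfl fun a _ => this a, Finset.sum_ite_eq' Finset.univ b]
      simp
    rw [Finset.sum_congr rfl fun b _ => step b, Finset.sum_add_distrib, ← PT.sum_tmul,
      ← PT.tmul_sum, hw, PT.tmul_smul, ← PT.smul_tmul, ← PT.add_tmul]
    push_cast at hRp
    rw [hRp]
  have := LinearMap.congr_fun hhom z
  rw [LinearMap.add_apply, LinearMap.comp_apply, LinearMap.comp_apply δ₀, LinearMap.comp_apply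
    (sumMap f c₁), hcomm, map_zero, add_zero] at this
  exact ⟨_, this⟩

end KoszulHomotopy

theorem koszul_eq (j : ℕ) : koszul N r j = sumMap (fun a : Fin N => fLin N r (hBasis N a))
    (fun a => contr j ((hBasis N).coord a)) := rfl

theorem koszul_exact (hr : 0 < r) (hrn : Nat.gcd r (N + 1) = 1) (j : ℕ) :
    Function.Exact (koszul N r (j + 1)) (koszul N r j) := by
  have hf : GradedRegular.FlagSystem r fun a : Fin N => fLin N r (hBasis N a) := by
    simp only [fLin_hBasis]
    exact flagSystem_fA hr hrn
  have hcw : ∀ (a b : Fin N) (x : ⋀[ℂ]^(j + 1) (Hsp (N + 1))),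
      contr (j + 1) ((hBasis N).coord b) (wedge (j + 1) (hBasis N a) x) =
        (if a = b then x else 0) - wedge j (hBasis N a) (contr j ((hBasis N).coord b) x) := by
    intro a b x
    rw [contr_wedge, Module.Basis.coord_apply, Module.Basis.repr_self, Finsupp.single_apply]
    congr 1
    split_ifs
    · exact one_smul _ _
    · exact zero_smul _ _
  rw [koszul_eq, koszul_eq]
  refine fun z => ⟨sumMap_exact (c₁ := fun a => contr j ((hBasis N).coord a))
    (c₂ := fun a => contr (j + 1) ((hBasis N).coord a)) (w₀ := fun a => wedge j (hBasis N a))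
    (w₁ := fun a => wedge (j + 1) (hBasis N a)) hf j hcw (sum_wedge_contr (hBasis N) j) z, ?_⟩
  rintro ⟨w, rfl⟩
  exact sumMap_sumMap (c₁ := fun a => contr j ((hBasis N).coord a))
    (c₂ := fun a => contr (j + 1) ((hBasis N).coord a)) (fun a b x => contr_comm _ _ _) w

/-! ### Homomorphisms between standard modules -/

section Hom

variable {τ σ υ : Type*} [AddCommGroup τ] [Module ℂ τ] [AddCommGroup σ] [Module ℂ σ]
  [AddCommGroup υ] [Module ℂ υ] {k : ℂ}
  {ρ : Representation ℂ (Equiv.Perm (Fin (N + 1))) τ}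
  {ρ' : Representation ℂ (Equiv.Perm (Fin (N + 1))) σ}
  {ρ'' : Representation ℂ (Equiv.Perm (Fin (N + 1))) υ}

theorem Std.ofPT_injective (k : ℂ) (ρ : Representation ℂ (Equiv.Perm (Fin (N + 1))) τ) :
    Function.Injective (Std.ofPT k ρ) := by
  intro x y h
  have := congrArg (Std.toDunkl k ρ) h
  rw [Std.toDunkl_ofPT, Std.toDunkl_ofPT] at this
  exact (DunklMod.of k ρ).injective this

theorem Std.lowest_eq_ofPT (k : ℂ) (ρ : Representation ℂ (Equiv.Perm (Fin (N + 1))) τ) (t : τ) :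
    Std.lowest (N + 1) k ρ t = Std.ofPT k ρ (1 ⊠ t) := by
  rw [Std.ofPT_tmul, map_one, one_smul]

theorem Std.smul_ofPT (a : Alg (N + 1) k) (m : PT N τ) :
    a • Std.ofPT k ρ m = Std.ofPT k ρ (dunkl ρ k a m) := by
  apply (Std.equivDunkl k ρ).injective
  rw [map_smul]
  change a • Std.toDunkl k ρ _ = Std.toDunkl k ρ _
  rw [Std.toDunkl_ofPT, Std.toDunkl_ofPT, DunklMod.smul_of]

/-- A map `ℂ[𝔥] ⊗ τ → ℂ[𝔥] ⊗ σ` which is linear over `ℂ[𝔥]`, equivariant and sends `τ` to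
singular vectors. -/
structure IsSingularMap (k : ℂ) (ρ : Representation ℂ (Equiv.Perm (Fin (N + 1))) τ)
    (ρ' : Representation ℂ (Equiv.Perm (Fin (N + 1))) σ) (D : PT N τ →ₗ[ℂ] PT N σ) : Prop where
  polyHom : ∀ p t, dunkl ρ' k (polyHom N k p) (D (1 ⊠ t)) = D (p ⊠ t)
  opW : ∀ g t, opW ρ' g (D (1 ⊠ t)) = D (1 ⊠ ρ g t)
  opY : ∀ v t, opY ρ' k v (D (1 ⊠ t)) = 0

/-- The homomorphism of standard modules given by a singular map. -/
def Std.hom {D : PT N τ →ₗ[ℂ] PT N σ} (hD : IsSingularMap k ρ ρ' D) :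
    Std (N + 1) k ρ →ₗ[Alg (N + 1) k] Std (N + 1) k ρ' :=
  Std.lift ρ ((Std.ofPT k ρ').comp (D.comp (PT.mk N τ 1)))
    (fun g t => by
      change W (N + 1) k g • Std.ofPT k ρ' (D (1 ⊠ t)) = Std.ofPT k ρ' (D (1 ⊠ ρ g t))
      rw [Std.smul_ofPT, dunkl_W, hD.opW])
    (fun v t => by
      change Y (N + 1) k v • Std.ofPT k ρ' (D (1 ⊠ t)) = 0
      rw [Std.smul_ofPT, dunkl_Y, hD.opY, map_zero])

theorem Std.hom_ofPT {D : PT N τ →ₗ[ℂ] PT N σ} (hD : IsSingularMap k ρ ρ' D) (m : PT N τ) :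
    Std.hom hD (Std.ofPT k ρ m) = Std.ofPT k ρ' (D m) := by
  have : ((Std.hom hD).restrictScalars ℂ).comp (Std.ofPT k ρ) = (Std.ofPT k ρ').comp D := by
    refine PT.ext fun p x => ?_
    change Std.hom hD (polyHom N k p • Std.lowest (N + 1) k ρ x) = Std.ofPT k ρ' (D (p ⊠ x))
    rw [map_smul, Std.hom, Std.lift_lowest]
    change polyHom N k p • Std.ofPT k ρ' (D (1 ⊠ x)) = _
    rw [Std.smul_ofPT, hD.polyHom]
  exact LinearMap.congr_fun this m

theorem Std.hom_exact {D₂ : PT N τ →ₗ[ℂ] PT N σ} {D₁ : PT N σ →ₗ[ℂ] PT N υ}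
    (h₂ : IsSingularMap k ρ ρ' D₂) (h₁ : IsSingularMap k ρ' ρ'' D₁) (h : Function.Exact D₂ D₁) :
    Function.Exact (Std.hom h₂) (Std.hom h₁) := by
  intro z
  obtain ⟨z, rfl⟩ := Std.ofPT_surjective _ _ z
  rw [Std.hom_ofPT, map_eq_zero_iff _ (Std.ofPT_injective _ _), h z]
  constructor
  · rintro ⟨w, rfl⟩
    exact ⟨Std.ofPT _ _ w, Std.hom_ofPT h₂ w⟩
  · rintro ⟨w, hw⟩
    obtain ⟨w, rfl⟩ := Std.ofPT_surjective _ _ w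
    rw [Std.hom_ofPT] at hw
    exact ⟨w, Std.ofPT_injective _ _ hw⟩

theorem Std.range_eq_span {ι : Type*} {v : ι → τ} (hv : Submodule.span ℂ (Set.range v) = ⊤)
    (F : Std (N + 1) k ρ →ₗ[Alg (N + 1) k] Std (N + 1) k ρ') :
    LinearMap.range F = Submodule.span _ (Set.range fun i => F (Std.lowest (N + 1) k ρ (v i))) := by
  apply le_antisymm
  · rw [LinearMap.range_eq_map, Submodule.map_le_iff_le_comap, top_le_iff]
    refine Std.span_lowest _ _ fun t => ?_
    rw [Submodule.mem_comap]
    have ht : t ∈ Submodule.span ℂ (Set.range v) := by rw [hv]; trivial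
    change F (Std.lowestₗ (N + 1) k ρ t) ∈ _
    induction ht using Submodule.span_induction with
    | mem x hx => obtain ⟨i, rfl⟩ := hx; exact Submodule.subset_span ⟨i, rfl⟩
    | zero => rw [map_zero, map_zero]; exact Submodule.zero_mem _
    | add x y _ _ hx hy => rw [map_add, map_add]; exact Submodule.add_mem _ hx hy
    | smul c x _ hx =>
      rw [map_smul, ← algebraMap_smul (Alg (N + 1) k), map_smul]
      exact Submodule.smul_mem _ _ hx
  · rw [Submodule.span_le]
    rintro _ ⟨i, rfl⟩
    exact ⟨_, rfl⟩

theorem Std.W_smul_lowestₗ_comp {n : ℕ} {k : ℂ} {ρ : Representation ℂ (Equiv.Perm (Fin n)) τ}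
    {ρ' : Representation ℂ (Equiv.Perm (Fin n)) σ} (e : τ →ₗ[ℂ] σ)
    (he : ∀ g t, e (ρ g t) = ρ' g (e t)) (g : Equiv.Perm (Fin n)) (t : τ) :
    W n k g • ((Std.lowestₗ n k ρ').comp e) t = ((Std.lowestₗ n k ρ').comp e) (ρ g t) :=
  (Std.W_smul_lowest ρ' g (e t)).trans (congrArg (Std.lowest n k ρ') (he g t).symm)

theorem Std.Y_smul_lowestₗ_comp {n : ℕ} {k : ℂ}
    {ρ' : Representation ℂ (Equiv.Perm (Fin n)) σ} (e : τ →ₗ[ℂ] σ) (v : Hsp n) (t : τ) :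
    Y n k v • ((Std.lowestₗ n k ρ').comp e) t = 0 :=
  Std.Y_smul_lowest ρ' v (e t)

/-- The homomorphism of standard modules given by an intertwiner. -/
def Std.map {n : ℕ} {k : ℂ} {ρ : Representation ℂ (Equiv.Perm (Fin n)) τ}
    {ρ' : Representation ℂ (Equiv.Perm (Fin n)) σ} (e : τ →ₗ[ℂ] σ)
    (he : ∀ g t, e (ρ g t) = ρ' g (e t)) : Std n k ρ →ₗ[Alg n k] Std n k ρ' :=
  Std.lift ρ ((Std.lowestₗ n k ρ').comp e)
    (Std.W_smul_lowestₗ_comp e he) (Std.Y_smul_lowestₗ_comp e)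

theorem Std.map_lowest {n : ℕ} {k : ℂ} {ρ : Representation ℂ (Equiv.Perm (Fin n)) τ}
    {ρ' : Representation ℂ (Equiv.Perm (Fin n)) σ} (e : τ →ₗ[ℂ] σ)
    (he : ∀ g t, e (ρ g t) = ρ' g (e t)) (t : τ) :
    Std.map (k := k) e he (Std.lowest n k ρ t) = Std.lowest n k ρ' (e t) :=
  Std.lift_lowest ρ _ (Std.W_smul_lowestₗ_comp e he) (Std.Y_smul_lowestₗ_comp e) t

/-- Isomorphic representations have isomorphic standard modules. -/
def Std.congr {n : ℕ} {k : ℂ} {ρ : Representation ℂ (Equiv.Perm (Fin n)) τ}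
    {ρ' : Representation ℂ (Equiv.Perm (Fin n)) σ} (e : τ ≃ₗ[ℂ] σ)
    (he : ∀ g t, e (ρ g t) = ρ' g (e t)) : Std n k ρ ≃ₗ[Alg n k] Std n k ρ' :=
  LinearEquiv.ofLinearMap (Std.map (e : τ →ₗ[ℂ] σ) he)
    (Std.map (e.symm : σ →ₗ[ℂ] τ) fun g t => by
      rw [LinearEquiv.coe_coe, LinearEquiv.symm_apply_eq, he, LinearEquiv.apply_symm_apply])
    (Std.hom_ext _ fun t => by
      rw [LinearMap.comp_apply, Std.map_lowest, Std.map_lowest, LinearEquiv.coe_coe,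
        LinearEquiv.coe_coe, LinearEquiv.apply_symm_apply, LinearMap.id_apply])
    (Std.hom_ext _ fun t => by
      rw [LinearMap.comp_apply, Std.map_lowest, Std.map_lowest, LinearEquiv.coe_coe,
        LinearEquiv.coe_coe, LinearEquiv.symm_apply_apply, LinearMap.id_apply])

theorem Std.congr_lowest {n : ℕ} {k : ℂ} {ρ : Representation ℂ (Equiv.Perm (Fin n)) τ}
    {ρ' : Representation ℂ (Equiv.Perm (Fin n)) σ} (e : τ ≃ₗ[ℂ] σ)
    (he : ∀ g t, e (ρ g t) = ρ' g (e t)) (t : τ) :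
    Std.congr (k := k) e he (Std.lowest n k ρ t) = Std.lowest n k ρ' (e t) :=
  Std.map_lowest (e : τ →ₗ[ℂ] σ) he t

theorem Std.subsingleton {n : ℕ} {k : ℂ} (ρ : Representation ℂ (Equiv.Perm (Fin n)) τ)
    [Subsingleton τ] : Subsingleton (Std n k ρ) := by
  have hbot : (⊥ : Submodule (Alg n k) (Std n k ρ)) = ⊤ := by
    refine Std.span_lowest _ _ fun t => ?_
    rw [Subsingleton.elim t 0]
    exact (Submodule.mem_bot _).2 (map_zero (Std.lowestₗ n k ρ))
  exact (Submodule.subsingleton_iff _).1 (subsingleton_of_bot_eq_top hbot)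

end Hom

/-! ### The BGG resolution -/

theorem koszul_isSingularMap (hr : 0 < r) (j : ℕ) :
    IsSingularMap (kpar (N + 1) r) (extRep (N + 1) (j + 1)) (extRep (N + 1) j) (koszul N r j) where
  polyHom p t := by
    simp only [koszul_tmul, map_sum, mul_one, dunkl_polyHom]
    exact Finset.sum_congr rfl fun a _ => by rw [mul_comm]
  opW g t := opW_koszul hr j g t
  opY v t := opY_koszul hr j v t

theorem contr_ιMulti_one (φ : Module.Dual ℂ (Hsp (N + 1))) (v : Hsp (N + 1)) :
    contr 0 φ (exteriorPower.ιMulti ℂ 1 fun _ => v) =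
      φ v • exteriorPower.ιMulti ℂ 0 Fin.elim0 := by
  apply Subtype.ext
  rw [coe_contr, exteriorPower.ιMulti_apply_coe, ExteriorAlgebra.ιMulti_succ_apply, contrE_ι_mul,
    ExteriorAlgebra.ιMulti_zero_apply]
  have h := contrE_algebraMap φ 1
  rw [map_one] at h
  rw [h, mul_zero, sub_zero, Submodule.coe_smul, exteriorPower.ιMulti_apply_coe,
    ExteriorAlgebra.ιMulti_zero_apply]

theorem koszul_zero_yvec (hr : 0 < r) (i : Fin (N + 1)) :
    koszul N r 0 (1 ⊠ (exteriorPower.ιMulti ℂ 1 fun _ => yvec (N + 1) i)) =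
      fA N r i ⊠ exteriorPower.ιMulti ℂ 0 Fin.elim0 := by
  rw [koszul_tmul]
  simp only [contr_ιMulti_one, PT.tmul_smul, mul_one]
  simp only [← PT.smul_tmul]
  rw [← PT.sum_tmul, ← fLin_yvec hr]
  congr 1
  conv_rhs => rw [← (hBasis N).sum_repr (yvec (N + 1) i), map_sum]
  simp

theorem bgg_zero_lowest (hr : 0 < r) (i : Fin (N + 1)) :
    Std.hom (koszul_isSingularMap hr 0)
        (Std.lowest (N + 1) _ _ (exteriorPower.ιMulti ℂ 1 fun _ => yvec (N + 1) i)) =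
      polyEval (N + 1) (kpar (N + 1) r) (fpoly (N + 1) r i) •
        Std.lowest (N + 1) _ _ (exteriorPower.ιMulti ℂ 0 Fin.elim0) := by
  rw [Std.lowest_eq_ofPT]
  refine (Std.hom_ofPT (koszul_isSingularMap hr 0) _).trans ?_
  rw [koszul_zero_yvec hr, polyEval_eq]
  rfl

theorem zeroEquiv_extRep (n : ℕ) (g : Equiv.Perm (Fin n)) (t : ⋀[ℂ]^0 (Hsp n)) :
    exteriorPower.zeroEquiv ℂ (Hsp n) (extRep n 0 g t) =
      Representation.trivial ℂ (Equiv.Perm (Fin n)) ℂ g (exteriorPower.zeroEquiv ℂ (Hsp n) t) :=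
  LinearMap.congr_fun (exteriorPower.zeroEquiv_naturality (reflRep n g)) t

/-- The isomorphism `M_k(⋀^0 𝔥) ≅ M_k(ℂ)`. -/
def stdZero (n : ℕ) (k : ℂ) : Std n k (extRep n 0) ≃ₗ[Alg n k] Pol n k :=
  Std.congr (exteriorPower.zeroEquiv ℂ (Hsp n)) (zeroEquiv_extRep n)

theorem stdZero_lowest (n : ℕ) (k : ℂ) :
    stdZero n k (Std.lowest n k _ (exteriorPower.ιMulti ℂ 0 Fin.elim0)) =
      Std.lowest n k _ (1 : ℂ) := by
  rw [stdZero, Std.congr_lowest, exteriorPower.zeroEquiv_ιMulti]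

theorem span_yvec : Submodule.span ℂ (Set.range (yvec (N + 1))) = ⊤ := by
  rw [eq_top_iff, ← (hBasis N).span_eq]
  refine Submodule.span_mono ?_
  rintro _ ⟨a, rfl⟩
  exact ⟨_, (hBasis_apply a).symm⟩

theorem span_ιMulti_one : Submodule.span ℂ (Set.range fun i : Fin (N + 1) =>
    exteriorPower.ιMulti ℂ 1 fun _ => yvec (N + 1) i) = ⊤ := by
  have : (fun i : Fin (N + 1) => exteriorPower.ιMulti ℂ 1 fun _ => yvec (N + 1) i) =
      (exteriorPower.oneEquiv ℂ (Hsp (N + 1))).symm ∘ yvec (N + 1) := by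
    funext i
    rw [Function.comp_apply, LinearEquiv.eq_symm_apply, exteriorPower.oneEquiv_ιMulti]
  rw [this, Set.range_comp, ← LinearEquiv.coe_coe, ← Submodule.map_span, span_yvec,
    Submodule.map_top, LinearEquiv.range]

/-- The image of M_k(𝔥) is generated by the images of the y_i, since these span 𝔥, and those images
are the generators f_i of I_k. -/
theorem bgg_exact_zero (hr : 0 < r) : Function.Exact
    (Std.hom (N := N) (koszul_isSingularMap hr 0))
    ((Submodule.mkQ (Isub (N + 1) r)).comp (stdZero (N + 1) (kpar (N + 1) r)).toLinearMap) := by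
  rw [LinearMap.exact_iff, LinearMap.ker_comp, Submodule.ker_mkQ,
    Std.range_eq_span span_ιMulti_one]
  rw [funext (bgg_zero_lowest (N := N) hr)]
  rw [Submodule.comap_equiv_eq_map_symm, Isub, Submodule.map_span, ← Set.range_comp]
  congr 2
  funext i
  simp only [Function.comp_apply, polyVec]
  change (stdZero (N + 1) (kpar (N + 1) r)).symm _ = _
  rw [LinearEquiv.symm_apply_eq, map_smul, stdZero_lowest]

theorem hasBGGResolution (hr : 0 < r) (hrn : Nat.gcd r (N + 1) = 1) :
    HasBGGResolution (N + 1) r := by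
  refine ⟨(Submodule.mkQ (Isub (N + 1) r)).comp (stdZero (N + 1) (kpar (N + 1) r)).toLinearMap,
    fun j => Std.hom (koszul_isSingularMap hr j), ?_, bgg_zero_lowest hr, ?_, bgg_exact_zero hr,
    fun j => Std.hom_exact _ _ (koszul_exact hr hrn j), ?_⟩
  · exact congrArg _ (stdZero_lowest _ _)
  · exact (Submodule.mkQ_surjective _).comp (stdZero (N + 1) (kpar (N + 1) r)).surjective
  · intro j hj
    have h0 : Module.finrank ℂ (⋀[ℂ]^j (Hsp (N + 1))) = 0 := by
      rw [exteriorPower.finrank_eq, finrank_Hsp, Nat.choose_eq_zero_of_lt (by omega)]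
    have := Module.finrank_zero_iff.1 h0
    exact Std.subsingleton _

end Cherednik
end

/-! ### The socle, the quotient V_k as a quotient ring, and the grading element -/

noncomputable section

open MvPolynomial

namespace GradedRegular

variable {N r : ℕ} {f : Fin N → MvPolynomial (Fin N) ℂ}

theorem FlagSystem.isGraded_span_range (hf : FlagSystem r f) :
    IsGraded (Ideal.span (Set.range f)) := by
  refine isGraded_span ?_
  rintro _ ⟨a, rfl⟩
  exact ⟨r, hf.homogeneous a⟩

/-- Some power of the maximal ideal lies in the ideal. Induction on the power that annihilates p:
either p is already in the socle, or some X_a p is nonzero and is annihilated by a smaller power. -/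
theorem FlagSystem.exists_socle_mul (hf : FlagSystem r f) {p : MvPolynomial (Fin N) ℂ}
    (hp : p ∉ Ideal.span (Set.range f)) :
    ∃ q, q * p ∉ Ideal.span (Set.range f) ∧ ∀ a, X a * (q * p) ∈ Ideal.span (Set.range f) := by
  set I := Ideal.span (Set.range f)
  set M : Ideal (MvPolynomial (Fin N) ℂ) := Ideal.span (Set.range X) with hM
  have hrad : M ≤ I.radical := by
    rw [hM, Ideal.span_le]
    rintro _ ⟨a, rfl⟩
    exact hf.exists_X_pow_mem_span a
  obtain ⟨K, hK⟩ := Ideal.exists_pow_le_of_le_radical_of_fg hrad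
    (Submodule.fg_span (Set.finite_range _))
  have key : ∀ m, ∀ p, p ∉ I → (∀ q ∈ M ^ m, q * p ∈ I) →
      ∃ q, q * p ∉ I ∧ ∀ a, X a * (q * p) ∈ I := by
    intro m
    induction m with
    | zero =>
      intro p hp h
      exact absurd (by simpa using h 1 (by simp)) hp
    | succ m ih =>
      intro p hp h
      by_cases hX : ∀ a, X a * p ∈ I
      · exact ⟨1, by simpa using hp, by simpa using hX⟩
      · push Not at hX
        obtain ⟨a, ha⟩ := hX
        obtain ⟨q, h1, h2⟩ := ih _ ha fun q hq => by
          rw [← mul_assoc]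
          refine h _ ?_
          rw [pow_succ]
          exact Ideal.mul_mem_mul hq (Ideal.subset_span ⟨a, rfl⟩)
        exact ⟨q * X a, by rwa [mul_assoc], by simpa only [mul_assoc] using h2⟩
  exact key K p hp fun q hq => I.mul_mem_right _ (hK hq)

/-- The socle of the quotient by a flag system is spanned by a homogeneous element, which has the
maximal degree. -/
theorem FlagSystem.exists_homogeneous_socle (hf : FlagSystem r f) :
    ∃ (D : ℕ) (s : MvPolynomial (Fin N) ℂ), s.IsHomogeneous D ∧ s ∉ Ideal.span (Set.range f) ∧
      (∀ p ∉ Ideal.span (Set.range f), ∃ q, q * p - s ∈ Ideal.span (Set.range f)) ∧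
      ∀ p d, D < d → p.IsHomogeneous d → p ∈ Ideal.span (Set.range f) := by
  set I := Ideal.span (Set.range f)
  have hI : IsGraded I := hf.isGraded_span_range
  obtain ⟨s, h1, h2, h3⟩ := hf.hasSimpleSocle
  obtain ⟨D, hD⟩ : ∃ D, homogeneousComponent D s ∉ I := by
    by_contra! h
    apply h1
    rw [← sum_homogeneousComponent s]
    exact I.sum_mem fun d _ => h d
  have hX : ∀ a, X a * homogeneousComponent D s ∈ I := by
    intro a
    have := hI _ (h2 a) (D + 1)
    rwa [homogeneousComponent_mul (isHomogeneous_X ℂ a), if_pos (by omega),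
      Nat.add_sub_cancel] at this
  have hC : ∀ (c : ℂ) p, c ≠ 0 → C c * p ∈ I → p ∈ I := by
    intro c p hc h
    have := I.mul_mem_left (C c⁻¹) h
    rwa [← mul_assoc, ← C_mul, inv_mul_cancel₀ hc, C_1, one_mul] at this
  have h4 : ∀ p ∉ I, ∃ q, q * p - homogeneousComponent D s ∈ I := by
    intro p hp
    obtain ⟨q, hq1, hq2⟩ := hf.exists_socle_mul hp
    -- The homogeneous component and qp are both multiples c s and c' s of the original socle
    -- element, with c' ≠ 0, so a rescaling of q maps p to the component.
    obtain ⟨c, hc⟩ := h3 _ hX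
    obtain ⟨c', hc'⟩ := h3 _ hq2
    have hc'0 : c' ≠ 0 := by
      rintro rfl
      rw [C_0, zero_mul, sub_zero] at hc'
      exact hq1 hc'
    refine ⟨C (c / c') * q, ?_⟩
    have := I.sub_mem (I.mul_mem_left (C (c / c')) hc') hc
    convert this using 1
    have e : (C (c / c') : MvPolynomial (Fin N) ℂ) * C c' = C c := by
      rw [← C_mul, div_mul_cancel₀ _ hc'0]
    linear_combination s * e
  refine ⟨D, _, homogeneousComponent_isHomogeneous D s, hD, h4, fun p d hd hp => ?_⟩
  -- A nonzero class of degree greater than D would have a multiple equal to the socle element of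
  -- degree D, which is impossible for degree reasons.
  by_contra hpI
  obtain ⟨q, hq⟩ := h4 p hpI
  have := hI _ hq D
  rw [map_sub, mul_comm, homogeneousComponent_mul hp, if_neg (by omega), zero_sub, neg_mem_iff,
    homogeneousComponent_of_isHomogeneous (homogeneousComponent_isHomogeneous D s),
    if_pos rfl] at this
  exact hD this

end GradedRegular

namespace Cherednik

variable {N r : ℕ}

/-! ### The polynomial representation and its quotient -/

/-- The Dunkl operators on `ℂ[𝔥]`. -/
def dunklY (N : ℕ) (k : ℂ) (v : Hsp (N + 1)) : MvPolynomial (Fin N) ℂ →ₗ[ℂ] MvPolynomial (Fin N) ℂ :=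
  (der N v).toLinearMap - ∑ q ∈ reflections (N + 1),
    (k * root (N + 1) q.1 q.2 v) • divDiff N q.1 q.2

theorem dunklY_apply (k : ℂ) (v : Hsp (N + 1)) (p : MvPolynomial (Fin N) ℂ) :
    dunklY N k v p = der N v p - ∑ q ∈ reflections (N + 1),
      (k * root (N + 1) q.1 q.2 v) • divDiff N q.1 q.2 p := by
  simp [dunklY, LinearMap.sum_apply]

/-- The identification of `ℂ[𝔥]` with the polynomial representation. -/
def toPol (N : ℕ) (k : ℂ) : MvPolynomial (Fin N) ℂ →ₗ[ℂ] Pol (N + 1) k :=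
  (Std.ofPT k (Representation.trivial ℂ _ ℂ)).comp ((PT.mk N ℂ).flip 1)

theorem toPol_apply (k : ℂ) (p : MvPolynomial (Fin N) ℂ) :
    toPol N k p = Std.ofPT k (Representation.trivial ℂ _ ℂ) (p ⊠ (1 : ℂ)) := rfl

theorem polyHom_smul_toPol (k : ℂ) (q p : MvPolynomial (Fin N) ℂ) :
    polyHom N k q • toPol N k p = toPol N k (q * p) := by
  rw [toPol_apply, Std.smul_ofPT, dunkl_polyHom, toPol_apply]

theorem W_smul_toPol (k : ℂ) (g : Equiv.Perm (Fin (N + 1))) (p : MvPolynomial (Fin N) ℂ) :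
    W (N + 1) k g • toPol N k p = toPol N k (act N g p) := by
  rw [toPol_apply, Std.smul_ofPT, dunkl_W, opW_tmul, toPol_apply]
  rfl

theorem Y_smul_toPol (k : ℂ) (v : Hsp (N + 1)) (p : MvPolynomial (Fin N) ℂ) :
    Y (N + 1) k v • toPol N k p = toPol N k (dunklY N k v p) := by
  rw [toPol_apply, Std.smul_ofPT, dunkl_Y, opY_tmul, toPol_apply, dunklY_apply]
  congr 1
  rw [sub_eq_add_neg, sub_eq_add_neg, PT.add_tmul, PT.neg_tmul, PT.sum_tmul]
  simp only [PT.smul_tmul]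
  rfl

theorem toPol_surjective (k : ℂ) : Function.Surjective (toPol N k) := by
  have : LinearMap.range ((PT.mk N ℂ).flip 1) = ⊤ := by
    refine PT.eq_top _ fun p t => ⟨t • p, ?_⟩
    change (t • p) ⊠ (1 : ℂ) = p ⊠ t
    rw [PT.smul_tmul, ← PT.tmul_smul, smul_eq_mul, mul_one]
  exact (Std.ofPT_surjective _ _).comp (LinearMap.range_eq_top.1 this)

/-- The ideal generated by the `f_i`. -/
def fIdeal (N r : ℕ) : Ideal (MvPolynomial (Fin N) ℂ) :=
  Ideal.span (Set.range fun a : Fin N => fA N r a.castSucc)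

theorem fA_mem_fIdeal (hr : 0 < r) (i : Fin (N + 1)) : fA N r i ∈ fIdeal N r := by
  have h : ∀ a : Fin N, fA N r a.castSucc ∈ fIdeal N r := fun a => Ideal.subset_span ⟨a, rfl⟩
  refine Fin.lastCases ?_ h i
  have h1 := sum_fA (N := N) r hr
  rw [Fin.sum_univ_castSucc] at h1
  rw [← neg_mem_iff, ← eq_neg_of_add_eq_zero_left h1]
  exact Ideal.sum_mem _ fun a _ => h a

/-- A priori I_k is larger than the ideal, being stable under the Dunkl operators. But it is the
image of the first BGG differential, and every element of that image is a combination of the f's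
with polynomial coefficients. -/
theorem toPol_mem_Isub_iff (hr : 0 < r) (p : MvPolynomial (Fin N) ℂ) :
    toPol N (kpar (N + 1) r) p ∈ Isub (N + 1) r ↔ p ∈ fIdeal N r := by
  have hgen : ∀ i, polyVec (N + 1) (kpar (N + 1) r) (fpoly (N + 1) r i) =
      toPol N (kpar (N + 1) r) (fA N r i) := fun i => by
    rw [polyVec, polyEval_eq, toPol_apply]
    rfl
  constructor
  · intro h
    have h1 : Std.ofPT (kpar (N + 1) r) (extRep (N + 1) 0)
        (p ⊠ exteriorPower.ιMulti ℂ 0 Fin.elim0) ∈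
          LinearMap.ker ((Submodule.mkQ (Isub (N + 1) r)).comp
            (stdZero (N + 1) (kpar (N + 1) r)).toLinearMap) := by
      rw [LinearMap.ker_comp, Submodule.ker_mkQ, Submodule.mem_comap, LinearEquiv.coe_coe,
        Std.ofPT_tmul, map_smul, stdZero_lowest]
      exact h
    rw [(bgg_exact_zero hr).linearMap_ker_eq] at h1
    obtain ⟨w, hw⟩ := h1
    obtain ⟨m, rfl⟩ := Std.ofPT_surjective _ _ w
    have h2 := Std.ofPT_injective _ _ ((Std.hom_ofPT (koszul_isSingularMap hr 0) m).symm.trans hw)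
    let ev : PT N (⋀[ℂ]^0 (Hsp (N + 1))) →ₗ[ℂ] MvPolynomial (Fin N) ℂ :=
      PT.lift ((LinearMap.lsmul ℂ (MvPolynomial (Fin N) ℂ)).flip.compl₂
        (exteriorPower.zeroEquiv ℂ (Hsp (N + 1))).toLinearMap)
    have hev : ∀ q x, ev (q ⊠ x) = exteriorPower.zeroEquiv ℂ (Hsp (N + 1)) x • q :=
      fun _ _ => rfl
    have h3 : ev (p ⊠ exteriorPower.ιMulti ℂ 0 Fin.elim0) = p := by
      rw [hev, exteriorPower.zeroEquiv_ιMulti, one_smul]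
    rw [← h3, ← h2]
    have h4 : ((fIdeal N r).restrictScalars ℂ).comap (ev.comp (koszul N r 0)) = ⊤ := by
      refine PT.eq_top _ fun q x => ?_
      rw [Submodule.mem_comap, LinearMap.comp_apply, koszul_tmul, map_sum]
      refine Submodule.sum_mem _ fun a _ => ?_
      rw [hev, fLin_hBasis]
      exact Submodule.smul_mem _ _ (Ideal.mul_mem_right _ _ (fA_mem_fIdeal hr _))
    exact h4.ge (Submodule.mem_top (x := m))
  · intro h
    rw [fIdeal] at h
    induction h using Submodule.span_induction with
    | mem x hx =>
      obtain ⟨a, rfl⟩ := hx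
      exact Submodule.subset_span ⟨a.castSucc, hgen _⟩
    | zero => rw [map_zero]; exact Submodule.zero_mem _
    | add x y _ _ hx hy => rw [map_add]; exact Submodule.add_mem _ hx hy
    | smul q x _ hx =>
      rw [smul_eq_mul, ← polyHom_smul_toPol]
      exact Submodule.smul_mem _ _ hx

/-- The projection from `ℂ[𝔥]` to `V_k`. -/
def toV (N r : ℕ) : MvPolynomial (Fin N) ℂ →ₗ[ℂ] Vmod (N + 1) r :=
  ((Submodule.mkQ (Isub (N + 1) r)).restrictScalars ℂ).comp (toPol N (kpar (N + 1) r))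

theorem toV_apply (p : MvPolynomial (Fin N) ℂ) :
    toV N r p = Submodule.Quotient.mk (toPol N (kpar (N + 1) r) p) := rfl

theorem toV_surjective : Function.Surjective (toV N r) :=
  (Submodule.mkQ_surjective _).comp (toPol_surjective _)

theorem toV_eq_zero_iff (hr : 0 < r) (p : MvPolynomial (Fin N) ℂ) :
    toV N r p = 0 ↔ p ∈ fIdeal N r := by
  rw [toV_apply, Submodule.Quotient.mk_eq_zero, toPol_mem_Isub_iff hr]

theorem polyHom_smul_toV (q p : MvPolynomial (Fin N) ℂ) :
    polyHom N (kpar (N + 1) r) q • toV N r p = toV N r (q * p) := by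
  rw [toV_apply, ← Submodule.Quotient.mk_smul, polyHom_smul_toPol, toV_apply]

theorem X_smul_toV (φ : Module.Dual ℂ (Hsp (N + 1))) (p : MvPolynomial (Fin N) ℂ) :
    X (N + 1) (kpar (N + 1) r) φ • toV N r p = toV N r (linForm N φ * p) := by
  rw [← polyHom_linForm, polyHom_smul_toV]

theorem W_smul_toV (g : Equiv.Perm (Fin (N + 1))) (p : MvPolynomial (Fin N) ℂ) :
    W (N + 1) (kpar (N + 1) r) g • toV N r p = toV N r (act N g p) := by
  rw [toV_apply, ← Submodule.Quotient.mk_smul, W_smul_toPol, toV_apply]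

theorem Y_smul_toV (v : Hsp (N + 1)) (p : MvPolynomial (Fin N) ℂ) :
    Y (N + 1) (kpar (N + 1) r) v • toV N r p = toV N r (dunklY N (kpar (N + 1) r) v p) := by
  rw [toV_apply, ← Submodule.Quotient.mk_smul, Y_smul_toPol, toV_apply]

/-! ### The Euler element -/

/-- The canonical element of 𝔥* ⊗ 𝔥 does not depend on the presentation of the identity. The
families need not be bases, so the n pairs of symmetric coordinates and vectors y_i may be used as
well. -/
theorem sum_X_mul_Y {k : ℂ} {ι : Type*} [Fintype ι] {n : ℕ} (φ : ι → Module.Dual ℂ (Hsp n))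
    (v : ι → Hsp n) (h : ∀ u, ∑ j, φ j u • v j = u) :
    ∑ i, X n k ((Module.finBasis ℂ (Hsp n)).coord i) * Y n k (Module.finBasis ℂ (Hsp n) i) =
      ∑ j, X n k (φ j) * Y n k (v j) := by
  set b := Module.finBasis ℂ (Hsp n)
  have hφ : ∀ j, φ j = ∑ i, φ j (b i) • b.coord i := by
    intro j
    refine b.ext fun c => ?_
    rw [LinearMap.sum_apply, Finset.sum_eq_single c]
    · simp
    · intro a _ ha
      simp [ha]
    · simp
  calc _ = ∑ i, ∑ j, φ j (b i) • (X n k (b.coord i) * Y n k (v j)) := by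
        refine Finset.sum_congr rfl fun i _ => ?_
        conv_lhs => rw [← h (b i), map_sum, Finset.mul_sum]
        exact Finset.sum_congr rfl fun j _ => by rw [map_smul, mul_smul_comm]
    _ = _ := by
        rw [Finset.sum_comm]
        refine Finset.sum_congr rfl fun j _ => ?_
        conv_rhs => rw [hφ j, map_sum, Finset.sum_mul]
        exact Finset.sum_congr rfl fun i _ => by rw [map_smul, smul_mul_assoc]

theorem card_reflections : ((reflections (N + 1)).card : ℂ) = (N + 1) * N / 2 := by
  have := sum_reflections (n := N + 1) (fun _ _ => (1 : ℂ)) fun _ _ => rfl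
  simp only [Finset.sum_const, Finset.card_univ, Fintype.card_fin, nsmul_eq_mul, mul_one,
    smul_eq_mul] at this
  push_cast at this
  linear_combination (-1 / 2 : ℂ) * this

theorem der_hBasis (a : Fin N) : der N (hBasis N a) = pderiv a := by
  refine MvPolynomial.derivation_ext fun b => ?_
  rw [der, mkDerivation_X, pderiv_X, Module.Basis.coord_apply, Module.Basis.repr_self,
    Finsupp.single_apply, Pi.single_apply]
  split_ifs with h1 h2 h2
  · simp
  · exact absurd h1.symm h2
  · exact absurd h2.symm h1
  · simp

theorem hBasis_resolution (u : Hsp (N + 1)) : ∑ a, (hBasis N).coord a u • hBasis N a = u :=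
  (hBasis N).sum_repr u

theorem sum_root_smul_X (φ : Module.Dual ℂ (Hsp (N + 1))) :
    ∑ a, φ (hBasis N a) • (MvPolynomial.X a : MvPolynomial (Fin N) ℂ) = linForm N φ := rfl

/-- The weight of the elements of degree `0`. -/
def baseWeight (N r : ℕ) : ℂ := (1 - r) * N / 2

/-- The Dunkl part of ∑ x_a y_a gives d - k ∑ (1 - s), whose reflections cancel those in 𝐡. There
remains d + N/2 - k n(n-1)/2 = d + (1 - r)N/2. -/
theorem euler_smul_toV {p : MvPolynomial (Fin N) ℂ} {d : ℕ} (hp : p.IsHomogeneous d) :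
    euler (N + 1) (kpar (N + 1) r) • toV N r p = ((d : ℂ) + baseWeight N r) • toV N r p := by
  rw [euler, sum_X_mul_Y _ _ hBasis_resolution, sub_smul, add_smul, Finset.sum_smul,
    Finset.sum_smul, algebraMap_smul]
  simp only [mul_smul, Y_smul_toV, X_smul_toV, smul_assoc, W_smul_toV]
  simp only [← map_smul, ← map_sum, ← map_add, ← map_sub]
  congr 1
  set k := kpar (N + 1) r with hk
  have h1 : ∑ a, linForm N ((hBasis N).coord a) * dunklY N k (hBasis N a) p =
      (d : ℂ) • p - ∑ q ∈ reflections (N + 1), k • (p - act N (Equiv.swap q.1 q.2) p) := by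
    simp only [dunklY_apply, mul_sub, Finset.sum_sub_distrib, Finset.mul_sum, linForm_coord,
      der_hBasis]
    rw [hp.sum_X_mul_pderiv, Finset.sum_comm, ← Nat.cast_smul_eq_nsmul ℂ]
    congr 1
    refine Finset.sum_congr rfl fun q _ => ?_
    rw [← mul_divDiff, ← sum_root_smul_X, Finset.sum_mul, Finset.smul_sum]
    refine Finset.sum_congr rfl fun a _ => ?_
    rw [mul_smul_comm, smul_mul_assoc, smul_smul]
  rw [h1]
  simp only [smul_sub, Finset.sum_sub_distrib, Finset.sum_const]
  have h2 : (reflections (N + 1)).card • k • p = (r * N / 2 : ℂ) • p := by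
    rw [← Nat.cast_smul_eq_nsmul ℂ, smul_smul, card_reflections, hk, kpar]
    congr 1
    have : (N : ℂ) + 1 ≠ 0 := by exact_mod_cast N.succ_ne_zero
    push_cast
    field_simp
  rw [h2]
  have h3 : ((d : ℂ) + baseWeight N r) • p =
      (d : ℂ) • p - (r * N / 2 : ℂ) • p + ((((N + 1 : ℕ) : ℂ) - 1) / 2) • p := by
    rw [← sub_smul, ← add_smul, baseWeight]
    congr 1
    push_cast
    ring
  rw [h3]
  simp only [map_smul]
  abel

end Cherednik
end

noncomputable section

open MvPolynomial

namespace Cherednik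

variable {N r : ℕ}

/-! ### Degrees -/

theorem divDiff_isHomogeneous {i j : Fin (N + 1)} {p : MvPolynomial (Fin N) ℂ} {d : ℕ}
    (hp : p.IsHomogeneous (d + 1)) : (divDiff N i j p).IsHomogeneous d := by
  by_cases h : i = j
  · rw [h, divDiff_self]
    exact isHomogeneous_zero _ _ _
  · have : divDiff N i j p = homogeneousComponent d (divDiff N i j p) := by
      rw [divDiff_eq_iff h]
      have h1 := GradedRegular.homogeneousComponent_mul
        (linForm_isHomogeneous (root (N + 1) i j)) (divDiff N i j p) (d + 1)
      rw [if_pos (by omega), Nat.add_sub_cancel, mul_divDiff,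
        GradedRegular.homogeneousComponent_of_isHomogeneous
          (hp.sub (act_isHomogeneous _ hp)), if_pos rfl] at h1
      exact h1.symm
    rw [this]
    exact homogeneousComponent_isHomogeneous _ _

theorem dunklY_isHomogeneous (k : ℂ) (v : Hsp (N + 1)) {p : MvPolynomial (Fin N) ℂ} {d : ℕ}
    (hp : p.IsHomogeneous (d + 1)) : (dunklY N k v p).IsHomogeneous d := by
  rw [dunklY_apply]
  refine IsHomogeneous.sub ?_ (Submodule.sum_mem (homogeneousSubmodule _ _ d) fun q _ =>
    Submodule.smul_mem _ _ (divDiff_isHomogeneous hp))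
  have : ∀ u : Hsp (N + 1), (der N u p).IsHomogeneous d := by
    intro u
    rw [← hBasis_resolution u]
    have hsum : der N (∑ a, (hBasis N).coord a u • hBasis N a) p =
        ∑ a, (hBasis N).coord a u • der N (hBasis N a) p := by
      let L : Hsp (N + 1) →ₗ[ℂ] MvPolynomial (Fin N) ℂ :=
        { toFun := fun w => der N w p
          map_add' := fun _ _ => der_add _ _ _
          map_smul' := fun _ _ => der_smul _ _ _ }
      change L _ = ∑ a, _ • L _
      rw [map_sum]
      simp only [map_smul]
    rw [hsum]
    refine Submodule.sum_mem (homogeneousSubmodule _ _ d) fun a _ => Submodule.smul_mem _ _ ?_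
    rw [der_hBasis]
    exact hp.pderiv
  exact this v

theorem dunklY_eq_zero (k : ℂ) (v : Hsp (N + 1)) {p : MvPolynomial (Fin N) ℂ}
    (hp : p.IsHomogeneous 0) : dunklY N k v p = 0 := by
  rw [← totalDegree_zero_iff_isHomogeneous, totalDegree_eq_zero_iff_eq_C] at hp
  rw [dunklY_apply, hp, ← algebraMap_eq, Derivation.map_algebraMap, algebraMap_eq]
  simp only [divDiff_C, smul_zero, Finset.sum_const_zero, sub_zero]

/-! ### The `sl₂`-triple -/

/-- The element `∑ y_i²`. -/
def sumY (n : ℕ) (k : ℂ) : Alg n k := ∑ i, Y n k (yvec n i) * Y n k (yvec n i)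

/-- The element `∑ x_i²`. -/
def sumX (n : ℕ) (k : ℂ) : Alg n k := ∑ i, X n k (xfun n i) * X n k (xfun n i)

theorem sum_root_yvec {n : ℕ} (i j : Fin n) :
    ∑ l, root n i j (yvec n l) • yvec n l = coroot n i j := by
  simp only [root_yvec, sub_smul, Finset.sum_sub_distrib, coroot, ite_smul, one_smul, zero_smul,
    Finset.sum_ite_eq, Finset.mem_univ, if_true]

theorem Y_coroot_mul_swap {n : ℕ} {k : ℂ} (i j : Fin n) :
    Y n k (coroot n i j) * W n k (Equiv.swap i j) + W n k (Equiv.swap i j) * Y n k (coroot n i j)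
      = 0 := by
  rw [W_mul_Y, reflRep_coroot, Equiv.swap_apply_left, Equiv.swap_apply_right, coroot_swap j i,
    map_neg, neg_mul, add_neg_cancel]

/-- In [∑ y_i², x] the reflection terms assemble into Y_{α^∨} s_α + s_α Y_{α^∨}, and s_α
anticommutes with its coroot. So k disappears from the commutator. -/
theorem sumY_mul_X {n : ℕ} {k : ℂ} (φ : Module.Dual ℂ (Hsp n)) :
    sumY n k * X n k φ - X n k φ * sumY n k =
      (2 : ℂ) • Y n k (∑ i, φ (yvec n i) • yvec n i) := by
  have h1 : ∀ i, Y n k (yvec n i) * Y n k (yvec n i) * X n k φ -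
      X n k φ * (Y n k (yvec n i) * Y n k (yvec n i)) =
      (2 : ℂ) • φ (yvec n i) • Y n k (yvec n i) - ∑ p ∈ reflections n,
        (k * φ (coroot n p.1 p.2)) • root n p.1 p.2 (yvec n i) •
          (Y n k (yvec n i) * W n k (Equiv.swap p.1 p.2) +
            W n k (Equiv.swap p.1 p.2) * Y n k (yvec n i)) := by
    intro i
    have h2 := Y_mul_X (k := k) (yvec n i) φ
    have h3 : Y n k (yvec n i) * Y n k (yvec n i) * X n k φ -
      X n k φ * (Y n k (yvec n i) * Y n k (yvec n i)) =
      Y n k (yvec n i) * (Y n k (yvec n i) * X n k φ - X n k φ * Y n k (yvec n i)) +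
      (Y n k (yvec n i) * X n k φ - X n k φ * Y n k (yvec n i)) * Y n k (yvec n i) := by
      noncomm_ring
    rw [h3, h2, mul_sub, sub_mul, ← Algebra.commutes, Finset.mul_sum, Finset.sum_mul,
      sub_add_sub_comm, ← Finset.sum_add_distrib, Algebra.algebraMap_eq_smul_one, smul_mul_assoc,
      one_mul, two_smul]
    congr 1
    refine Finset.sum_congr rfl fun p _ => ?_
    rw [mul_smul_comm, smul_mul_assoc, ← smul_add, smul_smul]
    congr 1
    ring
  have hc : ∀ p : Fin n × Fin n, ∑ i, root n p.1 p.2 (yvec n i) •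
          (Y n k (yvec n i) * W n k (Equiv.swap p.1 p.2) +
            W n k (Equiv.swap p.1 p.2) * Y n k (yvec n i)) = 0 := by
    intro p
    rw [← Y_coroot_mul_swap p.1 p.2, ← sum_root_yvec, map_sum, Finset.sum_mul, Finset.mul_sum,
      ← Finset.sum_add_distrib]
    refine Finset.sum_congr rfl fun i _ => ?_
    rw [map_smul, smul_mul_assoc, mul_smul_comm, smul_add]
  rw [sumY, Finset.sum_mul, Finset.mul_sum, ← Finset.sum_sub_distrib,
    Finset.sum_congr rfl fun i _ => h1 i, Finset.sum_sub_distrib]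
  have h2 : ∑ i, ∑ p ∈ reflections n, (k * φ (coroot n p.1 p.2)) •
      root n p.1 p.2 (yvec n i) • (Y n k (yvec n i) * W n k (Equiv.swap p.1 p.2) +
        W n k (Equiv.swap p.1 p.2) * Y n k (yvec n i)) = 0 := by
    rw [Finset.sum_comm]
    refine Finset.sum_eq_zero fun p _ => ?_
    rw [← Finset.smul_sum, hc p, smul_zero]
  rw [h2]
  simp only [sub_zero, map_sum, map_smul, Finset.smul_sum]

theorem sum_xfun_yvec (i : Fin (N + 1)) :
    ∑ l, xfun (N + 1) i (yvec (N + 1) l) • yvec (N + 1) l = yvec (N + 1) i := by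
  simp only [xfun_yvec, sub_smul, Finset.sum_sub_distrib, ite_smul, one_smul, zero_smul,
    Finset.sum_ite_eq, Finset.mem_univ, if_true]
  rw [← Finset.smul_sum, sum_yvec, smul_zero, sub_zero]

theorem xfun_resolution (u : Hsp (N + 1)) :
    ∑ i, xfun (N + 1) i u • yvec (N + 1) i = u := by
  have : ∑ i, (xfun (N + 1) i).smulRight (yvec (N + 1) i) = LinearMap.id := by
    refine hom_ext_yvec fun l => ?_
    simp only [LinearMap.sum_apply, LinearMap.smulRight_apply, xfun_yvec, sub_smul,
      Finset.sum_sub_distrib, ite_smul, one_smul, zero_smul, Finset.sum_ite_eq', Finset.mem_univ,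
      if_true, LinearMap.id_apply]
    rw [← Finset.smul_sum, sum_yvec, smul_zero, sub_zero]
  have := LinearMap.congr_fun this u
  simpa [LinearMap.sum_apply] using this

/-- Each commutator contributes 4 x_i y_i + 2 [y_i, x_i], and ∑ [y_i, x_i] = N - 2k ∑ s_{ij}. The
constants of 𝐡 are exactly those needed here. -/
theorem sumY_mul_sumX (k : ℂ) :
    sumY (N + 1) k * sumX (N + 1) k - sumX (N + 1) k * sumY (N + 1) k =
      (4 : ℂ) • euler (N + 1) k := by
  have h1 : ∀ i : Fin (N + 1), sumY (N + 1) k * (X (N + 1) k (xfun _ i) * X (N + 1) k (xfun _ i)) -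
      (X (N + 1) k (xfun _ i) * X (N + 1) k (xfun _ i)) * sumY (N + 1) k =
      (4 : ℂ) • (X (N + 1) k (xfun _ i) * Y (N + 1) k (yvec _ i)) +
      (2 : ℂ) • (Y (N + 1) k (yvec _ i) * X (N + 1) k (xfun _ i) -
        X (N + 1) k (xfun _ i) * Y (N + 1) k (yvec _ i)) := by
    intro i
    have h2 := sumY_mul_X (k := k) (xfun (N + 1) i)
    rw [sum_xfun_yvec] at h2
    have h3 : ∀ F x : Alg (N + 1) k, F * (x * x) - (x * x) * F =
        (F * x - x * F) * x + x * (F * x - x * F) := by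
      intro F x
      noncomm_ring
    rw [h3, h2, smul_mul_assoc, mul_smul_comm, smul_sub, show (4 : ℂ) = 2 + 2 by norm_num,
      add_smul]
    abel
  have h4 : ∑ i : Fin (N + 1), (Y (N + 1) k (yvec _ i) * X (N + 1) k (xfun _ i) -
        X (N + 1) k (xfun _ i) * Y (N + 1) k (yvec _ i)) =
      algebraMap ℂ _ (N : ℂ) - (2 : ℂ) • ∑ p ∈ reflections (N + 1),
        k • W (N + 1) k (Equiv.swap p.1 p.2) := by
    simp only [Y_mul_X, Finset.sum_sub_distrib]
    congr 1
    · rw [← map_sum]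
      congr 1
      simp only [xfun_yvec, if_true, Finset.sum_const, Finset.card_univ, Fintype.card_fin,
        nsmul_eq_mul]
      have : ((N + 1 : ℕ) : ℂ) ≠ 0 := by exact_mod_cast N.succ_ne_zero
      field_simp
      push_cast
      ring
    · rw [Finset.sum_comm, Finset.smul_sum]
      refine Finset.sum_congr rfl fun p hp => ?_
      have hne : p.1 ≠ p.2 := by
        simp only [reflections, Finset.mem_filter] at hp
        exact hp.2.ne
      rw [← Finset.sum_smul, smul_smul]
      congr 1
      simp only [mul_assoc]
      rw [← Finset.mul_sum, mul_comm (2 : ℂ)]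
      congr 1
      calc ∑ i, root (N + 1) p.1 p.2 (yvec _ i) * xfun (N + 1) i (coroot _ p.1 p.2)
          = root (N + 1) p.1 p.2 (∑ i, xfun (N + 1) i (coroot _ p.1 p.2) • yvec _ i) := by
            simp only [map_sum, map_smul, smul_eq_mul]
            exact Finset.sum_congr rfl fun i _ => mul_comm _ _
        _ = 2 := by rw [xfun_resolution, root_coroot hne]
  rw [sumX, Finset.mul_sum, Finset.sum_mul, ← Finset.sum_sub_distrib,
    Finset.sum_congr rfl fun i _ => h1 i, Finset.sum_add_distrib, ← Finset.smul_sum,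
    ← Finset.smul_sum, h4, euler, sum_X_mul_Y _ _ xfun_resolution, smul_sub, smul_sub, smul_add,
    smul_smul]
  have h5 : (2 : ℂ) • algebraMap ℂ (Alg (N + 1) k) (N : ℂ) =
      (4 : ℂ) • algebraMap ℂ (Alg (N + 1) k) ((((N + 1 : ℕ) : ℂ) - 1) / 2) := by
    rw [Algebra.algebraMap_eq_smul_one, Algebra.algebraMap_eq_smul_one, smul_smul, smul_smul]
    congr 1
    push_cast
    ring
  rw [h5]
  norm_num
  abel

/-- The usual formula E F^(m+1) v = (m+1)(μ - m) F^m v, read at the last m with F^m v ≠ 0, forces μ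
= m. The commutation relation is only required along the orbit of v. -/
theorem exists_eq_of_sl2 {V : Type*} [AddCommGroup V] [Module ℂ V] (E F : Module.End ℂ V) {v : V}
    {μ : ℂ} (hv : v ≠ 0) (hE : E v = 0)
    (h : ∀ m : ℕ, E (F ((F ^ m) v)) - F (E ((F ^ m) v)) = (μ - 2 * m) • (F ^ m) v)
    (hK : ∃ K, (F ^ K) v = 0) : ∃ m : ℕ, (F ^ m) v ≠ 0 ∧ μ = m := by
  have key : ∀ m : ℕ, E ((F ^ (m + 1)) v) = (((m : ℂ) + 1) * (μ - m)) • (F ^ m) v := by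
    intro m
    induction m with
    | zero =>
      have := h 0
      simp only [pow_zero, Module.End.one_apply, hE, map_zero, sub_zero] at this
      simpa using this
    | succ m ih =>
      have h1 := h (m + 1)
      rw [ih, map_smul] at h1
      rw [pow_succ', Module.End.mul_apply, sub_eq_iff_eq_add.1 h1, ← Module.End.mul_apply,
        ← pow_succ', ← add_smul]
      congr 1
      push_cast
      ring
  classical
  have h0 := Nat.find_spec hK
  have h1 : Nat.find hK ≠ 0 := fun h2 => by
    rw [h2, pow_zero] at h0
    exact hv h0
  obtain ⟨m, hm⟩ := Nat.exists_eq_succ_of_ne_zero h1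
  have h3 : (F ^ m) v ≠ 0 := Nat.find_min hK (by omega)
  refine ⟨m, h3, ?_⟩
  have h4 := key m
  rw [← Nat.succ_eq_add_one, ← hm, h0, map_zero] at h4
  have h5 := (smul_eq_zero.1 h4.symm).resolve_right h3
  have h6 : (m : ℂ) + 1 ≠ 0 := by exact_mod_cast m.succ_ne_zero
  exact sub_eq_zero.1 ((mul_eq_zero.1 h5).resolve_left h6)

/-! ### Irreducibility -/

/-- The image in `V_k` of the homogeneous polynomials of degree `d`. -/
def degV (N r d : ℕ) : Submodule ℂ (Vmod (N + 1) r) :=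
  (homogeneousSubmodule (Fin N) ℂ d).map (toV N r)

theorem euler_smul_degV {d : ℕ} {v : Vmod (N + 1) r} (hv : v ∈ degV N r d) :
    euler (N + 1) (kpar (N + 1) r) • v = ((d : ℂ) + baseWeight N r) • v := by
  obtain ⟨p, hp, rfl⟩ := hv
  exact euler_smul_toV hp

theorem sumX_smul_degV {d : ℕ} {v : Vmod (N + 1) r} (hv : v ∈ degV N r d) :
    sumX (N + 1) (kpar (N + 1) r) • v ∈ degV N r (d + 2) := by
  obtain ⟨p, hp, rfl⟩ := hv
  rw [sumX, Finset.sum_smul]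
  refine Submodule.sum_mem _ fun i _ => ?_
  rw [mul_smul, X_smul_toV, X_smul_toV]
  refine ⟨_, ?_, rfl⟩
  have := (linForm_isHomogeneous (xfun (N + 1) i)).mul
    ((linForm_isHomogeneous (xfun (N + 1) i)).mul hp)
  rwa [show 1 + (1 + d) = d + 2 by ring] at this

theorem sumY_smul_degV {d : ℕ} {v : Vmod (N + 1) r} (hv : v ∈ degV N r (d + 2)) :
    sumY (N + 1) (kpar (N + 1) r) • v ∈ degV N r d := by
  obtain ⟨p, hp, rfl⟩ := hv
  rw [sumY, Finset.sum_smul]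
  refine Submodule.sum_mem _ fun i _ => ?_
  rw [mul_smul, Y_smul_toV, Y_smul_toV]
  exact ⟨_, dunklY_isHomogeneous _ _ (dunklY_isHomogeneous _ _ hp), rfl⟩

theorem sumY_smul_eq_zero {d : ℕ} (hd : d < 2) {v : Vmod (N + 1) r} (hv : v ∈ degV N r d) :
    sumY (N + 1) (kpar (N + 1) r) • v = 0 := by
  obtain ⟨p, hp, rfl⟩ := hv
  rw [sumY, Finset.sum_smul]
  refine Finset.sum_eq_zero fun i _ => ?_
  rw [mul_smul, Y_smul_toV, Y_smul_toV]
  interval_cases d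
  · rw [dunklY_eq_zero _ _ hp, map_zero, map_zero]
  · rw [dunklY_eq_zero _ _ (dunklY_isHomogeneous _ _ hp), map_zero]

theorem exists_top_degree (hr : 0 < r) (hrn : Nat.gcd r (N + 1) = 1) :
    ∃ (D : ℕ) (s : Vmod (N + 1) r), s ∈ degV N r D ∧ s ≠ 0 ∧
      (∀ v : Vmod (N + 1) r, v ≠ 0 → ∃ a : Alg (N + 1) (kpar (N + 1) r), a • v = s) ∧
      ∀ d, D < d → degV N r d = ⊥ := by
  obtain ⟨D, s, h1, h2, h3, h4⟩ := (flagSystem_fA (N := N) hr hrn).exists_homogeneous_socle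
  refine ⟨D, toV N r s, ⟨s, h1, rfl⟩, fun h => h2 ((toV_eq_zero_iff hr s).1 h), fun v hv => ?_,
    fun d hd => ?_⟩
  · obtain ⟨p, rfl⟩ := toV_surjective v
    obtain ⟨q, hq⟩ := h3 p fun h => hv ((toV_eq_zero_iff hr p).2 h)
    refine ⟨polyHom N _ q, ?_⟩
    rw [polyHom_smul_toV, ← sub_eq_zero, ← map_sub]
    exact (toV_eq_zero_iff hr _).2 hq
  · rw [eq_bot_iff]
    rintro _ ⟨p, hp, rfl⟩
    exact (toV_eq_zero_iff hr p).2 (h4 p d hd hp)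

/-- The action of an element of `H_k(n)` on `V_k`. -/
abbrev opV (N r : ℕ) (a : Alg (N + 1) (kpar (N + 1) r)) : Module.End ℂ (Vmod (N + 1) r) :=
  Algebra.lsmul ℂ ℂ (Vmod (N + 1) r) a

/-- Every nonzero submodule contains the socle vector s, so it suffices to reach 1 from s. Repeated
application of ∑ y_i² to s does so, by the sl₂ argument applied at both ends of the grading. -/
theorem isSimpleModule_Vmod (hr : 0 < r) (hrn : Nat.gcd r (N + 1) = 1) :
    IsSimpleModule (Alg (N + 1) (kpar (N + 1) r)) (Vmod (N + 1) r) := by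
  obtain ⟨D, s, hsD, hs0, hs, hD⟩ := exists_top_degree (N := N) hr hrn
  set k := kpar (N + 1) r with hk
  set c := baseWeight N r with hc
  have hone : toV N r 1 ≠ 0 := by
    intro h
    obtain ⟨p, rfl⟩ := toV_surjective s
    apply hs0
    rw [← mul_one p, ← polyHom_smul_toV, h, smul_zero]
  have hone0 : toV N r 1 ∈ degV N r 0 := ⟨1, isHomogeneous_one _ _, rfl⟩
  -- The factor -1/4 normalises the commutator [Ex, Fy] to 𝐡.
  let Ex : Module.End ℂ (Vmod (N + 1) r) := opV N r ((-1 / 4 : ℂ) • sumX (N + 1) k)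
  let Fy : Module.End ℂ (Vmod (N + 1) r) := opV N r (sumY (N + 1) k)
  have hEx : ∀ v, Ex v = (-1 / 4 : ℂ) • sumX (N + 1) k • v := fun v => smul_assoc _ _ _
  have hFy : ∀ v, Fy v = sumY (N + 1) k • v := fun v => rfl
  have hcomm : ∀ v, Ex (Fy v) - Fy (Ex v) = euler (N + 1) k • v := by
    intro v
    have h := congrArg (fun a => a • v) (sumY_mul_sumX (N := N) k)
    simp only [sub_smul, mul_smul, smul_assoc] at h
    rw [hEx, hFy, hFy, hEx, smul_comm (sumY (N + 1) k), ← smul_sub, ← neg_sub, h, smul_neg,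
      smul_smul, ← neg_smul]
    norm_num
  have hExdeg : ∀ {d v}, v ∈ degV N r d → Ex v ∈ degV N r (d + 2) := fun {d v} hv => by
    rw [hEx]
    exact Submodule.smul_mem _ _ (sumX_smul_degV hv)
  have hFpow : ∀ m, (2 * m ≤ D ∧ (Fy ^ m) s ∈ degV N r (D - 2 * m)) ∨ (Fy ^ m) s = 0 := by
    intro m
    induction m with
    | zero => exact Or.inl ⟨by omega, by simpa using hsD⟩
    | succ m ih =>
      rw [pow_succ', Module.End.mul_apply]
      rcases ih with ⟨h1, h2⟩ | h0
      · by_cases h3 : 2 * (m + 1) ≤ D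
        · refine Or.inl ⟨h3, sumY_smul_degV ?_⟩
          rwa [show D - 2 * (m + 1) + 2 = D - 2 * m by omega]
        · exact Or.inr (sumY_smul_eq_zero (by omega) h2)
      · exact Or.inr (by rw [h0, map_zero])
  have hEpow : ∀ m, (Ex ^ m) (toV N r 1) ∈ degV N r (2 * m) := by
    intro m
    induction m with
    | zero => simpa using hone0
    | succ m ih =>
      rw [pow_succ', Module.End.mul_apply]
      exact hExdeg ih
  have hzero : ∀ {d v}, D < d → v ∈ degV N r d → v = 0 := fun hd hv => by
    rw [hD _ hd] at hv
    exact (Submodule.mem_bot ℂ).1 hv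
  -- The vector s is killed by Ex because degree D + 2 is zero, and its weight is D + c; Fy lowers
  -- degrees, hence weights, by 2.
  obtain ⟨m, hm1, hm2⟩ := exists_eq_of_sl2 Ex Fy (v := s) (μ := D + c) hs0
    (hzero (by omega) (hExdeg hsD)) (fun m => by
      rw [hcomm]
      rcases hFpow m with ⟨h1, h2⟩ | h0
      · rw [euler_smul_degV h2]
        congr 1
        push_cast [h1]
        ring
      · rw [h0, smul_zero, smul_zero])
    ⟨D + 1, (hFpow (D + 1)).resolve_left fun h => by omega⟩
  -- The same from the bottom, with the roles of Ex and Fy exchanged: 1 is killed by Fy, and the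
  -- sign of the commutator turns its weight c into -c.
  obtain ⟨m', hm1', hm2'⟩ := exists_eq_of_sl2 Fy Ex (v := toV N r 1) (μ := -c) hone
    (sumY_smul_eq_zero (by omega) hone0) (fun m => by
      rw [← neg_sub, hcomm, euler_smul_degV (hEpow m), ← neg_smul]
      congr 1
      push_cast
      ring)
    ⟨D + 1, hzero (by omega) (hEpow (D + 1))⟩
  have hm'D : 2 * m' ≤ D := by
    by_contra h
    exact hm1' (hzero (by omega) (hEpow m'))
  have hDm : D = m + m' := by
    have : (D : ℂ) = m + m' := by rw [← hm2, ← hm2']; ring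
    exact_mod_cast this
  -- The two weights give D = m + m'. Nonvanishing of Ex^m' · 1 gives 2m' ≤ D and that of Fy^m s
  -- gives 2m ≤ D, so m = m' and the degree D - 2m is zero.
  have hlast : (Fy ^ m) s ∈ degV N r 0 := by
    rcases hFpow m with ⟨h1, h2⟩ | h0
    · rwa [show D - 2 * m = 0 by omega] at h2
    · exact absurd h0 hm1
  have hpowmem : ∀ (J : Submodule (Alg (N + 1) k) (Vmod (N + 1) r)), s ∈ J →
      ∀ m, (Fy ^ m) s ∈ J := by
    intro J hJ m
    induction m with
    | zero => simpa using hJ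
    | succ m ih =>
      rw [pow_succ', Module.End.mul_apply]
      exact J.smul_mem _ ih
  have : Nontrivial (Vmod (N + 1) r) := ⟨⟨_, _, hone⟩⟩
  rw [isSimpleModule_iff]
  refine ⟨fun J => ?_⟩
  by_cases hJ : J = ⊥
  · exact Or.inl hJ
  right
  obtain ⟨v, hvJ, hv0⟩ := (Submodule.ne_bot_iff J).1 hJ
  obtain ⟨a, rfl⟩ := hs v hv0
  have h1 := hpowmem J (J.smul_mem a hvJ) m
  obtain ⟨p, hp, hpv⟩ := hlast
  have hpC : p = C (coeff 0 p) := by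
    have hp' : p.IsHomogeneous 0 := hp
    rwa [← totalDegree_zero_iff_isHomogeneous, totalDegree_eq_zero_iff_eq_C] at hp'
  have hc0 : coeff 0 p ≠ 0 := by
    intro h
    rw [h, C_0] at hpC
    rw [← hpv, hpC, map_zero] at hm1
    exact hm1 rfl
  rw [← hpv] at h1
  have h2 : toV N r 1 ∈ J := by
    have := J.smul_mem (polyHom N k (C (coeff 0 p)⁻¹)) h1
    rwa [polyHom_smul_toV, hpC, coeff_C, if_pos rfl, ← C_mul, inv_mul_cancel₀ hc0, C_1] at this
  rw [eq_top_iff]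
  rintro w -
  obtain ⟨q, rfl⟩ := toV_surjective w
  rw [← mul_one q, ← polyHom_smul_toV]
  exact J.smul_mem _ h2

end Cherednik
end

/-! ### Eigenspaces, traces and determinants of diagonal operators -/

noncomputable section

namespace Module.Basis

variable {ι V : Type*} [AddCommGroup V] [Module ℂ V] (b : Module.Basis ι ℂ V)
  {T : Module.End ℂ V} {c : ι → ℂ}

theorem repr_apply_of_diagonal (hT : ∀ i, T (b i) = c i • b i) (x : V) (i : ι) :
    b.repr (T x) i = c i * b.repr x i := by
  have : (b.coord i).comp T = c i • b.coord i := by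
    classical
    refine b.ext fun j => ?_
    simp only [LinearMap.comp_apply, hT, map_smul, LinearMap.smul_apply, coord_apply, repr_self,
      smul_eq_mul, Finsupp.single_apply]
    split_ifs with h
    · rw [h]
    · simp
  exact LinearMap.congr_fun this x

theorem repr_pow_apply_of_diagonal (hT : ∀ i, T (b i) = c i • b i) (m : ℕ) (x : V) (i : ι) :
    b.repr ((T ^ m) x) i = c i ^ m * b.repr x i := by
  induction m with
  | zero => simp
  | succ m ih =>
    rw [pow_succ', Module.End.mul_apply, b.repr_apply_of_diagonal hT, ih, pow_succ', mul_assoc]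

theorem mem_span_image_of_repr (s : Set ι) {x : V} (h : ∀ i, b.repr x i ≠ 0 → i ∈ s) :
    x ∈ Submodule.span ℂ (b '' s) :=
  (b.mem_span_image).2 fun i hi => h i (Finsupp.mem_support_iff.1 hi)

theorem maxGenEigenspace_of_diagonal (hT : ∀ i, T (b i) = c i • b i) (μ : ℂ) :
    T.maxGenEigenspace μ = Submodule.span ℂ (b '' {i | c i = μ}) := by
  apply le_antisymm
  · intro x hx
    obtain ⟨m, hm⟩ := (Module.End.mem_maxGenEigenspace _ _ _).1 hx
    refine b.mem_span_image_of_repr _ fun i hi => ?_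
    have hd : ∀ i, (T - μ • (1 : Module.End ℂ V)) (b i) = (c i - μ) • b i := fun i => by
      rw [LinearMap.sub_apply, hT, LinearMap.smul_apply, Module.End.one_apply, sub_smul]
    have h := b.repr_pow_apply_of_diagonal hd m x i
    rw [hm, map_zero, Finsupp.zero_apply] at h
    have := (mul_eq_zero.1 h.symm).resolve_right hi
    exact sub_eq_zero.1 (eq_zero_of_pow_eq_zero this)
  · rw [Submodule.span_le]
    rintro _ ⟨i, hi, rfl⟩
    refine (Module.End.mem_maxGenEigenspace _ _ _).2 ⟨1, ?_⟩
    rw [pow_one, LinearMap.sub_apply, hT, LinearMap.smul_apply, Module.End.one_apply, ← sub_smul,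
      show c i - μ = 0 from sub_eq_zero.2 hi, zero_smul]

theorem trace_restrict_of_diagonal (hT : ∀ i, T (b i) = c i • b i) (F : Finset ι)
    {S : Submodule ℂ V} (hS : S = Submodule.span ℂ (b '' F)) (h : Set.MapsTo T S S) :
    LinearMap.trace ℂ S (T.restrict h) = ∑ i ∈ F, c i := by
  classical
  subst hS
  have hli : LinearIndependent ℂ fun i : F => b i := b.linearIndependent.comp _ Subtype.val_injective
  have hr : Submodule.span ℂ (b '' F) = Submodule.span ℂ (Set.range fun i : F => b i) := by
    congr 1
    ext; simp
  let B := (Module.Basis.span hli).map (LinearEquiv.ofEq _ _ hr.symm)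
  have hB : ∀ i, ((B i : Submodule.span ℂ (b '' F)) : V) = b i := fun i => by
    simp [B, Module.Basis.span_apply]
  have hTB : ∀ i, T.restrict h (B i) = c i • B i := fun i => by
    apply Subtype.ext
    rw [Submodule.coe_smul, hB]
    exact (congrArg T (hB i)).trans (hT i)
  rw [LinearMap.trace_eq_matrix_trace ℂ B, Matrix.trace]
  simp only [Matrix.diag_apply, LinearMap.toMatrix_apply, hTB, map_smul, Finsupp.smul_apply,
    repr_self, Finsupp.single_eq_same, smul_eq_mul, mul_one]
  exact Finset.sum_coe_sort F c

theorem det_one_sub_smul_of_diagonal [Fintype ι] (hT : ∀ i, T (b i) = c i • b i) (s : ℂ) :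
    LinearMap.det (1 - s • T) = ∏ i, (1 - s * c i) := by
  classical
  rw [← LinearMap.det_toMatrix b]
  have : LinearMap.toMatrix b b (1 - s • T) = Matrix.diagonal fun i => 1 - s * c i := by
    ext i j
    rw [LinearMap.toMatrix_apply, LinearMap.sub_apply, Module.End.one_apply, LinearMap.smul_apply,
      hT, smul_smul, map_sub, map_smul, Finsupp.sub_apply, Finsupp.smul_apply, repr_self,
      Matrix.diagonal_apply, Finsupp.single_apply]
    by_cases h : i = j
    · simp [h]
    · simp [h, Ne.symm h]
  rw [this, Matrix.det_diagonal]

end Module.Basis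

/-- Over ℂ the polynomial X^m - 1 is separable, so T is semisimple and its eigenvectors span. -/
theorem Module.End.exists_basis_of_pow_eq_one {V : Type*} [AddCommGroup V] [Module ℂ V]
    [FiniteDimensional ℂ V] {N : ℕ} (hN : Module.finrank ℂ V = N) (T : Module.End ℂ V) {m : ℕ}
    (hm : 0 < m) (hT : T ^ m = 1) :
    ∃ (b : Module.Basis (Fin N) ℂ V) (c : Fin N → ℂ), (∀ i, T (b i) = c i • b i) ∧
      ∀ i, c i ^ m = 1 := by
  have hss : T.IsSemisimple := by
    refine Module.End.isSemisimple_of_squarefree_aeval_eq_zero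
      (p := (Polynomial.X ^ m - Polynomial.C 1 : Polynomial ℂ)) ?_ (by simp [hT])
    exact (Polynomial.separable_X_pow_sub_C 1 (by exact_mod_cast hm.ne') one_ne_zero).squarefree
  let s : Set V := {v | ∃ μ : ℂ, T v = μ • v}
  have hs : ⊤ ≤ Submodule.span ℂ s := by
    rw [← hss.iSup_eigenspace_eq_top]
    refine iSup_le fun μ v hv => Submodule.subset_span ⟨μ, Module.End.mem_eigenspace_iff.1 hv⟩
  let b₀ := Module.Basis.ofSpan hs
  have := Module.Finite.finite_basis b₀
  have := Fintype.ofFinite ((linearIndepOn_empty ℂ id).extend (Set.empty_subset s))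
  have hc := Module.finrank_eq_card_basis b₀
  let b := b₀.reindex (Fintype.equivFinOfCardEq (hc.symm.trans hN))
  have hb : ∀ i, ∃ μ : ℂ, T (b i) = μ • b i := fun i => by
    rw [Module.Basis.reindex_apply]
    exact Module.Basis.ofSpan_subset hs ⟨_, rfl⟩
  choose c hc using hb
  refine ⟨b, c, hc, fun i => ?_⟩
  have h := b.repr_pow_apply_of_diagonal hc m (b i) i
  rw [hT, Module.End.one_apply, Module.Basis.repr_self, Finsupp.single_eq_same, mul_one] at h
  exact h.symm

end

/-! ### Homogeneous eigenbases, linear substitutions and products of geometric series -/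

noncomputable section

open MvPolynomial

section Graded

variable {N : ℕ} {ι : Type*} {b : Module.Basis ι ℂ (MvPolynomial (Fin N) ℂ)} {δ : ι → ℕ}

theorem homogeneousSubmodule_eq_span_basis (hb : ∀ i, (b i).IsHomogeneous (δ i)) (d : ℕ) :
    homogeneousSubmodule (Fin N) ℂ d = Submodule.span ℂ (b '' {i | δ i = d}) := by
  apply le_antisymm
  · intro p hp
    have h1 : p = homogeneousComponent d p := by
      rw [GradedRegular.homogeneousComponent_of_isHomogeneous hp, if_pos rfl]
    rw [h1, ← b.linearCombination_repr p, Finsupp.linearCombination_apply, Finsupp.sum, map_sum]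
    refine Submodule.sum_mem _ fun i _ => ?_
    rw [map_smul, GradedRegular.homogeneousComponent_of_isHomogeneous (hb i)]
    refine Submodule.smul_mem _ _ ?_
    split_ifs with h
    · exact Submodule.subset_span ⟨i, h.symm, rfl⟩
    · exact Submodule.zero_mem _
  · rw [Submodule.span_le]
    rintro _ ⟨i, rfl, rfl⟩
    exact hb i

/-- Both sums are the trace of T on the homogeneous polynomials of degree d, computed in two bases.
-/
theorem sum_eigenvalues_eq {κ : Type*} {b' : Module.Basis κ ℂ (MvPolynomial (Fin N) ℂ)}
    {δ' : κ → ℕ} (hb : ∀ i, (b i).IsHomogeneous (δ i)) (hb' : ∀ i, (b' i).IsHomogeneous (δ' i))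
    {T : Module.End ℂ (MvPolynomial (Fin N) ℂ)} {c : ι → ℂ} {c' : κ → ℂ}
    (hT : ∀ i, T (b i) = c i • b i) (hT' : ∀ i, T (b' i) = c' i • b' i) {d : ℕ}
    {F : Finset ι} {F' : Finset κ} (hF : ∀ i, i ∈ F ↔ δ i = d) (hF' : ∀ i, i ∈ F' ↔ δ' i = d) :
    ∑ i ∈ F, c i = ∑ i ∈ F', c' i := by
  have e : homogeneousSubmodule (Fin N) ℂ d = Submodule.span ℂ (b '' F) := by
    rw [homogeneousSubmodule_eq_span_basis hb]
    congr 2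
    ext i
    exact (hF i).symm
  have e' : homogeneousSubmodule (Fin N) ℂ d = Submodule.span ℂ (b' '' F') := by
    rw [homogeneousSubmodule_eq_span_basis hb']
    congr 2
    ext i
    exact (hF' i).symm
  have h : Set.MapsTo T (homogeneousSubmodule (Fin N) ℂ d) (homogeneousSubmodule (Fin N) ℂ d) := by
    intro x hx
    rw [e] at hx ⊢
    refine b.mem_span_image_of_repr _ fun i hi => ?_
    rw [b.repr_apply_of_diagonal hT] at hi
    exact b.mem_span_image.1 hx (Finsupp.mem_support_iff.2 (right_ne_zero_of_mul hi))
  rw [← b.trace_restrict_of_diagonal hT F e h, b'.trace_restrict_of_diagonal hT' F' e' h]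

end Graded

/-- The substitution `X_a ↦ ∑ c, M a c X_c`. -/
def linSubst {N : ℕ} (M : Matrix (Fin N) (Fin N) ℂ) :
    MvPolynomial (Fin N) ℂ →ₐ[ℂ] MvPolynomial (Fin N) ℂ :=
  aeval fun a => ∑ c, M a c • (MvPolynomial.X c : MvPolynomial (Fin N) ℂ)

theorem linSubst_X {N : ℕ} (M : Matrix (Fin N) (Fin N) ℂ) (a : Fin N) :
    linSubst M (.X a) = ∑ c, M a c • (MvPolynomial.X c : MvPolynomial (Fin N) ℂ) := by
  simp [linSubst]

theorem linSubst_linSubst {N : ℕ} (M M' : Matrix (Fin N) (Fin N) ℂ) (p : MvPolynomial (Fin N) ℂ) :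
    linSubst M (linSubst M' p) = linSubst (M' * M) p := by
  suffices (linSubst M).comp (linSubst M') = linSubst (M' * M) from DFunLike.congr_fun this p
  refine MvPolynomial.algHom_ext fun a => ?_
  simp only [AlgHom.comp_apply, linSubst_X, map_sum, map_smul, Matrix.mul_apply, Finset.smul_sum,
    Finset.sum_smul, smul_smul]
  exact Finset.sum_comm

theorem linSubst_one {N : ℕ} (p : MvPolynomial (Fin N) ℂ) : linSubst 1 p = p := by
  suffices linSubst 1 = AlgHom.id ℂ (MvPolynomial (Fin N) ℂ) from DFunLike.congr_fun this p
  refine MvPolynomial.algHom_ext fun a => ?_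
  simp [linSubst_X, Matrix.one_apply]

theorem linSubst_bijective {N : ℕ} {M M' : Matrix (Fin N) (Fin N) ℂ} (h : M * M' = 1) :
    Function.Bijective (linSubst M) := by
  have h' : M' * M = 1 := mul_eq_one_comm.1 h
  refine Function.bijective_iff_has_inverse.2 ⟨linSubst M', fun p => ?_, fun p => ?_⟩
  · rw [linSubst_linSubst, h, linSubst_one]
  · rw [linSubst_linSubst, h', linSubst_one]

section PowerSeries

open PowerSeries

/-- The product of the geometric series with ratios `c_a`. -/
def geomProd {N : ℕ} (c : Fin N → ℂ) : PowerSeries ℂ := ∏ a, PowerSeries.mk fun m => c a ^ m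

theorem coeff_geomProd {N : ℕ} (c : Fin N → ℂ) (d : ℕ) :
    PowerSeries.coeff d (geomProd c) =
      ∑ α ∈ Finset.finsuppAntidiag Finset.univ d, ∏ a, c a ^ α a := by
  rw [geomProd, PowerSeries.coeff_prod]
  simp only [coeff_mk]

theorem geomProd_mul {N : ℕ} (c : Fin N → ℂ) :
    geomProd c * ∏ a, (1 - PowerSeries.C (c a) * PowerSeries.X) = 1 := by
  rw [geomProd, ← Finset.prod_mul_distrib]
  refine Finset.prod_eq_one fun a _ => ?_
  ext m
  rw [mul_sub, mul_one, map_sub, mul_left_comm, PowerSeries.coeff_C_mul]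
  cases m with
  | zero => simp
  | succ m => rw [PowerSeries.coeff_succ_mul_X]; simp [pow_succ', PowerSeries.coeff_one]

theorem expand_geomProd_mul {N r : ℕ} (hr : r ≠ 0) (c : Fin N → ℂ) :
    (geomProd c).expand r hr * ∏ a, (1 - PowerSeries.C (c a) * PowerSeries.X ^ r) = 1 := by
  have h := congrArg (PowerSeries.expand r hr) (geomProd_mul c)
  simpa only [map_mul, map_prod, map_sub, map_one, PowerSeries.expand_C, PowerSeries.expand_X] using h

end PowerSeries

end

/-! ### The graded trace computed in two bases -/

noncomputable section

open MvPolynomial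

theorem PowerSeries.coeff_C_mul_X_pow_mul_expand {r : ℕ} (hr : r ≠ 0) (c : ℂ) (δ d : ℕ)
    (p : PowerSeries ℂ) :
    PowerSeries.coeff d (PowerSeries.C c * PowerSeries.X ^ δ * p.expand r hr) =
      if δ ≤ d ∧ r ∣ d - δ then c * PowerSeries.coeff ((d - δ) / r) p else 0 := by
  rw [mul_assoc, PowerSeries.coeff_C_mul, PowerSeries.coeff_X_pow_mul', PowerSeries.coeff_expand]
  by_cases h1 : δ ≤ d <;> by_cases h2 : r ∣ d - δ <;> simp [h1, h2]

section Substitution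

variable {N : ℕ} {φ : MvPolynomial (Fin N) ℂ →ₐ[ℂ] MvPolynomial (Fin N) ℂ}

theorem MvPolynomial.algHom_monomial_one (α : Fin N →₀ ℕ) :
    φ (monomial α 1) = ∏ a, φ (.X a) ^ α a := by
  rw [monomial_eq, C_1, one_mul, Finsupp.prod_fintype _ _ fun _ => pow_zero _, map_prod]
  simp only [map_pow]

theorem MvPolynomial.algHom_monomial_of_diagonal
    {T : MvPolynomial (Fin N) ℂ →ₐ[ℂ] MvPolynomial (Fin N) ℂ} {c : Fin N → ℂ}
    (h : ∀ a, T (φ (.X a)) = c a • φ (.X a)) (α : Fin N →₀ ℕ) :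
    T (φ (monomial α 1)) = (∏ a, c a ^ α a) • φ (monomial α 1) := by
  rw [algHom_monomial_one, map_prod]
  simp only [map_pow, h, smul_pow, Finset.prod_smul]

theorem MvPolynomial.isHomogeneous_algHom_monomial {r : ℕ}
    (h : ∀ a, (φ (.X a)).IsHomogeneous r) (α : Fin N →₀ ℕ) :
    (φ (monomial α 1)).IsHomogeneous (r * ∑ a, α a) := by
  rw [algHom_monomial_one, Finset.mul_sum]
  exact IsHomogeneous.prod _ _ _ fun a _ => (h a).pow _

end Substitution

namespace GradedRegular

variable {N r : ℕ} {f : Fin N → MvPolynomial (Fin N) ℂ}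

/-- The basis of monomials in the variables `∑ c, M a c X_c`. -/
def substBasis {M M' : Matrix (Fin N) (Fin N) ℂ} (h : M * M' = 1) :
    Module.Basis (Fin N →₀ ℕ) ℂ (MvPolynomial (Fin N) ℂ) :=
  (basisMonomials (Fin N) ℂ).map
    (LinearEquiv.ofBijective (linSubst M).toLinearMap (linSubst_bijective h))

theorem substBasis_apply {M M' : Matrix (Fin N) (Fin N) ℂ} (h : M * M' = 1) (α : Fin N →₀ ℕ) :
    substBasis h α = linSubst M (monomial α 1) := by
  rw [substBasis, Module.Basis.map_apply, coe_basisMonomials]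
  rfl

/-- The basis of the products of the `u s` with the monomials in `∑ c, M a c f_c`. -/
def liftedBasis {m : ℕ} {u : Fin m → MvPolynomial (Fin N) ℂ} {δ : Fin m → ℕ}
    (hf : FlagSystem r f) (hu : IsLiftedBasis (Ideal.span (Set.range f)) u δ)
    {M M' : Matrix (Fin N) (Fin N) ℂ} (h : M * M' = 1) :
    Module.Basis (Σ _ : Fin m, Fin N →₀ ℕ) ℂ (MvPolynomial (Fin N) ℂ) :=
  (Pi.basis fun _ : Fin m => basisMonomials (Fin N) ℂ).map
    ((LinearEquiv.piCongrRight fun _ : Fin m =>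
      LinearEquiv.ofBijective (linSubst M).toLinearMap (linSubst_bijective h)).trans
      (LinearEquiv.ofBijective (freeMap f u) (hu.freeMap_bijective hf)))

theorem liftedBasis_apply {m : ℕ} {u : Fin m → MvPolynomial (Fin N) ℂ} {δ : Fin m → ℕ}
    (hf : FlagSystem r f) (hu : IsLiftedBasis (Ideal.span (Set.range f)) u δ)
    {M M' : Matrix (Fin N) (Fin N) ℂ} (h : M * M' = 1) (x : Σ _ : Fin m, Fin N →₀ ℕ) :
    liftedBasis hf hu h x = u x.1 * ((aeval f).comp (linSubst M)) (monomial x.2 1) := by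
  rw [liftedBasis, Module.Basis.map_apply, Pi.basis_apply, LinearEquiv.trans_apply,
    LinearEquiv.ofBijective_apply, freeMap_apply, Finset.sum_eq_single x.1]
  · rw [LinearEquiv.piCongrRight_apply, Pi.single_eq_same, coe_basisMonomials]
    rfl
  · intro s _ hs
    simp [Pi.single_eq_of_ne hs]
  · simp

/-- The graded trace of a diagonalizable automorphism, computed with the two bases. -/
theorem geomProd_eq_sum (hf : FlagSystem r f) (hr : r ≠ 0)
    {M₁ M₁' M₂ M₂' : Matrix (Fin N) (Fin N) ℂ} (h₁ : M₁ * M₁' = 1) (h₂ : M₂ * M₂' = 1)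
    {T : MvPolynomial (Fin N) ℂ →ₐ[ℂ] MvPolynomial (Fin N) ℂ} {κ₁ κ₂ : Fin N → ℂ}
    (hT₁ : ∀ a, T (linSubst M₁ (.X a)) = κ₁ a • linSubst M₁ (.X a))
    (hT₂ : ∀ a, T (aeval f (linSubst M₂ (.X a))) = κ₂ a • aeval f (linSubst M₂ (.X a))) :
    ∃ (m : ℕ) (u : Fin m → MvPolynomial (Fin N) ℂ) (δ : Fin m → ℕ) (c : Fin m → ℂ),
      IsLiftedBasis (Ideal.span (Set.range f)) u δ ∧ (∀ s, T (u s) = c s • u s) ∧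
      ((∀ a, κ₁ a = 1) → ∀ s, c s = 1) ∧
      geomProd κ₁ = ∑ s, PowerSeries.C (c s) * PowerSeries.X ^ δ s *
        (geomProd κ₂).expand r hr := by
  classical
  have hX : ∀ (M : Matrix (Fin N) (Fin N) ℂ) a, (linSubst M (.X a)).IsHomogeneous 1 := fun M a => by
    rw [linSubst_X]
    exact Submodule.sum_mem (homogeneousSubmodule _ _ 1) fun c _ =>
      Submodule.smul_mem _ _ (isHomogeneous_X ℂ c)
  have hhom₁ : ∀ α, (substBasis h₁ α).IsHomogeneous (∑ a, α a) := fun α => by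
    rw [substBasis_apply]
    simpa using isHomogeneous_algHom_monomial (hX M₁) α
  have heig₁ : ∀ α, T.toLinearMap (substBasis h₁ α) = (∏ a, κ₁ a ^ α a) • substBasis h₁ α :=
    fun α => by
      rw [substBasis_apply]
      exact algHom_monomial_of_diagonal hT₁ α
  -- The lifts of the basis of the quotient are chosen among monomials in eigencoordinates, so that
  -- T is diagonal on them as well.
  obtain ⟨m, e, hu⟩ := hf.exists_isLiftedBasis (substBasis h₁) _ hhom₁ (substBasis h₁).span_eq
  refine ⟨m, _, _, fun s => ∏ a, κ₁ a ^ e s a, hu, fun s => heig₁ (e s), fun h s => ?_, ?_⟩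
  · simp [h]
  have hfX : ∀ a, (((aeval f).comp (linSubst M₂)) (.X a)).IsHomogeneous r := fun a => by
    rw [AlgHom.comp_apply, linSubst_X, map_sum]
    refine Submodule.sum_mem (homogeneousSubmodule _ _ r) fun c _ => ?_
    rw [map_smul, aeval_X]
    exact Submodule.smul_mem _ _ (hf.homogeneous c)
  have hhom₂ : ∀ x, (liftedBasis hf hu h₂ x).IsHomogeneous
      ((∑ a, e x.1 a) + r * ∑ a, x.2 a) := fun x => by
    rw [liftedBasis_apply]
    exact (hhom₁ _).mul (isHomogeneous_algHom_monomial hfX _)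
  have heig₂ : ∀ x, T.toLinearMap (liftedBasis hf hu h₂ x) =
      ((∏ a, κ₁ a ^ e x.1 a) * ∏ a, κ₂ a ^ x.2 a) • liftedBasis hf hu h₂ x := fun x => by
    rw [liftedBasis_apply, AlgHom.toLinearMap_apply, map_mul,
      algHom_monomial_of_diagonal (φ := (aeval f).comp (linSubst M₂)) hT₂, mul_smul_comm]
    have := heig₁ (e x.1)
    rw [AlgHom.toLinearMap_apply] at this
    rw [this, smul_mul_assoc, smul_smul, mul_comm]
  ext d
  rw [coeff_geomProd, map_sum]
  simp only [PowerSeries.coeff_C_mul_X_pow_mul_expand, coeff_geomProd, Finset.mul_sum]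
  -- In the second basis the elements of degree d with first factor u_s correspond to the exponents
  -- of total degree (d - δ_s) / r, and there are none unless this is a natural number.
  rw [sum_eigenvalues_eq hhom₁ hhom₂ heig₁ heig₂ (d := d)
    (F' := Finset.univ.sigma fun s => if ∑ a, e s a ≤ d ∧ r ∣ d - ∑ a, e s a then
      Finset.finsuppAntidiag Finset.univ ((d - ∑ a, e s a) / r) else ∅), Finset.sum_sigma]
  · refine Finset.sum_congr rfl fun s _ => ?_
    split_ifs <;> simp
  · intro α
    simp [Finset.mem_finsuppAntidiag]
  · rintro ⟨s, β⟩
    simp only [Finset.mem_sigma, Finset.mem_univ, true_and]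
    have hr' := Nat.pos_of_ne_zero hr
    split_ifs with h
    · obtain ⟨h1, q, hq⟩ := h
      simp only [Finset.mem_finsuppAntidiag, Finset.subset_univ, and_true, hq,
        Nat.mul_div_cancel_left q hr']
      constructor
      · intro h; rw [h]; omega
      · intro h; exact Nat.eq_of_mul_eq_mul_left hr' (show r * ∑ a, β a = r * q by omega)
    · simp only [Finset.notMem_empty, false_iff]
      intro h'
      exact h ⟨by omega, ∑ a, β a, by omega⟩

end GradedRegular

end

/-! ### Character and dimension of V_k -/

noncomputable section

open MvPolynomial

namespace Cherednik

open GradedRegular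

variable {N r : ℕ}

theorem dual_coord_of_diagonal {g : Equiv.Perm (Fin (N + 1))}
    {b : Module.Basis (Fin N) ℂ (Hsp (N + 1))} {c : Fin N → ℂ}
    (hb : ∀ a, reflRep (N + 1) g (b a) = c a • b a) (hc : ∀ a, c a ≠ 0) (a : Fin N) :
    (reflRep (N + 1)).dual g (b.coord a) = (c a)⁻¹ • b.coord a := by
  refine b.ext fun d => ?_
  have h : reflRep (N + 1) g⁻¹ (b d) = (c d)⁻¹ • b d := by
    have h1 : reflRep (N + 1) g⁻¹ (reflRep (N + 1) g (b d)) = b d := by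
      rw [← Module.End.mul_apply, ← map_mul]; simp
    rw [hb, map_smul] at h1
    rw [← h1, smul_smul, inv_mul_cancel₀ (hc d), one_smul]
    exact h1.symm ▸ rfl
  rw [Representation.dual_apply, Module.Dual.transpose_apply, LinearMap.comp_apply, h, map_smul,
    LinearMap.smul_apply, Module.Basis.coord_apply, Module.Basis.repr_self, Finsupp.single_apply]
  split_ifs with h
  · rw [h]
  · simp

theorem linSubst_toMatrix_X (b : Module.Basis (Fin N) ℂ (Hsp (N + 1))) (a : Fin N) :
    linSubst (b.toMatrix (hBasis N)) (.X a) = linForm N (b.coord a) := by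
  rw [linSubst_X]
  rfl

theorem aeval_linSubst_toMatrix_X (b : Module.Basis (Fin N) ℂ (Hsp (N + 1))) (a : Fin N) :
    aeval (fun a : Fin N => fA N r a.castSucc)
      (linSubst ((hBasis N).toMatrix b).transpose (.X a)) = fLin N r (b a) := by
  rw [linSubst_X, map_sum]
  conv_rhs => rw [← (hBasis N).sum_repr (b a), map_sum]
  refine Finset.sum_congr rfl fun c _ => ?_
  rw [map_smul, map_smul, aeval_X, fLin_hBasis]
  rfl

/-- If g has eigenvalues κ_a on 𝔥, it has eigenvalues κ_a⁻¹ on the coordinate functions but again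
κ_a on the f's, which transform like 𝔥. Comparing graded traces and clearing the geometric series
gives a polynomial identity for the graded trace P of g on V_k. -/
theorem exists_diagonalization (hr : 0 < r) (hrn : Nat.gcd r (N + 1) = 1)
    (g : Equiv.Perm (Fin (N + 1))) :
    ∃ (b : Module.Basis (Fin N) ℂ (Hsp (N + 1))) (κ : Fin N → ℂ) (m : ℕ)
      (u : Fin m → MvPolynomial (Fin N) ℂ) (δ : Fin m → ℕ) (c : Fin m → ℂ),
      (∀ a, reflRep (N + 1) g (b a) = κ a • b a) ∧ (∀ a, ‖κ a‖ = 1) ∧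
      IsLiftedBasis (fIdeal N r) u δ ∧ (∀ s, act N g (u s) = c s • u s) ∧
      ((∀ a, κ a = 1) → ∀ s, c s = 1) ∧
      (∑ s, Polynomial.C (c s) * Polynomial.X ^ δ s) *
          ∏ a, (1 - Polynomial.C (κ a)⁻¹ * Polynomial.X) =
        ∏ a, (1 - Polynomial.C (κ a) * Polynomial.X ^ r) := by
  have hg : reflRep (N + 1) g ^ orderOf g = 1 := by rw [← map_pow, pow_orderOf_eq_one, map_one]
  obtain ⟨b, κ, hb, hκ⟩ := Module.End.exists_basis_of_pow_eq_one (finrank_Hsp (N := N))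
    (reflRep (N + 1) g) (orderOf_pos g) hg
  have hn : ∀ a, ‖κ a‖ = 1 := fun a =>
    Complex.norm_eq_one_of_pow_eq_one (hκ a) (orderOf_pos g).ne'
  have h0 : ∀ a, κ a ≠ 0 := fun a h => by simpa [h] using hn a
  -- The coordinates dual to b and the polynomials f_b transform contragrediently, hence the two
  -- matrices, the second being the inverse transpose of the first.
  obtain ⟨m, u, δ, c, hu, hc, hone, hgen⟩ := geomProd_eq_sum (flagSystem_fA hr hrn) hr.ne'
    (M₁ := b.toMatrix (hBasis N)) (M₁' := (hBasis N).toMatrix b)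
    (M₂ := ((hBasis N).toMatrix b).transpose) (M₂' := (b.toMatrix (hBasis N)).transpose)
    (T := act N g) (κ₁ := fun a => (κ a)⁻¹) (κ₂ := κ)
    (Module.Basis.toMatrix_mul_toMatrix_flip _ _)
    (by rw [← Matrix.transpose_mul, Module.Basis.toMatrix_mul_toMatrix_flip,
          Matrix.transpose_one])
    (fun a => by
      rw [linSubst_toMatrix_X, act_linForm, dual_coord_of_diagonal hb h0, map_smul])
    (fun a => by
      rw [aeval_linSubst_toMatrix_X, act_fLin hr, hb, map_smul])
  refine ⟨b, κ, m, u, δ, c, hb, hn, hu, hc, fun h => hone fun a => by simp [h], ?_⟩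
  apply Polynomial.coe_injective ℂ
  simp only [← Polynomial.coeToPowerSeries.ringHom_apply, map_mul, map_prod, map_sum, map_sub,
    map_one, map_pow]
  simp only [Polynomial.coeToPowerSeries.ringHom_apply, Polynomial.coe_C, Polynomial.coe_X]
  rw [← Finset.sum_mul] at hgen
  have h1 := geomProd_mul fun a => (κ a)⁻¹
  have h2 := expand_geomProd_mul hr.ne' κ
  generalize (∑ s, PowerSeries.C (c s) * PowerSeries.X ^ δ s) = P at *
  rw [hgen] at h1
  generalize (geomProd κ).expand r hr.ne' = E at *
  generalize (∏ a, (1 - PowerSeries.C (κ a)⁻¹ * PowerSeries.X)) = A at *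
  generalize (∏ a, (1 - PowerSeries.C (κ a) * PowerSeries.X ^ r)) = B at *
  linear_combination B * h1 - P * A * h2

section Lifted

variable {m : ℕ} {u : Fin m → MvPolynomial (Fin N) ℂ} {δ : Fin m → ℕ} {c : Fin m → ℂ}

/-- The basis of `V_k` given by a lifted basis. -/
def basisV (hr : 0 < r) (hu : IsLiftedBasis (fIdeal N r) u δ) :
    Module.Basis (Fin m) ℂ (Vmod (N + 1) r) :=
  Module.Basis.mk (v := fun s => toV N r (u s))
    (by
      rw [Fintype.linearIndependent_iff]
      intro c hc
      refine congrFun (hu.indep c ((toV_eq_zero_iff hr _).1 ?_))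
      simpa only [map_sum, ← smul_eq_C_mul, map_smul] using hc)
    (by
      intro x _
      obtain ⟨p, rfl⟩ := toV_surjective x
      obtain ⟨c, hc⟩ := hu.span p
      rw [← toV_eq_zero_iff hr, map_sub, sub_eq_zero] at hc
      rw [hc, map_sum]
      refine Submodule.sum_mem _ fun s _ => ?_
      rw [← smul_eq_C_mul, map_smul]
      exact Submodule.smul_mem _ _ (Submodule.subset_span ⟨s, rfl⟩))

theorem basisV_apply (hr : 0 < r) (hu : IsLiftedBasis (fIdeal N r) u δ) (s : Fin m) :
    basisV hr hu s = toV N r (u s) := by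
  rw [basisV, Module.Basis.mk_apply]

theorem weightTrace_Vmod (hr : 0 < r) (hu : IsLiftedBasis (fIdeal N r) u δ)
    {g : Equiv.Perm (Fin (N + 1))} (hc : ∀ s, act N g (u s) = c s • u s) (μ : ℂ) :
    weightTrace (N + 1) (kpar (N + 1) r) (Vmod (N + 1) r) g μ =
      ∑ s, if μ = δ s + baseWeight N r then c s else 0 := by
  classical
  have hE : ∀ s, Algebra.lsmul ℂ ℂ (Vmod (N + 1) r) (euler (N + 1) (kpar (N + 1) r))
      (basisV hr hu s) = ((δ s : ℂ) + baseWeight N r) • basisV hr hu s := fun s => by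
    rw [basisV_apply]
    exact euler_smul_toV (hu.homogeneous s)
  have hg : ∀ s, Algebra.lsmul ℂ ℂ (Vmod (N + 1) r) (W (N + 1) (kpar (N + 1) r) g)
      (basisV hr hu s) = c s • basisV hr hu s := fun s => by
    rw [basisV_apply, ← map_smul, ← hc]
    exact W_smul_toV g _
  rw [← Finset.sum_filter]
  refine (basisV hr hu).trace_restrict_of_diagonal hg _ ?_ _
  refine ((basisV hr hu).maxGenEigenspace_of_diagonal hE μ).trans ?_
  congr 2
  ext s
  simp [eq_comm]

/-- Only finitely many weights occur; summing over the basis of V_k instead of over weights avoids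
having to know which degrees coincide. -/
theorem character_Vmod (hr : 0 < r) (hu : IsLiftedBasis (fIdeal N r) u δ)
    {g : Equiv.Perm (Fin (N + 1))} (hc : ∀ s, act N g (u s) = c s • u s) {t : ℝ} (ht : 0 < t) :
    character (N + 1) (kpar (N + 1) r) (Vmod (N + 1) r) g t =
      (t : ℂ) ^ baseWeight N r * ∑ s, c s * (t : ℂ) ^ δ s := by
  have h0 : (t : ℂ) ≠ 0 := by exact_mod_cast ht.ne'
  have h : HasSum (fun μ : ℂ => ∑ s, if μ = δ s + baseWeight N r then
      c s * (t : ℂ) ^ ((δ s : ℂ) + baseWeight N r) else 0)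
      (∑ s, c s * (t : ℂ) ^ ((δ s : ℂ) + baseWeight N r)) :=
    hasSum_sum fun s _ => hasSum_ite_eq _ _
  rw [character, Finset.mul_sum]
  refine Eq.trans (congrArg tsum (funext fun μ => ?_)) (h.tsum_eq.trans ?_)
  · rw [weightTrace_Vmod hr hu hc, Finset.sum_mul]
    refine Finset.sum_congr rfl fun s _ => ?_
    split_ifs with hμ
    · rw [hμ]
    · rw [zero_mul]
  · refine Finset.sum_congr rfl fun s _ => ?_
    rw [Complex.cpow_add _ _ h0, Complex.cpow_natCast]
    ring

end Lifted

/-- A permutation and its inverse have the same cycle type and so are conjugate. This replaces the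
κ_a⁻¹ of the denominator by the κ_a of the stated formula. -/
theorem det_reflRep_inv {n : ℕ} (g : Equiv.Perm (Fin n)) (t : ℂ) :
    LinearMap.det (1 - t • reflRep n g⁻¹) = LinearMap.det (1 - t • reflRep n g) := by
  obtain ⟨h, hh⟩ := isConj_iff.1 ((Equiv.Perm.isConj_iff_cycleType_eq (σ := g) (τ := g⁻¹)).2
    (Equiv.Perm.cycleType_inv g).symm)
  have h1 : reflRep n h * reflRep n h⁻¹ = 1 := by rw [← map_mul, mul_inv_cancel, map_one]
  have e : 1 - t • reflRep n g⁻¹ = reflRep n h * (1 - t • reflRep n g) * reflRep n h⁻¹ := by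
    rw [mul_sub, sub_mul, mul_one, h1, mul_smul_comm, smul_mul_assoc, ← hh, map_mul, map_mul]
  have h2 := congrArg LinearMap.det h1
  rw [map_mul, map_one] at h2
  rw [e, map_mul, map_mul]
  linear_combination LinearMap.det (1 - t • reflRep n g) * h2

theorem character_formula (hr : 0 < r) (hrn : Nat.gcd r (N + 1) = 1)
    (g : Equiv.Perm (Fin (N + 1))) {t : ℝ} (ht : 0 < t) (ht1 : t ≠ 1) :
    character (N + 1) (kpar (N + 1) r) (Vmod (N + 1) r) g t =
      (t : ℂ) ^ baseWeight N r * (LinearMap.det (1 - (t : ℂ) ^ r • reflRep (N + 1) g) /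
        LinearMap.det (1 - (t : ℂ) • reflRep (N + 1) g)) := by
  obtain ⟨b, κ, m, u, δ, c, hb, hκ, hu, hc, -, hP⟩ := exists_diagonalization hr hrn g
  have h0 : ∀ a, κ a ≠ 0 := fun a h => by simpa [h] using hκ a
  have hb' : ∀ a, reflRep (N + 1) g⁻¹ (b a) = (κ a)⁻¹ • b a := fun a => by
    have h1 : reflRep (N + 1) g⁻¹ (reflRep (N + 1) g (b a)) = b a := by
      rw [← Module.End.mul_apply, ← map_mul]; simp
    rw [hb, map_smul] at h1
    rw [eq_inv_smul_iff₀ (h0 a), h1]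
  rw [character_Vmod hr hu hc ht, b.det_one_sub_smul_of_diagonal hb, ← det_reflRep_inv,
    b.det_one_sub_smul_of_diagonal hb']
  congr 1
  -- A zero factor would give |t| = |κ_a| = 1, which is excluded since t > 0 and t ≠ 1.
  have hne : ∏ a, (1 - (t : ℂ) * (κ a)⁻¹) ≠ 0 := by
    refine Finset.prod_ne_zero_iff.2 fun a _ h => ht1 ?_
    have := congrArg norm (sub_eq_zero.1 h)
    rw [norm_mul, norm_inv, hκ, norm_one, inv_one, mul_one, Complex.norm_real, Real.norm_eq_abs,
      abs_of_pos ht] at this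
    exact this.symm
  rw [eq_div_iff hne]
  have h := congrArg (Polynomial.eval (t : ℂ)) hP
  simp only [Polynomial.eval_mul, Polynomial.eval_prod, Polynomial.eval_finsetSum,
    Polynomial.eval_sub, Polynomial.eval_one, Polynomial.eval_C, Polynomial.eval_X,
    Polynomial.eval_pow] at h
  simpa only [mul_comm (t : ℂ), mul_comm ((t : ℂ) ^ r)] using h

/-- For g = 1 the identity reads P(X) (1 - X)^N = (1 - X^r)^N with P(1) = dim V_k. Cancelling (1 -
X)^N as polynomials leaves P = (1 + X + ⋯ + X^(r-1))^N, which can be evaluated at 1. -/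
theorem finite_and_finrank_Vmod (hr : 0 < r) (hrn : Nat.gcd r (N + 1) = 1) :
    Module.Finite ℂ (Vmod (N + 1) r) ∧ Module.finrank ℂ (Vmod (N + 1) r) = r ^ N := by
  obtain ⟨b, κ, m, u, δ, c, hb, -, hu, -, hone, hP⟩ := exists_diagonalization hr hrn 1
  have hκ : ∀ a, κ a = 1 := fun a => by
    have h := congrArg (fun x => b.repr x a) (hb a)
    simpa using h.symm
  refine ⟨Module.Finite.of_basis (basisV hr hu), ?_⟩
  rw [Module.finrank_eq_card_basis (basisV hr hu), Fintype.card_fin]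
  simp only [hone hκ, hκ, inv_one, map_one, one_mul, Finset.prod_const, Finset.card_univ,
    Fintype.card_fin, ← mul_neg_geom_sum, mul_pow] at hP
  rw [mul_comm] at hP
  have h1 : (1 - Polynomial.X : Polynomial ℂ) ≠ 0 := by
    rw [← neg_ne_zero, neg_sub]
    exact Polynomial.X_sub_C_ne_zero (1 : ℂ)
  have h := congrArg (Polynomial.eval 1) (mul_left_cancel₀ (pow_ne_zero _ h1) hP)
  simp [Polynomial.eval_finsetSum] at h
  exact_mod_cast h

end Cherednik

end
theorem mainTheorem9 (n r : ℕ) (hn : 0 < n) (hr : 0 < r) (hrn : Nat.gcd r n = 1) :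
    Module.Finite ℂ (Cherednik.Vmod n r) ∧
    IsSimpleModule (Cherednik.Alg n (Cherednik.kpar n r)) (Cherednik.Vmod n r) ∧
    Cherednik.HasBGGResolution n r ∧
    (∀ (g : Equiv.Perm (Fin n)) (t : ℝ), 0 < t → t ≠ 1 →
      Cherednik.character n (Cherednik.kpar n r) (Cherednik.Vmod n r) g t =
        (t : ℂ) ^ ((1 - (r : ℂ)) * ((n : ℂ) - 1) / 2) *
          (LinearMap.det (1 - (t : ℂ) ^ r • Cherednik.reflRep n g) /
            LinearMap.det (1 - (t : ℂ) • Cherednik.reflRep n g))) ∧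
    Module.finrank ℂ (Cherednik.Vmod n r) = r ^ (n - 1) := by
  obtain ⟨N, rfl⟩ := Nat.exists_eq_succ_of_ne_zero hn.ne'
  obtain ⟨hfin, hdim⟩ := Cherednik.finite_and_finrank_Vmod hr hrn
  refine ⟨hfin, Cherednik.isSimpleModule_Vmod hr hrn, Cherednik.hasBGGResolution hr hrn,
    fun g t ht ht1 => ?_, hdim⟩
  have h : (1 - (r : ℂ)) * ((N.succ : ℂ) - 1) / 2 = Cherednik.baseWeight N r := by
    rw [Cherednik.baseWeight, Nat.cast_succ, add_sub_cancel_right]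
  rw [h]
  exact Cherednik.character_formula hr hrn g ht ht1
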